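/- **Symbols.** Write $\langle x\rangle=\sqrt{x^2+1}$. For $r\in\mathbb R$, $\mathcal S^r(\mathbb R_{\ge 0})$ is the set of smooth $\sigma:\mathbb R_{\ge0}\to\mathbb C$ such that for every $k\ge 0$ there is $D_k>0$ with $|\partial_x^k\sigma(x)|\le D_k\langle x\rangle^{r-k}$ on $\mathbb R_{\ge0}$. An excision function is a smooth $\chi:\mathbb R_{\ge0}\to\mathbb R$ that vanishes near $0$ and equals $1$ for all large $x$. For $\alpha\in\mathbb C$, $\mathcal S^\alpha_{\rm ph}$ is the space of $\sigma\in\mathcal S^{\Re\alpha}(\mathbb R_{\ge0})$ with an expansion $\sigma\sim\sum_{j\ge0}a_jx^{\alpha-j}$, i.e. for some excision function $\chi$ and all $N\ge1$ the remainder $\sigma^\chi_{(N)}=\sigma-\sum_{j<N}\chi\,a_jx^{\alpha-j}$ lies in $\mathcal S^{\Re\alpha-N}(\mathbb R_{\ge0})$ ($a_0=0$ is allowed). The finite part at infinity of such a $\sigma$ is $\underset{+\infty}{\rm fp}\,\sigma=\sum_j a_j\delta_{\alpha-j,0}$; it is extended linearly to $\sum_{\alpha\in\mathbb C}\mathcal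 S^\alpha_{\rm ph}$. **Linear forms.** Let $Q$ be an inner product on $\mathbb R^\infty=\bigcup_k\mathbb R^k$. Use it to identify $v\in\mathbb R^\infty$ with a linear form and use coordinates $z_i=Q(z,e_i)$: the real linear forms on $\mathbb C^k$ are $\ell_v(z)=\sum_i v_iz_i$, $v\in\mathbb R^k$, the inner product of $\ell_u$ and $\ell_v$ is $Q(u,v)$, and a germ on $\mathbb C^k$ is viewed as a germ on $\mathbb C^{k+1}$ that does not depend on $z_{k+1}$. All germs below are germs at $0$ of maps defined near $0$ outside finitely many hyperplanes $\{\ell_v=0\}$, $v\ne0$; two such maps have the same germ if they agree near $0$ outside finitely many such hyperplanes. **Meromorphic germs.** $\mathcal M(\mathbb C^k)$ is the space of germs $h/(\ell_{v_1}\cdots\ell_{v_n})$ with $h$ holomorphic at $0$ (with complex values) and $v_i\in\mathbb R^k\setminus\{0\}$, and $\mathcal M(\mathbb C^\infty)=\bigcup_k\mathcal M(\mathbb C^k)$. A simple holomorphic family of symbols on an open $U\subset\mathbb C^k$ of affine order $\alpha(z)=L(z)+c$ ($L$ a real linear form, $c\in\mathbb R$) is a family $\tau(z)\in\mathcal S_{\rm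 ph}^{\alpha(z)}$, $z\in U$, with expansions $\tau(z)\sim\sum_ja_j(z)x^{\alpha(z)-j}$, such that for all excision functions $\chi$, all $N\ge1$ and $d\ge0$, the function $z\mapsto\partial_x^d\tau^\chi_{(N)}(z)(x)$ is holomorphic on $U$ for every $x\ge 0$, and for all compact $K\subset U$, $n\ge0$ and $\epsilon>0$ there is $C>0$ with $$\bigl|\partial_z^n\partial_x^d\tau^\chi_{(N)}(z)(x)\bigr|\le C\langle x\rangle^{\Re\alpha(z)-N-d+\epsilon}\qquad(z\in K,\ x\ge0).$$ A simple meromorphic germ of symbols of affine order $\alpha$ on $\mathbb C^k$ is a germ $\tau/(\ell_{v_1}\cdots\ell_{v_n})$ with $v_i\in\mathbb R^k\setminus\{0\}$ and $\tau$ a simple holomorphic family of affine order $\alpha$ on a neighbourhood of $0$. Their linear span is $\mathcal{MS}^\alpha(\mathbb C^k)$, and $\mathcal{MS}(\mathbb C^k)$ is the span of all of these over all $\alpha$. The space $\Omega$ is the complex linear span of all $\mathcal{MS}^{L+c}(\mathbb C^k)$ with $k\ge1$, $L\neq0$, $c\in\mathbb R$, and of all products $f\cdot P$ with $f\in\mathcal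 M(\mathbb C^\infty)$ and $P$ a real polynomial function of $x\in\mathbb R_{\ge0}$. For a germ $\sigma\in\Omega$, $\underset{+\infty}{\rm fp}(\sigma)$ is the germ of $z\mapsto\underset{+\infty}{\rm fp}(\sigma(z))$. **Independence.** A germ of symbols (resp. of functions) $g$ depends on the space of real linear forms with basis $\ell_{v_1},\dots,\ell_{v_m}$ if $g(z)=\tau(\ell_{v_1}(z),\dots,\ell_{v_m}(z))$ for some $\tau\in\mathcal{MS}(\mathbb C^m)$ (resp. $\tau\in\mathcal M(\mathbb C^m)$). The dependence space of $g$ is the smallest space on which $g$ depends (the intersection of all such spaces), and $g_1\perp^Qg_2$ means that the dependence spaces of $g_1$ and $g_2$ are $Q$-orthogonal. **Proposition.** The finite part at infinity defines a linear map $\underset{+\infty}{\rm fp}:\Omega\to\mathcal M(\mathbb C^\infty)$ that is a morphism of locality algebras: $1\in\Omega$ and $\underset{+\infty}{\rm fp}(1)=1$, and for all $\sigma_1,\sigma_2\in\Omega$ with $\sigma_1\perp^Q\sigma_2$ one has $\underset{+\infty}{\rm fp}(\sigma_1)\perp^Q\underset{+\infty}{\rm fp}(\sigma_2)$, $\sigma_1\sigma_2\in\Omega$,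 and $$\underset{+\infty}{\rm fp}(\sigma_1\sigma_2)=\underset{+\infty}{\rm fp}(\sigma_1)\cdot\underset{+\infty}{\rm fp}(\sigma_2).$$ -/

import Mathlib

open Filter Topology
open scoped NNReal ContDiff

noncomputable section

namespace LocSymb

/-! ### Polyhomogeneous symbols on the half line -/

/-- Extension of a function on `[0, ∞)` to `ℝ`; it is only ever used on `Set.Ici 0`. -/
def ext (σ : ℝ≥0 → ℂ) (x : ℝ) : ℂ := σ x.toNNReal

/-- `k`-th derivative of a function on `[0, ∞)` (one-sided at `0`). -/
def dx (k : ℕ) (σ : ℝ≥0 → ℂ) (x : ℝ≥0) : ℂ :=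
  iteratedDerivWithin k (ext σ) (Set.Ici 0) (x : ℝ)

/-- The Japanese bracket `⟨x⟩ = √(x² + 1)`. -/
def bracket (x : ℝ≥0) : ℝ := Real.sqrt ((x : ℝ) ^ 2 + 1)

/-- `σ` is a (smooth) symbol satisfying `|∂ₓᵏ σ(x)| ≤ D_k ⟨x⟩^(r-k)` on `[0, ∞)`. -/
def IsSymbol (r : ℝ) (σ : ℝ≥0 → ℂ) : Prop :=
  ContDiffOn ℝ ∞ (ext σ) (Set.Ici 0) ∧
    ∀ k : ℕ, ∃ D : ℝ, 0 < D ∧ ∀ x : ℝ≥0, ‖dx k σ x‖ ≤ D * bracket x ^ (r - k)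

/-- Excision functions: smooth real functions on `[0, ∞)`, zero near `0` and one near `∞`. -/
structure IsExcision (χ : ℝ≥0 → ℝ) : Prop where
  smooth : ContDiffOn ℝ ∞ (fun x : ℝ => χ x.toNNReal) (Set.Ici 0)
  zero_near : ∃ δ : ℝ≥0, 0 < δ ∧ ∀ x < δ, χ x = 0
  one_far : ∃ R : ℝ≥0, ∀ x > R, χ x = 1

/-- The remainder `σ(x) - ∑_{j<N} χ(x) a_j x^(α-j)`. -/
def remainder (χ : ℝ≥0 → ℝ) (α : ℂ) (a : ℕ → ℂ) (N : ℕ) (σ : ℝ≥0 → ℂ) : ℝ≥0 → ℂ :=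
  fun x => σ x - ∑ j ∈ Finset.range N, (χ x : ℂ) * a j * ((x : ℝ) : ℂ) ^ (α - j)

/-- `σ ∼ ∑_j a_j x^(α-j)`. The coefficient `a 0` may vanish, so that
`{σ | ∃ a, HasExpansion σ α a}` is the linear span of the polyhomogeneous symbols of order
exactly `α`. -/
def HasExpansion (σ : ℝ≥0 → ℂ) (α : ℂ) (a : ℕ → ℂ) : Prop :=
  IsSymbol α.re σ ∧
    ∃ χ, IsExcision χ ∧ ∀ N : ℕ, 1 ≤ N → IsSymbol (α.re - N) (remainder χ α a N σ)

/-- The constant term `∑_j a_j δ_{α-j,0}` of an expansion (at most one term is nonzero). -/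
def constTerm (α : ℂ) (a : ℕ → ℂ) : ℂ :=
  ∑ᶠ j : ℕ, if α - (j : ℂ) = 0 then a j else 0

/-- `c` is the finite part at infinity of `σ`, computed from a decomposition of `σ` as a finite
sum of polyhomogeneous symbols (linear extension of the constant term). -/
def IsFinitePart (σ : ℝ≥0 → ℂ) (c : ℂ) : Prop :=
  ∃ (n : ℕ) (τ : Fin n → ℝ≥0 → ℂ) (α : Fin n → ℂ) (a : Fin n → ℕ → ℂ),
    (∀ i, HasExpansion (τ i) (α i) (a i)) ∧ σ = ∑ i, τ i ∧ c = ∑ i, constTerm (α i) (a i)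

open Classical in
/-- The finite part at infinity on the linear span of the polyhomogeneous symbols of all orders
(the value does not depend on the decomposition); junk value `0` elsewhere. -/
def finitePart (σ : ℝ≥0 → ℂ) : ℂ :=
  if h : ∃ c, IsFinitePart σ c then h.choose else 0

/-! ### Linear forms and germs at zero outside finitely many real hyperplanes

For `ι = Fin k` the space `ι → ℂ` is `ℂᵏ`. The space `ℕ → ℂ` carries all the functions of finitely
many of the variables `z₀, z₁, …`; a function on `ℂᵏ` is viewed as a function on it by forgetting
the other variables.

An inner product `Q` on `ℝ^∞` identifies a vector `v` of `ℝ^∞ = ℕ →₀ ℝ` with the real linear form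
`Q(v, ·)`. In the coordinates `zᵢ = Q(z, eᵢ)` this form is `ℓ_v(z) = ∑ vᵢ zᵢ`, the `Q`-orthogonal
projections `ℂᵏ⁺¹ → ℂᵏ`, along which germs on `ℂᵏ` are pulled back, forget the last coordinate, and
the inner product of `ℓ_u` and `ℓ_v` is `Q u v`. These coordinates are used throughout. -/

/-- The linear form with real coefficients `ℓ_v(z) = ∑ vᵢ zᵢ`. -/
def linForm {ι : Type} (v : ι →₀ ℝ) (z : ι → ℂ) : ℂ := v.sum fun i c => (c : ℂ) * z i

/-- Neighbourhoods of zero deprived of finitely many hyperplanes `ℓ_v = 0`, `v ≠ 0`. -/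
def polarNhds (ι : Type) : Filter (ι → ℂ) :=
  𝓝 0 ⊓ ⨅ v : {v : ι →₀ ℝ // v ≠ 0}, 𝓟 {z | linForm v.1 z ≠ 0}

/-- Germs at zero of functions defined outside finitely many real hyperplanes through zero. -/
abbrev FunGerm (ι : Type) := Germ (polarNhds ι) ℂ

/-- Germs at zero of families of functions on `[0, ∞)`, defined outside finitely many real
hyperplanes through zero. -/
abbrev SymbGerm (ι : Type) := Germ (polarNhds ι) (ℝ≥0 → ℂ)

/-- The product of the forms in a list (repetitions account for multiplicities). -/
def polarProd {ι : Type} (P : List (ι →₀ ℝ)) (z : ι → ℂ) : ℂ :=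
  (P.map fun p => linForm p z).prod

/-- `φ = (L₁, …, L_m)`. -/
def formMap {ι : Type} {m : ℕ} (L : Fin m → ι →₀ ℝ) (z : ι → ℂ) : Fin m → ℂ :=
  fun j => linForm (L j) z

/-- The first `k` variables. -/
def restr (k : ℕ) (z : ℕ → ℂ) : Fin k → ℂ := fun i => z i

/-- The direct limit of spaces of germs on `ℂᵏ`, `k → ∞`: the germs which only involve the first
`k` variables for some `k` and come from the given space of germs on `ℂᵏ`. -/
def limitGerms {β : Type} [AddCommGroup β] [Module ℂ β]
    (S : ∀ k : ℕ, Set (Germ (polarNhds (Fin k)) β)) : Set (Germ (polarNhds ℕ) β) :=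
  {g | ∃ (k : ℕ) (τ : (Fin k → ℂ) → β),
    (τ : Germ (polarNhds (Fin k)) β) ∈ S k ∧ g = ((fun z => τ (restr k z) : (ℕ → ℂ) → β) :
      Germ (polarNhds ℕ) β)}

/-! ### Meromorphic germs of functions with linear poles -/

/-- `𝓜(ℂᵏ)`: germs `h / (ℓ₁ ⋯ ℓₙ)` with `h` holomorphic at zero and `ℓᵢ` nonzero real linear
forms. (These germs already form a linear space.) -/
def meroFun (k : ℕ) : Submodule ℂ (FunGerm (Fin k)) :=
  Submodule.span ℂ {f | ∃ (h : (Fin k → ℂ) → ℂ) (P : List (Fin k →₀ ℝ)),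
    AnalyticAt ℂ h 0 ∧ (∀ p ∈ P, p ≠ 0) ∧
      f = ((fun z => (polarProd P z)⁻¹ * h z : (Fin k → ℂ) → ℂ) : FunGerm (Fin k))}

/-- `𝓜(ℂ^∞)`. -/
def meroFunInf : Submodule ℂ (FunGerm ℕ) :=
  Submodule.span ℂ (limitGerms fun k => (meroFun k : Set (FunGerm (Fin k))))

/-! ### Meromorphic germs of symbols with linear poles -/

/-- The affine order `α(z) = L(z) + c`. -/
def affOrder {k : ℕ} (L : Fin k →₀ ℝ) (c : ℝ) (z : Fin k → ℂ) : ℂ := linForm L z + (c : ℂ)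

/-- `σ` is on `U` a simple holomorphic family of symbols of affine order `α = L + c`. -/
def IsSimpleHolFamily {k : ℕ} (U : Set (Fin k → ℂ)) (L : Fin k →₀ ℝ) (c : ℝ)
    (σ : (Fin k → ℂ) → ℝ≥0 → ℂ) : Prop :=
  ∃ a : ℕ → (Fin k → ℂ) → ℂ,
    (∀ z ∈ U, HasExpansion (σ z) (affOrder L c z) (fun j => a j z)) ∧
    ∀ χ, IsExcision χ → ∀ N : ℕ, 1 ≤ N → ∀ d : ℕ,
      let R : ℝ≥0 → (Fin k → ℂ) → ℂ := fun x z =>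
        dx d (remainder χ (affOrder L c z) (fun j => a j z) N (σ z)) x
      (∀ x, AnalyticOnNhd ℂ (R x) U) ∧
      ∀ K ⊆ U, IsCompact K → ∀ (n : ℕ) (ε : ℝ), 0 < ε → ∃ C : ℝ, 0 < C ∧
        ∀ z ∈ K, ∀ x : ℝ≥0, ‖iteratedFDeriv ℂ n (R x) z‖ ≤
          C * bracket x ^ ((affOrder L c z).re - N - d + ε)

/-- Simple meromorphic germs of symbols on `ℂᵏ`, with linear poles and affine order `L + c`:
germs of `τ / (ℓ₁ ⋯ ℓₙ)`, with `τ` a simple holomorphic family of affine order `L + c` near zero and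
`ℓᵢ` nonzero real linear forms. -/
def IsSimpleMeroGerm {k : ℕ} (L : Fin k →₀ ℝ) (c : ℝ) (g : SymbGerm (Fin k)) : Prop :=
  ∃ (U : Set (Fin k → ℂ)) (τ : (Fin k → ℂ) → ℝ≥0 → ℂ) (P : List (Fin k →₀ ℝ)),
    IsOpen U ∧ 0 ∈ U ∧ IsSimpleHolFamily U L c τ ∧ (∀ p ∈ P, p ≠ 0) ∧
      g = ((fun z => (polarProd P z)⁻¹ • τ z : (Fin k → ℂ) → ℝ≥0 → ℂ) : SymbGerm (Fin k))

/-- `𝓜𝓢^α(ℂᵏ)`, `α = L + c`. -/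
def meroSymbOrder (k : ℕ) (L : Fin k →₀ ℝ) (c : ℝ) : Submodule ℂ (SymbGerm (Fin k)) :=
  Submodule.span ℂ {g | IsSimpleMeroGerm L c g}

/-- `𝓜𝓢(ℂᵏ)`. -/
def meroSymb (k : ℕ) : Submodule ℂ (SymbGerm (Fin k)) :=
  Submodule.span ℂ {g | ∃ L c, IsSimpleMeroGerm L c g}

/-- The products `f · p` of meromorphic germs of functions `f ∈ 𝓜(ℂ^∞)` with real polynomial
functions `p` on `[0, ∞)`. -/
def polySymb : Set (SymbGerm ℕ) :=
  {g | ∃ (f : (ℕ → ℂ) → ℂ) (p : Polynomial ℝ), (f : FunGerm ℕ) ∈ meroFunInf ∧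
    g = ((fun z x => f z * ((p.eval (x : ℝ) : ℝ) : ℂ) : (ℕ → ℂ) → ℝ≥0 → ℂ) : SymbGerm ℕ)}

/-- The space `Ω` of admissible meromorphic germs of symbols, generated by the meromorphic germs of
symbols of nonconstant affine order and by `𝓜(ℂ^∞) · 𝓟([0, ∞))`. -/
def Omega : Submodule ℂ (SymbGerm ℕ) :=
  Submodule.span ℂ
    (limitGerms (fun k => {g | ∃ (L : Fin k →₀ ℝ) (c : ℝ), L ≠ 0 ∧ g ∈ meroSymbOrder k L c})
      ∪ polySymb)

/-- The finite part at infinity of a germ of symbols, taken pointwise in `z`. -/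
def fpInf (g : SymbGerm ℕ) : FunGerm ℕ := g.map finitePart

/-! ### Dependence and independence -/

/-- `g` depends on the subspace `W` of linear forms: `g(z) = τ(L₁(z), …, L_m(z))`, where
`L₁, …, L_m` is a basis of `W` and the germ `τ` on `ℂᵐ` belongs to the class `S m`. (By linear
independence of the `Lᵢ`, the composition with a germ defined off real hyperplanes makes sense.) -/
def DependsOn {β : Type} [AddCommGroup β] [Module ℂ β]
    (S : ∀ k : ℕ, Submodule ℂ (Germ (polarNhds (Fin k)) β)) (g : Germ (polarNhds ℕ) β)
    (W : Submodule ℝ (ℕ →₀ ℝ)) : Prop :=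
  ∃ (m : ℕ) (L : Fin m → ℕ →₀ ℝ) (τ : (Fin m → ℂ) → β),
    LinearIndependent ℝ L ∧ Submodule.span ℝ (Set.range L) = W ∧
      (τ : Germ (polarNhds (Fin m)) β) ∈ S m ∧
      g = ((fun z => τ (formMap L z) : (ℕ → ℂ) → β) : Germ (polarNhds ℕ) β)

/-- The dependence subspace: the smallest subspace of linear forms on which `g` depends, obtained
as the intersection of all of them. -/
def depSpace {β : Type} [AddCommGroup β] [Module ℂ β]
    (S : ∀ k : ℕ, Submodule ℂ (Germ (polarNhds (Fin k)) β)) (g : Germ (polarNhds ℕ) β) :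
    Submodule ℝ (ℕ →₀ ℝ) :=
  sInf {W | DependsOn S g W}

/-- Independence of germs relative to `Q`: `Q`-orthogonality of the dependence subspaces. -/
def Indep {β : Type} [AddCommGroup β] [Module ℂ β]
    (S : ∀ k : ℕ, Submodule ℂ (Germ (polarNhds (Fin k)) β))
    (Q : LinearMap.BilinForm ℝ (ℕ →₀ ℝ)) (g₁ g₂ : Germ (polarNhds ℕ) β) : Prop :=
  ∀ u ∈ depSpace S g₁, ∀ v ∈ depSpace S g₂, Q u v = 0

end LocSymb

end

open LocSymb

/-!
The proof rests on two facts.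

*Expansions are unique.* A finite sum of powers `x ^ β`, `β ≠ 0`, cannot converge to a nonzero
constant (`eq_zero_of_tendsto_sum_cpow`), so a function has at most one family of coefficients
`β ↦ κ β` in the sense of `HasCoefs` (`HasCoefs.unique`). Hence the finite part is the coefficient of
`x ^ 0`, whatever the decomposition into polyhomogeneous symbols
(`IsFinitePart.finitePart_eq`), and it is linear. If the order `L(z) + c` has `L ≠ 0`, then for
generic `z` no exponent `L(z) + c - j` is an integer, and the finite part vanishes; on `f · P` it is
`f · P(0)`. So the finite part is meromorphic (`exists_hasFp_of_mem_Omega`).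

*Germs in `Ω` have a normal form on each space of forms on which they depend.* Let `σ ∈ Ω` be the
pull-back of `τ ∈ 𝓜𝓢(ℂᵐ)` along an injective linear map. A representation of `τ` may involve constant
orders `c`, although `σ` has one without them, except for polynomials in `x`. The
coefficients of `x ^ s` in the expansion of `σ`, for real `s ∉ ℕ`, vanish generically
(`Omega_le_natGerms`); by uniqueness this holds for `τ`. So the part of constant order of `τ` is,
up to a smoothing family, a polynomial in `x` with meromorphic coefficients, and `τ` is a combination
of smoothing families, of families whose order is nonconstant, and of monomials, all in the given
variables (`mem_span_basicGerms`).

For germs in normal form on independent spaces `W₁`, `W₂` of forms, the product can be expanded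
(`mul_mem_span_basicGerms`). The product of families of orders `L₁ + c₁` and `L₂ + c₂` has order
`L₁ + L₂ + c₁ + c₂`, and `L₁ + L₂ ≠ 0` unless `L₁ = L₂ = 0`, because `W₁ ∩ W₂ = 0`; so the product
is in `Ω`, and the only products with a nonzero finite part are those of two terms with a nonzero
finite part. Here smoothing families count as families of any nonconstant order, which is why they
belong to `Ω`. That products of simple holomorphic families are simple holomorphic families is the
Cauchy product of expansions (`HolExp.mul`); the estimates for derivatives with respect to `z` follow
from the Cauchy inequalities (`exists_norm_iteratedFDeriv_le_of_isCompact`).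

Finally, `σ` depends on its dependence space (`dependsOn_depSpace`), since the spaces on which it
depends are stable under intersection (`DependsOn.inf`). If `σ` depends on `W₁` and on `W₂`, then one
restricts it to a generic real translate of the subspace where the forms in a complement of
`W₁ ∩ W₂` in `W₂` vanish; independence of the remaining variables shows that nothing is lost.
Applying the finite part to `σ = τ ∘ (ℓ₁, …, ℓₘ)` shows that the finite part of `σ` depends on each
space on which `σ` depends (`DependsOn.map_finitePart`), so that orthogonality is preserved.
-/

namespace LocSymb

/-! ### Linear forms, transposed maps and the filter of generic points near zero -/

section LinearForms

variable {ι κ μ : Type}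

theorem linForm_add (u v : ι →₀ ℝ) (z : ι → ℂ) :
    linForm (u + v) z = linForm u z + linForm v z := by
  classical
  exact Finsupp.sum_add_index' (by simp) (by intros; push_cast; ring)

theorem linForm_smul (c : ℝ) (v : ι →₀ ℝ) (z : ι → ℂ) :
    linForm (c • v) z = (c : ℂ) * linForm v z := by
  unfold linForm
  rw [Finsupp.sum_smul_index (by simp), Finsupp.mul_sum]
  exact Finsupp.sum_congr fun i _ => by push_cast; ring

@[simp] theorem linForm_zero (z : ι → ℂ) : linForm (0 : ι →₀ ℝ) z = 0 := by simp [linForm]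

@[simp] theorem linForm_single (i : ι) (c : ℝ) (z : ι → ℂ) :
    linForm (Finsupp.single i c) z = (c : ℂ) * z i := by
  simp [linForm]

theorem linForm_add_right (v : ι →₀ ℝ) (y z : ι → ℂ) :
    linForm v (y + z) = linForm v y + linForm v z := by
  simp [linForm, mul_add, Finsupp.sum_add]

theorem linForm_smul_right (v : ι →₀ ℝ) (c : ℂ) (z : ι → ℂ) :
    linForm v (c • z) = c * linForm v z := by
  simp only [linForm, Finsupp.mul_sum, Pi.smul_apply, smul_eq_mul]
  exact Finsupp.sum_congr fun i _ => by ring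

@[simp] theorem linForm_zero_right (v : ι →₀ ℝ) : linForm v (0 : ι → ℂ) = 0 := by
  simp [linForm]

@[fun_prop] theorem continuous_linForm (v : ι →₀ ℝ) : Continuous (linForm v : (ι → ℂ) → ℂ) := by
  unfold linForm Finsupp.sum
  fun_prop

theorem analyticOnNhd_linForm {k : ℕ} (v : Fin k →₀ ℝ) (s : Set (Fin k → ℂ)) :
    AnalyticOnNhd ℂ (linForm v) s := by
  intro z _
  unfold linForm Finsupp.sum
  refine Finset.analyticAt_fun_sum _ fun i _ => analyticAt_const.mul ?_
  exact (ContinuousLinearMap.proj (R := ℂ) (φ := fun _ : Fin k => ℂ) i).analyticAt z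

/-- Each complex-valued real-linear functional on the space of real linear forms is the evaluation
at a point of `ℂ^ι`. -/
theorem linForm_eq_of_functional (φ : (ι →₀ ℝ) →ₗ[ℝ] ℂ) (v : ι →₀ ℝ) :
    linForm v (fun i => φ (Finsupp.single i 1)) = φ v := by
  induction v using Finsupp.induction_linear with
  | zero => simp
  | add f g hf hg => rw [linForm_add, hf, hg, map_add]
  | single i c =>
    rw [linForm_single, ← Complex.real_smul, ← map_smul, Finsupp.smul_single, smul_eq_mul, mul_one]

/-- `linForm v z` as a real-linear function of the form. -/
noncomputable def linFormHom (z : ι → ℂ) : (ι →₀ ℝ) →ₗ[ℝ] ℂ where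
  toFun v := linForm v z
  map_add' u v := linForm_add u v z
  map_smul' c v := by simp [linForm_smul]

/-- The map `ℂ^κ → ℂ^ι` dual to a real-linear map between spaces of real linear forms. -/
noncomputable def pullMap (A : (ι →₀ ℝ) →ₗ[ℝ] (κ →₀ ℝ)) (y : κ → ℂ) : ι → ℂ :=
  fun i => linForm (A (Finsupp.single i 1)) y

theorem linForm_pullMap (A : (ι →₀ ℝ) →ₗ[ℝ] (κ →₀ ℝ)) (v : ι →₀ ℝ) (y : κ → ℂ) :
    linForm v (pullMap A y) = linForm (A v) y :=
  linForm_eq_of_functional ((linFormHom y).comp A) v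

theorem pullMap_pullMap (A : (ι →₀ ℝ) →ₗ[ℝ] (κ →₀ ℝ)) (B : (κ →₀ ℝ) →ₗ[ℝ] (μ →₀ ℝ)) (y : μ → ℂ) :
    pullMap A (pullMap B y) = pullMap (B ∘ₗ A) y := by
  funext i
  simp [pullMap, linForm_pullMap]

theorem pullMap_add (A : (ι →₀ ℝ) →ₗ[ℝ] (κ →₀ ℝ)) (y z : κ → ℂ) :
    pullMap A (y + z) = pullMap A y + pullMap A z := by
  funext i
  simp [pullMap, linForm_add_right]

@[simp] theorem pullMap_zero_right (A : (ι →₀ ℝ) →ₗ[ℝ] (κ →₀ ℝ)) :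
    pullMap A (0 : κ → ℂ) = 0 := by
  funext i
  simp [pullMap]

@[fun_prop] theorem continuous_pullMap (A : (ι →₀ ℝ) →ₗ[ℝ] (κ →₀ ℝ)) : Continuous (pullMap A) := by
  unfold pullMap
  fun_prop

@[simp] theorem pullMap_id (y : ι → ℂ) : pullMap LinearMap.id y = y := by
  funext i
  simp [pullMap]

theorem formMap_eq_pullMap {m : ℕ} (L : Fin m → ι →₀ ℝ) :
    (formMap L : (ι → ℂ) → Fin m → ℂ) = pullMap (Finsupp.linearCombination ℝ L) := by
  funext z j
  simp [formMap, pullMap]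

/-- The inclusion of the linear forms in the first `k` variables. -/
noncomputable def inclForms (k : ℕ) : (Fin k →₀ ℝ) →ₗ[ℝ] (ℕ →₀ ℝ) :=
  Finsupp.linearCombination ℝ fun i : Fin k => Finsupp.single (i : ℕ) (1 : ℝ)

theorem formMap_single (k : ℕ) :
    formMap (fun i : Fin k => Finsupp.single (i : ℕ) (1 : ℝ)) = restr k := by
  funext z j
  simp [formMap, restr]

theorem restr_eq_pullMap (k : ℕ) : restr k = pullMap (inclForms k) := by
  rw [← formMap_single, formMap_eq_pullMap, inclForms]

theorem linearIndependent_single (k : ℕ) :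
    LinearIndependent ℝ fun i : Fin k => (Finsupp.single (i : ℕ) (1 : ℝ) : ℕ →₀ ℝ) :=
  (Finsupp.linearIndependent_single_one ℝ ℕ).comp _ Fin.val_injective

theorem inclForms_injective (k : ℕ) : Function.Injective (inclForms k) :=
  linearIndependent_single k

/-- Every finite family of real linear forms involves finitely many variables only. -/
theorem exists_range_inclForms (F : Finset (ℕ →₀ ℝ)) :
    ∃ k : ℕ, 1 ≤ k ∧ ∀ v ∈ F, v ∈ LinearMap.range (inclForms k) := by
  classical
  obtain ⟨k, hk⟩ : ∃ k : ℕ, ∀ v ∈ F, ∀ i ∈ v.support, i < k := by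
    refine ⟨(F.biUnion Finsupp.support).sup id + 1, fun v hv i hi => Nat.lt_succ_of_le ?_⟩
    exact Finset.le_sup (f := id) (Finset.mem_biUnion.2 ⟨v, hv, hi⟩)
  refine ⟨k + 1, by omega, fun v hv => ?_⟩
  have : v = v.sum fun i c => c • (Finsupp.single i (1 : ℝ) : ℕ →₀ ℝ) := by
    simp [Finsupp.sum_single]
  rw [this]
  refine Submodule.sum_mem _ fun i hi => Submodule.smul_mem _ _ ⟨Finsupp.single ⟨i, ?_⟩ 1, ?_⟩
  · exact (hk v hv i hi).trans (Nat.lt_succ_self k)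
  · simp [inclForms]

theorem polarProd_pullMap (A : (ι →₀ ℝ) →ₗ[ℝ] (κ →₀ ℝ)) (P : List (ι →₀ ℝ)) (y : κ → ℂ) :
    polarProd P (pullMap A y) = polarProd (P.map A) y := by
  simp [polarProd, linForm_pullMap, Function.comp_def]

theorem polarProd_append (P R : List (ι →₀ ℝ)) (z : ι → ℂ) :
    polarProd (P ++ R) z = polarProd P z * polarProd R z := by
  simp [polarProd]

theorem analyticOnNhd_polarProd {k : ℕ} (P : List (Fin k →₀ ℝ)) (s : Set (Fin k → ℂ)) :
    AnalyticOnNhd ℂ (polarProd P) s := by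
  induction P with
  | nil => exact fun z _ => by simpa [polarProd] using! analyticAt_const
  | cons p P ih =>
    intro z hz
    simpa [polarProd] using! (analyticOnNhd_linForm p s z hz).mul (ih z hz)

theorem polarProd_ne_zero {P : List (ι →₀ ℝ)} {z : ι → ℂ} (h : ∀ p ∈ P, linForm p z ≠ 0) :
    polarProd P z ≠ 0 := by
  simpa [polarProd, List.prod_eq_zero_iff] using h

end LinearForms

section GenericPoints

variable {ι κ : Type}

theorem mem_polarNhds_iff {S : Set (ι → ℂ)} :
    S ∈ polarNhds ι ↔ ∃ V ∈ 𝓝 (0 : ι → ℂ), ∃ F : Finset (ι →₀ ℝ), (∀ v ∈ F, v ≠ 0) ∧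
      ∀ z ∈ V, (∀ v ∈ F, linForm v z ≠ 0) → z ∈ S := by
  classical
  constructor
  · intro h
    obtain ⟨V, hV, T, hT, rfl⟩ := mem_inf_iff.1 h
    obtain ⟨F, hF⟩ := (mem_iInf_finite T).1 hT
    rw [iInf_principal_finset, mem_principal] at hF
    refine ⟨V, hV, F.image Subtype.val, by simp +contextual, fun z hz h => ⟨hz, hF ?_⟩⟩
    refine Set.mem_iInter₂.2 fun v hv => ?_
    exact h _ (Finset.mem_image_of_mem _ hv)
  · rintro ⟨V, hV, F, hF, h⟩
    have hmem : (⋂ v ∈ F, {z : ι → ℂ | linForm v z ≠ 0}) ∈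
        ⨅ v : {v : ι →₀ ℝ // v ≠ 0}, 𝓟 {z : ι → ℂ | linForm v.1 z ≠ 0} := by
      refine (Filter.biInter_finset_mem F).2 fun v hv => ?_
      exact mem_iInf_of_mem (f := fun v : {v : ι →₀ ℝ // v ≠ 0} =>
        𝓟 {z : ι → ℂ | linForm v.1 z ≠ 0}) ⟨v, hF v hv⟩ (mem_principal_self _)
    refine mem_of_superset (inter_mem_inf hV hmem) fun z hz => h z hz.1 ?_
    exact fun v hv => Set.mem_iInter₂.1 hz.2 v hv

theorem polarNhds_le_nhds : polarNhds ι ≤ 𝓝 0 := inf_le_left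

theorem eventually_linForm_ne_zero {v : ι →₀ ℝ} (hv : v ≠ 0) :
    ∀ᶠ z in polarNhds ι, linForm v z ≠ 0 :=
  mem_polarNhds_iff.2 ⟨Set.univ, univ_mem, {v}, by simpa using hv, by simp⟩

theorem eventually_polar_linForm_ne_zero {P : List (ι →₀ ℝ)} (h : ∀ p ∈ P, p ≠ 0) :
    ∀ᶠ z in polarNhds ι, ∀ p ∈ P, linForm p z ≠ 0 := by
  induction P with
  | nil => simp
  | cons p P ih =>
    simp only [List.forall_mem_cons] at h ⊢
    exact (eventually_linForm_ne_zero h.1).and (ih h.2)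

theorem tendsto_pullMap {A : (ι →₀ ℝ) →ₗ[ℝ] (κ →₀ ℝ)} (hA : Function.Injective A) :
    Tendsto (pullMap A) (polarNhds κ) (polarNhds ι) := by
  refine tendsto_inf.2 ⟨?_, tendsto_iInf.2 fun v => tendsto_principal.2 ?_⟩
  · simpa using ((continuous_pullMap A).tendsto 0).mono_left polarNhds_le_nhds
  · have : A v.1 ≠ 0 := fun h => v.2 (hA (by simpa using h))
    filter_upwards [eventually_linForm_ne_zero this] with z hz
    simpa [linForm_pullMap] using hz

/-- The complement of finitely many hyperplanes is dense. -/
theorem dense_generic (F : Finset (ι →₀ ℝ)) (hF : ∀ v ∈ F, v ≠ 0) :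
    Dense {z : ι → ℂ | ∀ v ∈ F, linForm v z ≠ 0} := by
  classical
  induction F using Finset.induction_on with
  | empty => simp
  | insert v F hv ih =>
    simp only [Finset.forall_mem_insert] at hF ⊢
    have hopen : IsOpen {z : ι → ℂ | linForm v z ≠ 0} :=
      isOpen_ne_fun (continuous_linForm v) continuous_const
    refine Dense.inter_of_isOpen_left ?_ (ih hF.2) hopen
    -- a nonzero form cannot vanish near a point: move along a coordinate which it involves
    obtain ⟨i, hi⟩ := Finsupp.ne_iff.1 hF.1
    intro z
    by_cases hz : linForm v z = 0
    swap
    · exact subset_closure hz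
    have hval : linForm v (Pi.single i 1) = (v i : ℂ) := by
      classical
      rw [linForm, Finsupp.sum_eq_single i]
      · simp
      · intro j _ hj; simp [hj]
      · simp
    have hlim : Tendsto (fun n : ℕ => z + (1 / ((n : ℂ) + 1)) • (Pi.single i 1 : ι → ℂ)) atTop
        (𝓝 z) := by
      have h1 : Tendsto (fun n : ℕ => (1 / ((n : ℂ) + 1))) atTop (𝓝 0) :=
        tendsto_one_div_add_atTop_nhds_zero_nat
      have h2 := (h1.smul_const (Pi.single i 1 : ι → ℂ)).const_add z
      simpa using h2
    refine mem_closure_of_tendsto hlim (Eventually.of_forall fun n => ?_)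
    have hn : ((n : ℂ) + 1) ≠ 0 := by exact_mod_cast n.succ_ne_zero
    have hvi : (v i : ℂ) ≠ 0 := by exact_mod_cast hi
    change linForm v _ ≠ 0
    rw [linForm_add_right, linForm_smul_right, hval, hz, zero_add]
    exact mul_ne_zero (one_div_ne_zero hn) hvi

/-- The point of `ℂ^ι` with real coordinates at which a form `v` takes the value `φ v`. -/
noncomputable def realPt (φ : (ι →₀ ℝ) →ₗ[ℝ] ℝ) : ι → ℂ := fun i => (φ (Finsupp.single i 1) : ℂ)

theorem linForm_realPt (φ : (ι →₀ ℝ) →ₗ[ℝ] ℝ) (v : ι →₀ ℝ) : linForm v (realPt φ) = (φ v : ℂ) :=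
  linForm_eq_of_functional ((Complex.ofRealCLM : ℝ →ₗ[ℝ] ℂ) ∘ₗ φ) v

theorem pullMap_realPt (A : (ι →₀ ℝ) →ₗ[ℝ] (κ →₀ ℝ)) (φ : (κ →₀ ℝ) →ₗ[ℝ] ℝ) :
    pullMap A (realPt φ) = realPt (φ ∘ₗ A) := by
  funext i
  simp [pullMap, linForm_realPt, realPt]

/-- A real functional which vanishes on `W` and at no form of a given finite set outside `W`. -/
theorem exists_functional_ne_zero (W : Submodule ℝ (ι →₀ ℝ)) (F : Finset (ι →₀ ℝ)) :
    ∃ φ : (ι →₀ ℝ) →ₗ[ℝ] ℝ, (∀ v ∈ W, φ v = 0) ∧ ∀ v ∈ F, v ∉ W → φ v ≠ 0 := by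
  classical
  let ev : (ι →₀ ℝ) → Submodule ℝ W.dualAnnihilator := fun v =>
    LinearMap.ker ((Module.Dual.eval ℝ _ v) ∘ₗ W.dualAnnihilator.subtype)
  have htop : ⊤ ∉ (F.filter (· ∉ W)).image ev := by
    simp only [Finset.mem_image, Finset.mem_filter, not_exists, not_and, and_imp]
    intro v _ hv htop
    obtain ⟨φ, hφ, hφW⟩ := W.exists_le_ker_of_notMem hv
    have hmem : φ ∈ W.dualAnnihilator := by
      rw [Submodule.mem_dualAnnihilator]
      exact fun w hw => hφW hw
    have : (⟨φ, hmem⟩ : W.dualAnnihilator) ∈ ev v := by rw [htop]; trivial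
    exact hφ (by simpa [ev] using this)
  have hne := Subspace.biUnion_ne_univ_of_top_notMem (k := ℝ) (E := W.dualAnnihilator) htop
  obtain ⟨φ, hφ⟩ := (Set.ne_univ_iff_exists_notMem _).1 hne
  refine ⟨φ.1, fun v hv => (Submodule.mem_dualAnnihilator _).1 φ.2 v hv, fun v hv hvW h0 => hφ ?_⟩
  simp only [Set.mem_iUnion]
  exact ⟨ev v, Finset.mem_image_of_mem _ (by simp [hv, hvW]), by simpa [ev] using h0⟩

/-- Generic real slices: the affine map `y ↦ pullMap A y + w` with a suitable small real
translation vector `w`, annihilated by the forms in `W`, sends generic points near zero to points of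
a given set of generic points, provided that `A` kills no form in `W`. -/
theorem exists_generic_slice (A : (ι →₀ ℝ) →ₗ[ℝ] (κ →₀ ℝ)) (W : Submodule ℝ (ι →₀ ℝ))
    (hW : ∀ v ∈ W, A v = 0 → v = 0) {S V : Set (ι → ℂ)} (hS : S ∈ polarNhds ι)
    (hV : V ∈ 𝓝 (0 : ι → ℂ)) :
    ∃ φ : (ι →₀ ℝ) →ₗ[ℝ] ℝ, (∀ v ∈ W, φ v = 0) ∧ realPt φ ∈ V ∧
      ∀ᶠ y in polarNhds κ, pullMap A y + realPt φ ∈ S := by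
  obtain ⟨V', hV', F, hF, hFS⟩ := mem_polarNhds_iff.1 hS
  obtain ⟨φ, hφW, hφF⟩ := exists_functional_ne_zero W F
  -- small multiples of `φ` keep the translation vector near zero
  have hlim : Tendsto (fun n : ℕ => realPt ((1 / ((n : ℝ) + 1)) • φ)) atTop (𝓝 0) := by
    have h1 : Tendsto (fun n : ℕ => (1 / ((n : ℝ) + 1))) atTop (𝓝 0) :=
      tendsto_one_div_add_atTop_nhds_zero_nat
    refine tendsto_pi_nhds.2 fun i => ?_
    have h2 := (Complex.continuous_ofReal.tendsto _).comp
      (h1.mul_const (φ (Finsupp.single i 1)))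
    simpa [realPt, Function.comp_def] using h2
  obtain ⟨n, hnV, hnV'⟩ := ((hlim.eventually hV).and
    (hlim.eventually (interior_mem_nhds.2 hV'))).exists
  set ψ := (1 / ((n : ℝ) + 1)) • φ with hψ
  have hn : (1 / ((n : ℝ) + 1)) ≠ 0 := by positivity
  have hcont : Continuous fun y : κ → ℂ => pullMap A y + realPt ψ := by fun_prop
  refine ⟨ψ, fun v hv => by simp [hψ, hφW v hv], hnV, ?_⟩
  have h1 : ∀ᶠ y in polarNhds κ, pullMap A y + realPt ψ ∈ V' := by
    refine polarNhds_le_nhds ?_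
    refine hcont.continuousAt (mem_interior_iff_mem_nhds.1 ?_)
    have h0 : pullMap A 0 + realPt ψ = realPt ψ := by simp
    rw [h0]
    exact hnV'
  have h2 : ∀ᶠ y in polarNhds κ, ∀ v ∈ F, linForm v (pullMap A y + realPt ψ) ≠ 0 := by
    rw [eventually_all_finset]
    intro v hv
    simp only [linForm_add_right, linForm_pullMap, linForm_realPt]
    by_cases hvW : v ∈ W
    -- forms in `W` stay linear on the slice, and the other ones do not vanish at its base point
    · have h0 : ψ v = 0 := by simp [hψ, hφW v hvW]
      have : A v ≠ 0 := fun h => hF v hv (hW v hvW h)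
      simpa [h0] using eventually_linForm_ne_zero this
    · have h0 : (ψ v : ℂ) ≠ 0 := by
        exact Complex.ofReal_ne_zero.2 (mul_ne_zero hn (hφF v hv hvW))
      refine polarNhds_le_nhds (?_ : ∀ᶠ y in 𝓝 (0 : κ → ℂ), linForm (A v) y + (ψ v : ℂ) ≠ 0)
      have hc : ContinuousAt (fun y : κ → ℂ => linForm (A v) y + (ψ v : ℂ)) 0 := by fun_prop
      exact hc.eventually_ne (by simpa using h0)
  filter_upwards [h1, h2] with y hy1 hy2 using hFS _ hy1 hy2

/-- Composition with the map dual to an injective one detects properties of generic points: this map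
has affine right inverses which send generic points to generic points. -/
theorem eventually_of_eventually_pullMap {A : (ι →₀ ℝ) →ₗ[ℝ] (κ →₀ ℝ)}
    (hA : Function.Injective A) {p : (ι → ℂ) → Prop}
    (h : ∀ᶠ z in polarNhds κ, p (pullMap A z)) : ∀ᶠ y in polarNhds ι, p y := by
  obtain ⟨B, hB⟩ := A.exists_leftInverse_of_injective (LinearMap.ker_eq_bot.2 hA)
  have hBA : ∀ v, B (A v) = v := fun v => LinearMap.congr_fun hB v
  obtain ⟨φ, hφ, -, hφS⟩ := exists_generic_slice B (LinearMap.range A)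
    (by rintro _ ⟨v, rfl⟩ h0; rw [hBA] at h0; simp [h0]) h univ_mem
  filter_upwards [hφS] with y hy
  have : pullMap A (pullMap B y + realPt φ) = y := by
    have h0 : φ ∘ₗ A = 0 := LinearMap.ext fun v => hφ _ ⟨v, rfl⟩
    rw [pullMap_add, pullMap_pullMap, hB, pullMap_id, pullMap_realPt, h0]
    funext i
    simp [realPt]
  have hy' : p (pullMap A (pullMap B y + realPt φ)) := hy
  rwa [this] at hy'

end GenericPoints

/-! ### Uniqueness of asymptotic expansions and the finite part -/

section Expansions

/-- A finite sum of powers `x ^ β` with `β ≠ 0` converges to a constant only if the constant is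
zero.  Each exponent `γ` is eliminated in turn by the operator `f ↦ f(t x) - t ^ γ f(x)`, which
multiplies the constant by `1 - t ^ γ`. -/
theorem eq_zero_of_tendsto_sum_cpow (F : Finset ℂ) (hF : (0 : ℂ) ∉ F) (c : ℂ → ℂ) (c₀ : ℂ)
    (h : Tendsto (fun x : ℝ≥0 => c₀ + ∑ β ∈ F, c β * ((x : ℝ) : ℂ) ^ β) atTop (𝓝 0)) : c₀ = 0 := by
  classical
  induction F using Finset.induction_on generalizing c c₀ with
  | empty =>
    simp only [Finset.sum_empty, add_zero] at h
    exact tendsto_nhds_unique tendsto_const_nhds h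
  | insert γ F hγ ih =>
    rw [Finset.mem_insert, not_or] at hF
    have hγ0 : γ ≠ 0 := fun h => hF.1 h.symm
    obtain ⟨t, ht0, ht⟩ : ∃ t : ℝ≥0, 0 < t ∧ ((t : ℝ) : ℂ) ^ γ ≠ 1 := by
      -- for `t = exp (1 / ‖γ‖)` the exponent `γ * log t` has norm `1 < 2 π`
      have hn : 0 < ‖γ‖ := norm_pos_iff.2 hγ0
      refine ⟨⟨Real.exp (‖γ‖⁻¹), (Real.exp_pos _).le⟩, Real.exp_pos _, fun h1 => ?_⟩
      have h2 : (((Real.exp (‖γ‖⁻¹) : ℝ)) : ℂ) ^ γ = Complex.exp ((‖γ‖⁻¹ : ℝ) * γ) := by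
        rw [Complex.cpow_def_of_ne_zero (by exact_mod_cast (Real.exp_pos _).ne'),
          ← Complex.ofReal_log (Real.exp_pos _).le, Real.log_exp]
      have h3 : Complex.exp ((‖γ‖⁻¹ : ℝ) * γ) = 1 := h2.symm.trans h1
      obtain ⟨n, hn'⟩ := Complex.exp_eq_one_iff.1 h3
      have h4 : ‖(((‖γ‖⁻¹ : ℝ)) : ℂ) * γ‖ = 1 := by
        rw [norm_mul, Complex.norm_real, norm_inv, norm_norm, inv_mul_cancel₀ hn.ne']
      rw [hn'] at h4
      have h5 : |(n : ℝ)| * (2 * Real.pi) = 1 := by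
        simpa [abs_of_pos Real.pi_pos] using h4
      rcases eq_or_ne n 0 with rfl | hn0
      · simp at h5
      · have : (1 : ℝ) ≤ |(n : ℝ)| := by exact_mod_cast Int.one_le_abs hn0
        nlinarith [Real.pi_gt_three]
    -- `h2` concerns `f(t x) - t ^ γ f(x)`, which no longer contains the exponent `γ`
    have hscale : Tendsto (fun x : ℝ≥0 => t * x) atTop atTop :=
      tendsto_id.const_mul_atTop ht0
    have h2 := (h.comp hscale).sub (h.const_mul (((t : ℝ) : ℂ) ^ γ))
    have h3 := ih hF.2 (fun β => c β * (((t : ℝ) : ℂ) ^ β - ((t : ℝ) : ℂ) ^ γ))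
      (c₀ * (1 - ((t : ℝ) : ℂ) ^ γ)) (by
        refine (h2.congr fun x => ?_).trans (by simp)
        have hmul : ∀ β : ℂ, (((t : ℝ) : ℂ) * ((x : ℝ) : ℂ)) ^ β =
            ((t : ℝ) : ℂ) ^ β * ((x : ℝ) : ℂ) ^ β :=
          fun β => Complex.mul_cpow_ofReal_nonneg t.2 x.2 β
        simp only [Function.comp, Finset.sum_insert hγ, NNReal.coe_mul, Complex.ofReal_mul, hmul]
        simp only [mul_add, Finset.mul_sum]
        rw [show ∀ a b d e f g : ℂ, a + (b + d) - (e + (f + g)) = (a - e) + (b - f) + (d - g) by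
          intros; ring, ← Finset.sum_sub_distrib]
        rw [show c γ * (((t : ℝ) : ℂ) ^ γ * ((x : ℝ) : ℂ) ^ γ) -
          ((t : ℝ) : ℂ) ^ γ * (c γ * ((x : ℝ) : ℂ) ^ γ) = 0 by ring, add_zero]
        congr 1
        · ring
        · exact Finset.sum_congr rfl fun β _ => by ring)
    exact (mul_eq_zero.1 h3).resolve_right (sub_ne_zero.2 ht.symm)

/-- `κ β` is the coefficient of `x ^ β` in an asymptotic expansion of `σ` at infinity, for all
complex exponents `β`: up to `O(x ^ (-M))`, for each `M`, the function `σ` is a finite sum of terms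
`κ β x ^ β`. -/
def HasCoefs (σ : ℝ≥0 → ℂ) (κ : ℂ → ℂ) : Prop :=
  ∀ M : ℝ, ∃ F : Finset ℂ, (∀ β ∉ F, -M ≤ β.re → κ β = 0) ∧
    (fun x : ℝ≥0 => σ x - ∑ β ∈ F, κ β * ((x : ℝ) : ℂ) ^ β) =O[atTop] fun x : ℝ≥0 => (x : ℝ) ^ (-M)

theorem isBigO_rpow_of_le {r s : ℝ} (h : r ≤ s) :
    (fun x : ℝ≥0 => (x : ℝ) ^ r) =O[atTop] fun x : ℝ≥0 => (x : ℝ) ^ s := by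
  refine Asymptotics.IsBigO.of_bound 1 ?_
  filter_upwards [eventually_ge_atTop 1] with x hx
  have hx' : (1 : ℝ) ≤ x := by exact_mod_cast hx
  rw [one_mul, Real.norm_of_nonneg (by positivity), Real.norm_of_nonneg (by positivity)]
  exact Real.rpow_le_rpow_of_exponent_le hx' h

theorem isBigO_cpow (c β : ℂ) :
    (fun x : ℝ≥0 => c * ((x : ℝ) : ℂ) ^ β) =O[atTop] fun x : ℝ≥0 => (x : ℝ) ^ β.re := by
  refine Asymptotics.IsBigO.of_bound ‖c‖ ?_
  filter_upwards [eventually_gt_atTop 0] with x hx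
  have hx' : (0 : ℝ) < x := by exact_mod_cast hx
  rw [norm_mul, Complex.norm_cpow_eq_rpow_re_of_pos hx', Real.norm_of_nonneg (by positivity)]

/-- In a truncated expansion, further terms may be added to the partial sum. -/
theorem isBigO_sub_sum_of_subset {σ : ℝ≥0 → ℂ} {κ : ℂ → ℂ} {M : ℝ} {F G : Finset ℂ} (hFG : F ⊆ G)
    (hF : ∀ β ∉ F, -M ≤ β.re → κ β = 0)
    (h : (fun x : ℝ≥0 => σ x - ∑ β ∈ F, κ β * ((x : ℝ) : ℂ) ^ β)
      =O[atTop] fun x : ℝ≥0 => (x : ℝ) ^ (-M)) :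
    (fun x : ℝ≥0 => σ x - ∑ β ∈ G, κ β * ((x : ℝ) : ℂ) ^ β)
      =O[atTop] fun x : ℝ≥0 => (x : ℝ) ^ (-M) := by
  classical
  have hsum : (fun x : ℝ≥0 => ∑ β ∈ G \ F, κ β * ((x : ℝ) : ℂ) ^ β)
      =O[atTop] fun x : ℝ≥0 => (x : ℝ) ^ (-M) := by
    refine Asymptotics.IsBigO.fun_sum fun β hβ => ?_
    by_cases hM : -M ≤ β.re
    · simpa [hF β (Finset.mem_sdiff.1 hβ).2 hM] using Asymptotics.isBigO_zero _ _
    · exact (isBigO_cpow _ β).trans (isBigO_rpow_of_le (not_le.1 hM).le)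
  refine (h.sub hsum).congr_left fun x => ?_
  rw [← Finset.sum_sdiff hFG]
  ring

theorem HasCoefs.add {σ σ' : ℝ≥0 → ℂ} {κ κ' : ℂ → ℂ} (h : HasCoefs σ κ) (h' : HasCoefs σ' κ') :
    HasCoefs (σ + σ') (κ + κ') := by
  classical
  intro M
  obtain ⟨F, hF, hO⟩ := h M
  obtain ⟨F', hF', hO'⟩ := h' M
  refine ⟨F ∪ F', fun β hβ hM => ?_, ?_⟩
  · rw [Finset.mem_union, not_or] at hβ
    simp [hF β hβ.1 hM, hF' β hβ.2 hM]
  · refine ((isBigO_sub_sum_of_subset (Finset.subset_union_left (s₂ := F')) hF hO).add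
      (isBigO_sub_sum_of_subset (Finset.subset_union_right (s₁ := F)) hF' hO')).congr_left
        fun x => ?_
    simp only [Pi.add_apply, add_mul, Finset.sum_add_distrib]
    ring

theorem HasCoefs.smul {σ : ℝ≥0 → ℂ} {κ : ℂ → ℂ} (c : ℂ) (h : HasCoefs σ κ) :
    HasCoefs (c • σ) (c • κ) := by
  intro M
  obtain ⟨F, hF, hO⟩ := h M
  refine ⟨F, fun β hβ hM => by simp [hF β hβ hM], (hO.const_mul_left c).congr_left fun x => ?_⟩
  simp only [Pi.smul_apply, smul_eq_mul, mul_assoc, mul_sub, Finset.mul_sum]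

theorem hasCoefs_zero : HasCoefs 0 0 := fun M => ⟨∅, by simp, by
  simpa using Asymptotics.isBigO_zero _ _⟩

theorem HasCoefs.eq_zero {κ : ℂ → ℂ} (h : HasCoefs 0 κ) : κ = 0 := by
  classical
  funext γ
  obtain ⟨F, hF, hO⟩ := h (-γ.re + 1)
  by_cases hγ : γ ∈ F
  swap
  · exact hF γ hγ (by linarith)
  have hlim : Tendsto (fun x : ℝ≥0 => (x : ℝ) ^ (-1 : ℝ)) atTop (𝓝 0) :=
    (tendsto_rpow_neg_atTop one_pos).comp (NNReal.tendsto_coe_atTop.2 tendsto_id)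
  -- after multiplication by `x ^ (-γ)` the coefficient of interest is the constant term
  refine eq_zero_of_tendsto_sum_cpow ((F.erase γ).image (· - γ)) ?_ (fun β => κ (β + γ)) _ ?_
  · simp [sub_eq_zero]
  have h1 : (fun x : ℝ≥0 => ((x : ℝ) : ℂ) ^ (-γ) * ∑ β ∈ F, κ β * ((x : ℝ) : ℂ) ^ β)
      =O[atTop] fun x : ℝ≥0 => (x : ℝ) ^ (-1 : ℝ) := by
    have h2 := (isBigO_cpow 1 (-γ)).mul hO.neg_left
    refine (h2.congr' ?_ ?_)
    · filter_upwards with x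
      simp
    · filter_upwards [eventually_gt_atTop 0] with x hx
      have hx' : (0 : ℝ) < x := by exact_mod_cast hx
      rw [← Real.rpow_add hx']
      congr 1
      simp
  refine (h1.trans_tendsto hlim).congr' ?_
  filter_upwards [eventually_gt_atTop 0] with x hx
  have hx' : ((x : ℝ) : ℂ) ≠ 0 := by
    have : (x : ℝ) ≠ 0 := by exact_mod_cast hx.ne'
    exact_mod_cast this
  rw [Finset.sum_image (fun a _ b _ hab => by simpa using hab), ← Finset.add_sum_erase F _ hγ,
    mul_add, Finset.mul_sum, mul_left_comm, ← Complex.cpow_add _ _ hx']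
  congr 1
  · simp
  · refine Finset.sum_congr rfl fun β _ => ?_
    rw [mul_left_comm, ← Complex.cpow_add _ _ hx', neg_add_eq_sub, sub_add_cancel]

theorem HasCoefs.unique {σ : ℝ≥0 → ℂ} {κ κ' : ℂ → ℂ} (h : HasCoefs σ κ) (h' : HasCoefs σ κ') :
    κ = κ' := by
  have h1 := h.add (h'.smul (-1))
  rw [neg_one_smul, add_neg_cancel] at h1
  have h2 := h1.eq_zero
  rwa [neg_one_smul, ← sub_eq_add_neg, sub_eq_zero] at h2

theorem one_le_bracket (x : ℝ≥0) : 1 ≤ bracket x :=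
  Real.one_le_sqrt.2 (by nlinarith [sq_nonneg (x : ℝ)])

theorem bracket_pos (x : ℝ≥0) : 0 < bracket x := one_pos.trans_le (one_le_bracket x)

theorem le_bracket (x : ℝ≥0) : (x : ℝ) ≤ bracket x :=
  Real.le_sqrt_of_sq_le (by linarith)

theorem bracket_le_of_one_le {x : ℝ≥0} (hx : 1 ≤ x) : bracket x ≤ 2 * x := by
  have hx' : (1 : ℝ) ≤ x := by exact_mod_cast hx
  exact Real.sqrt_le_iff.2 ⟨by positivity, by nlinarith⟩

theorem bracket_rpow_mono {r s : ℝ} (h : r ≤ s) (x : ℝ≥0) : bracket x ^ r ≤ bracket x ^ s :=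
  Real.rpow_le_rpow_of_exponent_le (one_le_bracket x) h

theorem isBigO_bracket (r : ℝ) :
    (fun x : ℝ≥0 => bracket x ^ r) =O[atTop] fun x : ℝ≥0 => (x : ℝ) ^ r := by
  refine Asymptotics.IsBigO.of_bound (max 1 (2 ^ r)) ?_
  filter_upwards [eventually_ge_atTop 1] with x hx
  have hx' : (1 : ℝ) ≤ x := by exact_mod_cast hx
  have hb := bracket_pos x
  rw [Real.norm_of_nonneg (by positivity), Real.norm_of_nonneg (by positivity)]
  rcases le_total 0 r with hr | hr
  · calc bracket x ^ r ≤ (2 * x : ℝ) ^ r :=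
        Real.rpow_le_rpow hb.le (bracket_le_of_one_le hx) hr
      _ = 2 ^ r * (x : ℝ) ^ r := Real.mul_rpow (by norm_num) (by positivity)
      _ ≤ _ := by gcongr; exact le_max_right _ _
  · calc bracket x ^ r ≤ (x : ℝ) ^ r :=
        Real.rpow_le_rpow_of_nonpos (by positivity) (le_bracket x) hr
      _ = 1 * (x : ℝ) ^ r := (one_mul _).symm
      _ ≤ _ := by gcongr; exact le_max_left _ _

theorem dx_zero (σ : ℝ≥0 → ℂ) (x : ℝ≥0) : dx 0 σ x = σ x := by
  simp [dx, ext]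

theorem IsSymbol.isBigO {r : ℝ} {σ : ℝ≥0 → ℂ} (h : IsSymbol r σ) :
    σ =O[atTop] fun x : ℝ≥0 => (x : ℝ) ^ r := by
  obtain ⟨D, -, hD⟩ := h.2 0
  refine (Asymptotics.IsBigO.of_bound D (Eventually.of_forall fun x => ?_)).trans (isBigO_bracket r)
  have hb := bracket_pos x
  rw [Real.norm_of_nonneg (by positivity)]
  simpa [dx_zero] using hD x

/-- The coefficient of `x ^ β` in the expansion `∑ⱼ aⱼ x ^ (α - j)`. -/
noncomputable def coefAt (α : ℂ) (a : ℕ → ℂ) (β : ℂ) : ℂ :=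
  ∑ᶠ j : ℕ, if α - (j : ℂ) = β then a j else 0

theorem coefAt_sub_natCast (α : ℂ) (a : ℕ → ℂ) (j : ℕ) : coefAt α a (α - j) = a j := by
  rw [coefAt, finsum_eq_single _ j]
  · simp
  · intro i hi
    rw [if_neg]
    simpa using hi

theorem coefAt_eq_zero {α : ℂ} {a : ℕ → ℂ} {β : ℂ} (h : ∀ j : ℕ, α - j ≠ β) : coefAt α a β = 0 := by
  simp [coefAt, h]

theorem constTerm_eq_coefAt (α : ℂ) (a : ℕ → ℂ) : constTerm α a = coefAt α a 0 := rfl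

theorem HasExpansion.hasCoefs {σ : ℝ≥0 → ℂ} {α : ℂ} {a : ℕ → ℂ} (h : HasExpansion σ α a) :
    HasCoefs σ (coefAt α a) := by
  classical
  obtain ⟨-, χ, hχ, hR⟩ := h
  intro M
  obtain ⟨N, hN⟩ := exists_nat_gt (max 1 (α.re + M))
  have hN1 : (1 : ℝ) < N := (le_max_left _ _).trans_lt hN
  have hNM : α.re + M < N := (le_max_right _ _).trans_lt hN
  refine ⟨(Finset.range N).image fun j : ℕ => α - j, fun β hβ hM => ?_, ?_⟩
  · refine coefAt_eq_zero ?_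
    rintro j rfl
    refine hβ (Finset.mem_image_of_mem _ (Finset.mem_range.2 ?_))
    have : (j : ℝ) < N := by
      simp only [Complex.sub_re, Complex.natCast_re] at hM
      linarith
    exact_mod_cast this
  · have hO := (hR N (by exact_mod_cast hN1.le)).isBigO.trans
      (isBigO_rpow_of_le (show α.re - N ≤ -M by linarith))
    obtain ⟨R, hR1⟩ := hχ.one_far
    refine hO.congr' ?_ EventuallyEq.rfl
    filter_upwards [eventually_gt_atTop R] with x hx
    rw [Finset.sum_image (fun i _ j _ hij => by simpa using hij)]
    simp only [remainder, coefAt_sub_natCast, hR1 x hx, Complex.ofReal_one, one_mul]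

theorem hasCoefs_sum {n : ℕ} {τ : Fin n → ℝ≥0 → ℂ} {κ : Fin n → ℂ → ℂ}
    (h : ∀ i, HasCoefs (τ i) (κ i)) : HasCoefs (∑ i, τ i) (∑ i, κ i) := by
  induction n with
  | zero => simpa using hasCoefs_zero
  | succ n ih =>
    rw [Fin.sum_univ_succ, Fin.sum_univ_succ]
    exact (h 0).add (ih fun i => h i.succ)

theorem IsFinitePart.exists_hasCoefs {σ : ℝ≥0 → ℂ} {c : ℂ} (h : IsFinitePart σ c) :
    ∃ κ, HasCoefs σ κ ∧ κ 0 = c := by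
  obtain ⟨n, τ, α, a, hτ, rfl, rfl⟩ := h
  refine ⟨_, hasCoefs_sum fun i => (hτ i).hasCoefs, ?_⟩
  simp [constTerm_eq_coefAt]

/-- The finite part does not depend on the decomposition into polyhomogeneous symbols. -/
theorem IsFinitePart.finitePart_eq {σ : ℝ≥0 → ℂ} {c : ℂ} (h : IsFinitePart σ c) :
    finitePart σ = c := by
  have hex : ∃ c, IsFinitePart σ c := ⟨c, h⟩
  rw [finitePart, dif_pos hex]
  obtain ⟨κ, hκ, h1⟩ := hex.choose_spec.exists_hasCoefs
  obtain ⟨κ', hκ', h2⟩ := h.exists_hasCoefs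
  rw [← h1, ← h2, hκ.unique hκ']

theorem HasExpansion.isFinitePart {σ : ℝ≥0 → ℂ} {α : ℂ} {a : ℕ → ℂ} (h : HasExpansion σ α a) :
    IsFinitePart σ (coefAt α a 0) :=
  ⟨1, fun _ => σ, fun _ => α, fun _ => a, fun _ => h, by simp, by simp [constTerm_eq_coefAt]⟩

theorem isFinitePart_zero : IsFinitePart 0 0 :=
  ⟨0, Fin.elim0, Fin.elim0, Fin.elim0, fun i => i.elim0, by simp, by simp⟩

theorem IsFinitePart.add {σ σ' : ℝ≥0 → ℂ} {c c' : ℂ} (h : IsFinitePart σ c)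
    (h' : IsFinitePart σ' c') : IsFinitePart (σ + σ') (c + c') := by
  obtain ⟨n, τ, α, a, hτ, rfl, rfl⟩ := h
  obtain ⟨n', τ', α', a', hτ', rfl, rfl⟩ := h'
  refine ⟨n + n', Fin.append τ τ', Fin.append α α', Fin.append a a', fun i => ?_, ?_, ?_⟩
  · refine Fin.addCases (fun i => ?_) (fun i => ?_) i
    · simpa using hτ i
    · simpa using hτ' i
  · simp [Fin.sum_univ_add]
  · simp [Fin.sum_univ_add]

theorem IsSymbol.smul {r : ℝ} {σ : ℝ≥0 → ℂ} (c : ℂ) (h : IsSymbol r σ) : IsSymbol r (c • σ) := by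
  have hext : ext (c • σ) = fun x => c * ext σ x := rfl
  refine ⟨?_, fun k => ?_⟩
  · rw [hext]
    exact contDiffOn_const.mul h.1
  · obtain ⟨D, hD, hk⟩ := h.2 k
    refine ⟨(‖c‖ + 1) * D, by positivity, fun x => ?_⟩
    have hb := bracket_pos x
    rw [dx, hext, iteratedDerivWithin_const_mul_field, norm_mul, mul_assoc]
    gcongr
    · linarith
    · exact hk x

theorem HasExpansion.smul {σ : ℝ≥0 → ℂ} {α : ℂ} {a : ℕ → ℂ} (c : ℂ) (h : HasExpansion σ α a) :
    HasExpansion (c • σ) α (c • a) := by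
  obtain ⟨hσ, χ, hχ, hR⟩ := h
  refine ⟨hσ.smul c, χ, hχ, fun N hN => ?_⟩
  have : remainder χ α (c • a) N (c • σ) = c • remainder χ α a N σ := by
    funext x
    simp only [remainder, Pi.smul_apply, smul_eq_mul, mul_sub, Finset.mul_sum]
    congr 1
    exact Finset.sum_congr rfl fun j _ => by ring
  rw [this]
  exact (hR N hN).smul c

theorem coefAt_smul (α c : ℂ) (a : ℕ → ℂ) (β : ℂ) : coefAt α (c • a) β = c * coefAt α a β := by
  by_cases h : ∃ j : ℕ, α - j = β
  · obtain ⟨j, rfl⟩ := h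
    simp [coefAt_sub_natCast]
  · push Not at h
    simp [coefAt_eq_zero h]

theorem IsFinitePart.smul {σ : ℝ≥0 → ℂ} {c : ℂ} (b : ℂ) (h : IsFinitePart σ c) :
    IsFinitePart (b • σ) (b * c) := by
  obtain ⟨n, τ, α, a, hτ, rfl, rfl⟩ := h
  refine ⟨n, fun i => b • τ i, α, fun i => b • a i, fun i => (hτ i).smul b, ?_, ?_⟩
  · rw [Finset.smul_sum]
  · simp [constTerm_eq_coefAt, coefAt_smul, Finset.mul_sum]

end Expansions

/-! ### Derivatives of functions on the half line -/

section Derivatives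

/-- Smoothness on `[0, ∞)`. -/
abbrev SmoothHalf (σ : ℝ≥0 → ℂ) : Prop := ContDiffOn ℝ ∞ (ext σ) (Set.Ici 0)

theorem SmoothHalf.contDiffWithinAt {σ : ℝ≥0 → ℂ} (h : SmoothHalf σ) (d : ℕ) (x : ℝ≥0) :
    ContDiffWithinAt ℝ d (ext σ) (Set.Ici 0) (x : ℝ) :=
  (h (x : ℝ) x.2).of_le (mod_cast le_top)

theorem dx_add {σ τ : ℝ≥0 → ℂ} (hσ : SmoothHalf σ) (hτ : SmoothHalf τ) (d : ℕ) (x : ℝ≥0) :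
    dx d (σ + τ) x = dx d σ x + dx d τ x :=
  iteratedDerivWithin_add x.2 (uniqueDiffOn_Ici 0) (hσ.contDiffWithinAt d x)
    (hτ.contDiffWithinAt d x)

theorem dx_smul (c : ℂ) (σ : ℝ≥0 → ℂ) (d : ℕ) (x : ℝ≥0) : dx d (c • σ) x = c * dx d σ x :=
  iteratedDerivWithin_const_mul_field c (ext σ)

theorem dx_mul {σ τ : ℝ≥0 → ℂ} {d : ℕ} {x : ℝ≥0}
    (hσ : ContDiffWithinAt ℝ d (ext σ) (Set.Ici 0) (x : ℝ))
    (hτ : ContDiffWithinAt ℝ d (ext τ) (Set.Ici 0) (x : ℝ)) :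
    dx d (σ * τ) x = ∑ i ∈ Finset.range (d + 1), (d.choose i : ℂ) * dx i σ x * dx (d - i) τ x :=
  iteratedDerivWithin_mul x.2 (uniqueDiffOn_Ici 0) hσ hτ

theorem ext_eventuallyEq {σ τ : ℝ≥0 → ℂ} {x : ℝ≥0} (h : σ =ᶠ[𝓝 x] τ) :
    ext σ =ᶠ[𝓝 (x : ℝ)] ext τ := by
  have hc : Tendsto Real.toNNReal (𝓝 (x : ℝ)) (𝓝 x) := by
    simpa using (continuous_real_toNNReal.tendsto (x : ℝ))
  exact hc.eventually h

theorem dx_congr {σ τ : ℝ≥0 → ℂ} {x : ℝ≥0} (h : σ =ᶠ[𝓝 x] τ) (d : ℕ) : dx d σ x = dx d τ x :=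
  Filter.EventuallyEq.iteratedDerivWithin_eq ((ext_eventuallyEq h).filter_mono nhdsWithin_le_nhds)
    (ext_eventuallyEq h).eq_of_nhds

theorem dx_zero_fun (d : ℕ) (x : ℝ≥0) : dx d 0 x = 0 := by
  have := dx_smul 0 0 d x
  simpa using this

theorem dx_eq_zero {σ : ℝ≥0 → ℂ} {x : ℝ≥0} (h : σ =ᶠ[𝓝 x] 0) (d : ℕ) : dx d σ x = 0 := by
  rw [dx_congr h, dx_zero_fun]

theorem SmoothHalf.add {σ τ : ℝ≥0 → ℂ} (hσ : SmoothHalf σ) (hτ : SmoothHalf τ) :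
    SmoothHalf (σ + τ) := ContDiffOn.add hσ hτ

theorem SmoothHalf.mul {σ τ : ℝ≥0 → ℂ} (hσ : SmoothHalf σ) (hτ : SmoothHalf τ) :
    SmoothHalf (σ * τ) := ContDiffOn.mul hσ hτ

theorem SmoothHalf.smul {σ : ℝ≥0 → ℂ} (c : ℂ) (hσ : SmoothHalf σ) : SmoothHalf (c • σ) :=
  contDiffOn_const.mul hσ

theorem smoothHalf_const (c : ℂ) : SmoothHalf fun _ => c := contDiffOn_const

/-- The power function `x ^ α`. -/
noncomputable def cpowFun (α : ℂ) : ℝ≥0 → ℂ := fun x => ((x : ℝ) : ℂ) ^ α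

theorem ext_cpowFun_eventuallyEq (α : ℂ) {x : ℝ} (hx : 0 < x) :
    ext (cpowFun α) =ᶠ[𝓝 x] fun y : ℝ => (y : ℂ) ^ α := by
  filter_upwards [lt_mem_nhds hx] with y hy
  simp [ext, cpowFun, Real.coe_toNNReal y hy.le]

theorem contDiffAt_ofReal_cpow (α : ℂ) {x : ℝ} (hx : 0 < x) (n : WithTop ℕ∞) :
    ContDiffAt ℝ n (fun y : ℝ => (y : ℂ) ^ α) x := by
  have h1 : ContDiffAt ℝ n (fun y : ℝ => Complex.exp (Complex.log (y : ℂ) * α)) x := by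
    have hlog : ContDiffAt ℝ n (fun y : ℝ => Complex.log (y : ℂ)) x := by
      have : (fun y : ℝ => ((Real.log y : ℝ) : ℂ)) =ᶠ[𝓝 x] fun y : ℝ => Complex.log (y : ℂ) := by
        filter_upwards [lt_mem_nhds hx] with y hy
        exact Complex.ofReal_log hy.le
      refine ContDiffAt.congr_of_eventuallyEq ?_ this.symm
      exact Complex.ofRealCLM.contDiff.contDiffAt.comp x (Real.contDiffAt_log.2 hx.ne')
    exact (hlog.mul contDiffAt_const).cexp
  refine h1.congr_of_eventuallyEq ?_
  filter_upwards [lt_mem_nhds hx] with y hy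
  exact Complex.cpow_def_of_ne_zero (by exact_mod_cast hy.ne') _

theorem contDiffAt_ext_cpowFun (α : ℂ) {x : ℝ} (hx : 0 < x) (n : WithTop ℕ∞) :
    ContDiffAt ℝ n (ext (cpowFun α)) x :=
  (contDiffAt_ofReal_cpow α hx n).congr_of_eventuallyEq (ext_cpowFun_eventuallyEq α hx)

theorem iteratedDerivWithin_cpowFun (α : ℂ) (d : ℕ) {x : ℝ} (hx : 0 < x) :
    iteratedDerivWithin d (ext (cpowFun α)) (Set.Ici 0) x =
      (∏ i ∈ Finset.range d, (α - i)) * (x : ℂ) ^ (α - d) := by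
  induction d generalizing x with
  | zero => simp [(ext_cpowFun_eventuallyEq α hx).eq_of_nhds]
  | succ d ih =>
    have hev : iteratedDerivWithin d (ext (cpowFun α)) (Set.Ici 0) =ᶠ[𝓝 x]
        fun y : ℝ => (∏ i ∈ Finset.range d, (α - i)) * (y : ℂ) ^ (α - d) := by
      filter_upwards [lt_mem_nhds hx] with y hy using ih hy
    have hd : HasDerivAt (fun y : ℝ => (∏ i ∈ Finset.range d, (α - i)) * (y : ℂ) ^ (α - d))
        ((∏ i ∈ Finset.range d, (α - i)) * ((α - d) * (x : ℂ) ^ (α - d - 1))) x := by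
      refine HasDerivAt.const_mul _ ?_
      have h1 := (hasDerivAt_id (x : ℂ)).cpow_const (c := α - d) (Or.inl (by simpa using hx))
      simpa using h1.comp_ofReal
    rw [iteratedDerivWithin_succ, (hev.filter_mono nhdsWithin_le_nhds).derivWithin_eq
      hev.eq_of_nhds, hd.hasDerivWithinAt.derivWithin ((uniqueDiffOn_Ici 0) x hx.le),
      Finset.prod_range_succ, mul_assoc]
    push_cast
    rw [sub_sub]

theorem dx_cpowFun (α : ℂ) (d : ℕ) {x : ℝ≥0} (hx : 0 < x) :
    dx d (cpowFun α) x = (∏ i ∈ Finset.range d, (α - i)) * ((x : ℝ) : ℂ) ^ (α - d) :=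
  iteratedDerivWithin_cpowFun α d (by exact_mod_cast hx)

end Derivatives

/-! ### Symbols and excision functions -/

section Symbols

theorem IsSymbol.add {r : ℝ} {σ τ : ℝ≥0 → ℂ} (hσ : IsSymbol r σ) (hτ : IsSymbol r τ) :
    IsSymbol r (σ + τ) := by
  refine ⟨SmoothHalf.add hσ.1 hτ.1, fun k => ?_⟩
  obtain ⟨C, hC0, hC⟩ := hσ.2 k
  obtain ⟨D, hD0, hD⟩ := hτ.2 k
  refine ⟨C + D, by positivity, fun x => ?_⟩
  rw [dx_add hσ.1 hτ.1, add_mul]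
  exact (norm_add_le _ _).trans (add_le_add (hC x) (hD x))

theorem dx_const (c : ℂ) (d : ℕ) (x : ℝ≥0) : dx d (fun _ => c) x = if d = 0 then c else 0 := by
  have : ext (fun _ => c) = fun _ => c := rfl
  rw [dx, this, iteratedDerivWithin_const]

theorem isSymbol_const (c : ℂ) : IsSymbol 0 fun _ => c := by
  refine ⟨smoothHalf_const c, fun k => ⟨‖c‖ + 1, by positivity, fun x => ?_⟩⟩
  rw [dx_const]
  split_ifs with hk
  · simp [hk]
  · have := bracket_pos x
    simp only [norm_zero]
    positivity

/-- Smooth functions with bounded support are symbols of every order. -/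
theorem isSymbol_of_eq_zero_far {σ : ℝ≥0 → ℂ} (hσ : SmoothHalf σ) {R : ℝ≥0}
    (hR : ∀ x > R, σ x = 0) (r : ℝ) : IsSymbol r σ := by
  refine ⟨hσ, fun k => ?_⟩
  have hcont : ContinuousOn (fun x : ℝ => ‖iteratedDerivWithin k (ext σ) (Set.Ici 0) x‖ *
      Real.sqrt (x ^ 2 + 1) ^ (-(r - k))) (Set.Icc 0 (R : ℝ)) := by
    refine ContinuousOn.mul ?_ (Continuous.continuousOn ?_)
    · exact ((hσ.continuousOn_iteratedDerivWithin (m := k) (mod_cast le_top)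
        (uniqueDiffOn_Ici 0)).mono Set.Icc_subset_Ici_self).norm
    · refine Continuous.rpow_const (by fun_prop) fun x => Or.inl ?_
      positivity
  obtain ⟨C, hC⟩ := (isCompact_Icc.bddAbove_image hcont)
  refine ⟨max C 1, by positivity, fun x => ?_⟩
  have hb := bracket_pos x
  rcases le_or_gt x R with hx | hx
  · have h1 := hC (Set.mem_image_of_mem _ (show (x : ℝ) ∈ Set.Icc (0 : ℝ) R from ⟨x.2, hx⟩))
    have h2 : ‖dx k σ x‖ * bracket x ^ (-(r - k)) ≤ max C 1 := le_max_of_le_left h1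
    rwa [Real.rpow_neg hb.le, ← div_eq_mul_inv, div_le_iff₀ (by positivity)] at h2
  · rw [dx_eq_zero (by filter_upwards [lt_mem_nhds hx] with y hy using hR y hy), norm_zero]
    positivity

/-- A complex-valued excision function. -/
def exc (χ : ℝ≥0 → ℝ) : ℝ≥0 → ℂ := fun x => (χ x : ℂ)

theorem IsExcision.smoothHalf {χ : ℝ≥0 → ℝ} (h : IsExcision χ) : SmoothHalf (exc χ) :=
  Complex.ofRealCLM.contDiff.comp_contDiffOn h.smooth

theorem IsExcision.isSymbol_sub_one {χ : ℝ≥0 → ℝ} (h : IsExcision χ) (r : ℝ) :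
    IsSymbol r (exc χ + fun _ => -1) := by
  obtain ⟨R, hR⟩ := h.one_far
  exact isSymbol_of_eq_zero_far (h.smoothHalf.add (smoothHalf_const _)) (R := R)
    (fun x hx => by simp [exc, hR x hx]) r

theorem IsExcision.isSymbol {χ : ℝ≥0 → ℝ} (h : IsExcision χ) : IsSymbol 0 (exc χ) := by
  have h1 := (h.isSymbol_sub_one 0).add (isSymbol_const 1)
  convert h1 using 1
  funext x
  simp

/-- A complex-valued function vanishing near `0`. -/
def VanishesNearZero (ψ : ℝ≥0 → ℂ) : Prop := ∃ δ : ℝ≥0, 0 < δ ∧ ∀ x < δ, ψ x = 0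

theorem IsExcision.vanishesNearZero {χ : ℝ≥0 → ℝ} (h : IsExcision χ) :
    VanishesNearZero (exc χ) := by
  obtain ⟨δ, hδ, h0⟩ := h.zero_near
  exact ⟨δ, hδ, fun x hx => by simp [exc, h0 x hx]⟩

/-- An excision function which changes from `0` to `1` between `r` and `2 r`. -/
noncomputable def stepExc (r : ℝ≥0) : ℝ≥0 → ℝ := fun x => Real.smoothTransition (x / r - 1)

theorem isExcision_stepExc {r : ℝ≥0} (hr : 0 < r) : IsExcision (stepExc r) where
  smooth := by
    refine ContDiffOn.congr (f := fun x : ℝ => Real.smoothTransition (x / r - 1)) ?_ fun x hx => ?_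
    · exact (Real.smoothTransition.contDiff.comp (by fun_prop)).contDiffOn
    · simp [stepExc, Real.coe_toNNReal x hx]
  zero_near := ⟨r, hr, fun x hx => Real.smoothTransition.zero_of_nonpos (by
    have h1 : (x : ℝ) / r ≤ 1 := (div_le_one (by exact_mod_cast hr)).2 (by exact_mod_cast hx.le)
    linarith)⟩
  one_far := ⟨2 * r, fun x hx => Real.smoothTransition.one_of_one_le (by
    have h1 : (2 : ℝ) ≤ (x : ℝ) / r := (le_div_iff₀ (by exact_mod_cast hr)).2
      (by exact_mod_cast hx.le)
    linarith)⟩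

theorem stepExc_eq_zero {r x : ℝ≥0} (hr : 0 < r) (hx : x ≤ r) : stepExc r x = 0 :=
  Real.smoothTransition.zero_of_nonpos (by
    have h1 : (x : ℝ) / r ≤ 1 := (div_le_one (by exact_mod_cast hr)).2 (by exact_mod_cast hx)
    linarith)

theorem stepExc_eq_one {r x : ℝ≥0} (hr : 0 < r) (hx : 2 * r ≤ x) : stepExc r x = 1 :=
  Real.smoothTransition.one_of_one_le (by
    have h1 : (2 : ℝ) ≤ (x : ℝ) / r := (le_div_iff₀ (by exact_mod_cast hr)).2
      (by exact_mod_cast hx)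
    linarith)

end Symbols

/-! ### Holomorphic families of symbols with locally uniform estimates -/

section Families

variable {E E' : Type} [NormedAddCommGroup E] [NormedSpace ℂ E]
  [NormedAddCommGroup E'] [NormedSpace ℂ E']

/-- A holomorphic family of symbols `F z` of order `m z`, with estimates which are locally uniform
in `z`. Only derivatives in `x` are estimated, without loss in the exponent: the estimates for the
derivatives in `z`, with an arbitrarily small loss, follow from the Cauchy inequalities. -/
structure SymFam (U : Set E) (m : E → ℝ) (F : E → ℝ≥0 → ℂ) : Prop where
  smooth : ∀ z ∈ U, SmoothHalf (F z)
  analytic : ∀ (d : ℕ) (x : ℝ≥0), AnalyticOnNhd ℂ (fun z => dx d (F z) x) U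
  bound : ∀ d : ℕ, ∀ z₀ ∈ U, ∃ C : ℝ, 0 ≤ C ∧ ∀ᶠ z in 𝓝 z₀, ∀ x : ℝ≥0,
    ‖dx d (F z) x‖ ≤ C * bracket x ^ (m z - d)

variable {U : Set E} {m m' : E → ℝ} {F G : E → ℝ≥0 → ℂ}

theorem SymFam.isSymbol (h : SymFam U m F) {z : E} (hz : z ∈ U) {r : ℝ} (hr : m z ≤ r) :
    IsSymbol r (F z) := by
  refine ⟨h.smooth z hz, fun k => ?_⟩
  obtain ⟨C, hC0, hC⟩ := h.bound k z hz
  refine ⟨C + 1, by positivity, fun x => (hC.self_of_nhds x).trans ?_⟩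
  exact mul_le_mul (by linarith) (bracket_rpow_mono (by linarith) x)
    (Real.rpow_nonneg (bracket_pos x).le _) (by positivity)

theorem IsSymbol.symFam {r : ℝ} {σ : ℝ≥0 → ℂ} (h : IsSymbol r σ) (U : Set E) :
    SymFam U (fun _ => r) (fun _ => σ) where
  smooth _ _ := h.1
  analytic _ _ _ _ := analyticAt_const
  bound d _ _ := by
    obtain ⟨D, hD0, hD⟩ := h.2 d
    exact ⟨D, hD0.le, Eventually.of_forall fun _ => hD⟩

theorem SymFam.mono_set {V : Set E} (h : SymFam U m F) (hV : V ⊆ U) : SymFam V m F where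
  smooth z hz := h.smooth z (hV hz)
  analytic d x := (h.analytic d x).mono hV
  bound d z hz := h.bound d z (hV hz)

theorem SymFam.mono (h : SymFam U m F) (hU : IsOpen U) (hm : ∀ z ∈ U, m z ≤ m' z) :
    SymFam U m' F where
  smooth := h.smooth
  analytic := h.analytic
  bound d z₀ hz₀ := by
    obtain ⟨C, hC0, hC⟩ := h.bound d z₀ hz₀
    refine ⟨C, hC0, ?_⟩
    filter_upwards [hC, hU.mem_nhds hz₀] with z hz hzU x
    exact (hz x).trans
      (mul_le_mul_of_nonneg_left (bracket_rpow_mono (by linarith [hm z hzU]) x) hC0)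

theorem SymFam.congr (h : SymFam U m F) (hU : IsOpen U) (hFG : ∀ z ∈ U, F z = G z) :
    SymFam U m G where
  smooth z hz := hFG z hz ▸ h.smooth z hz
  analytic d x := (h.analytic d x).congr hU fun z hz => by simp only [hFG z hz]
  bound d z₀ hz₀ := by
    obtain ⟨C, hC0, hC⟩ := h.bound d z₀ hz₀
    refine ⟨C, hC0, ?_⟩
    filter_upwards [hC, hU.mem_nhds hz₀] with z hz hzU x
    rw [← hFG z hzU]
    exact hz x

theorem SymFam.add (hU : IsOpen U) (hF : SymFam U m F) (hG : SymFam U m G) :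
    SymFam U m (F + G) where
  smooth z hz := (hF.smooth z hz).add (hG.smooth z hz)
  analytic d x := by
    refine ((hF.analytic d x).add (hG.analytic d x)).congr hU fun z hz => ?_
    exact (dx_add (hF.smooth z hz) (hG.smooth z hz) d x).symm
  bound d z₀ hz₀ := by
    obtain ⟨C, hC0, hC⟩ := hF.bound d z₀ hz₀
    obtain ⟨D, hD0, hD⟩ := hG.bound d z₀ hz₀
    refine ⟨C + D, by positivity, ?_⟩
    filter_upwards [hC, hD, hU.mem_nhds hz₀] with z h1 h2 hz x
    rw [Pi.add_apply, dx_add (hF.smooth z hz) (hG.smooth z hz), add_mul]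
    exact (norm_add_le _ _).trans (add_le_add (h1 x) (h2 x))

theorem SymFam.smul (hF : SymFam U m F) {g : E → ℂ} (hg : AnalyticOnNhd ℂ g U) :
    SymFam U m (fun z => g z • F z) where
  smooth z hz := (hF.smooth z hz).smul (g z)
  analytic d x := by
    simp only [dx_smul]
    exact hg.mul (hF.analytic d x)
  bound d z₀ hz₀ := by
    obtain ⟨C, hC0, hC⟩ := hF.bound d z₀ hz₀
    refine ⟨(‖g z₀‖ + 1) * C, by positivity, ?_⟩
    have hgb : ∀ᶠ z in 𝓝 z₀, ‖g z‖ < ‖g z₀‖ + 1 :=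
      ((hg z₀ hz₀).continuousAt.norm).eventually_lt_const (lt_add_one _)
    filter_upwards [hC, hgb] with z h1 h2 x
    rw [dx_smul, norm_mul, mul_assoc]
    exact mul_le_mul h2.le (h1 x) (norm_nonneg _) (by positivity)

theorem symFam_zero (U : Set E) (m : E → ℝ) : SymFam U m (fun _ => 0) where
  smooth _ _ := smoothHalf_const 0
  analytic d x := by
    simp only [dx_zero_fun]
    exact fun _ _ => analyticAt_const
  bound d z₀ _ := ⟨0, le_rfl, Eventually.of_forall fun z x => by simp [dx_zero_fun]⟩

theorem SymFam.sum (hU : IsOpen U) {ι : Type} (s : Finset ι) {F : ι → E → ℝ≥0 → ℂ}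
    (h : ∀ i ∈ s, SymFam U m (F i)) : SymFam U m (fun z => ∑ i ∈ s, F i z) := by
  classical
  induction s using Finset.induction_on with
  | empty => simpa using symFam_zero U m
  | insert i s hi ih =>
    rw [Finset.forall_mem_insert] at h
    refine (SymFam.add hU h.1 (ih h.2)).congr hU fun z _ => ?_
    simp [Finset.sum_insert hi]

theorem SymFam.mul (hU : IsOpen U) (hF : SymFam U m F) (hG : SymFam U m' G) :
    SymFam U (fun z => m z + m' z) (F * G) := by
  have hdx : ∀ z ∈ U, ∀ (d : ℕ) (x : ℝ≥0), dx d ((F * G) z) x = ∑ i ∈ Finset.range (d + 1),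
      (d.choose i : ℂ) * dx i (F z) x * dx (d - i) (G z) x := fun z hz d x =>
    dx_mul ((hF.smooth z hz).contDiffWithinAt d x) ((hG.smooth z hz).contDiffWithinAt d x)
  refine ⟨fun z hz => (hF.smooth z hz).mul (hG.smooth z hz), fun d x => ?_, fun d z₀ hz₀ => ?_⟩
  · refine AnalyticOnNhd.congr (hs := hU) (hg := fun z hz => (hdx z hz d x).symm) ?_
    refine Finset.analyticOnNhd_fun_sum _ fun i _ => ?_
    exact (analyticOnNhd_const.mul (hF.analytic i x)).mul (hG.analytic (d - i) x)
  · choose C hC0 hC using fun i => hF.bound i z₀ hz₀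
    choose D hD0 hD using fun i => hG.bound i z₀ hz₀
    refine ⟨∑ i ∈ Finset.range (d + 1), d.choose i * C i * D (d - i),
      Finset.sum_nonneg fun i _ => mul_nonneg (mul_nonneg (by positivity) (hC0 i)) (hD0 _), ?_⟩
    have hC' := (eventually_all_finset (Finset.range (d + 1))).2 fun i _ => hC i
    have hD' := (eventually_all_finset (Finset.range (d + 1))).2 fun i _ => hD (d - i)
    filter_upwards [hC', hD', hU.mem_nhds hz₀] with z h1 h2 hz x
    rw [hdx z hz, Finset.sum_mul]
    refine (norm_sum_le _ _).trans (Finset.sum_le_sum fun i hi => ?_)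
    have hid : i ≤ d := Nat.lt_succ_iff.1 (Finset.mem_range.1 hi)
    have hb := bracket_pos x
    rw [norm_mul, norm_mul, Complex.norm_natCast]
    calc (d.choose i : ℝ) * ‖dx i (F z) x‖ * ‖dx (d - i) (G z) x‖
        ≤ (d.choose i : ℝ) * (C i * bracket x ^ (m z - i)) *
            (D (d - i) * bracket x ^ (m' z - (d - i : ℕ))) := by
          have := h1 i hi x
          have := h2 i hi x
          have := hC0 i
          gcongr
      _ = d.choose i * C i * D (d - i) * (bracket x ^ (m z - i) *
            bracket x ^ (m' z - (d - i : ℕ))) := by ring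
      _ = _ := by
          rw [← Real.rpow_add hb]
          congr 2
          push_cast [hid]
          ring

theorem SymFam.comp {A : E' → E} {V : Set E'} (hF : SymFam U m F) (hA : AnalyticOnNhd ℂ A V)
    (hV : Set.MapsTo A V U) : SymFam V (fun y => m (A y)) (fun y => F (A y)) where
  smooth y hy := hF.smooth _ (hV hy)
  analytic d x := (hF.analytic d x).comp hA hV
  bound d y hy := by
    obtain ⟨C, hC0, hC⟩ := hF.bound d (A y) (hV hy)
    exact ⟨C, hC0, (hA y hy).continuousAt.eventually hC⟩

/-- If `ψ` is a symbol vanishing near zero, then the functions `ψ(x) x ^ α(z)` form a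
holomorphic family of symbols. -/
theorem symFam_mul_cpowFun {r : ℝ} {ψ : ℝ≥0 → ℂ} (hψ : IsSymbol r ψ)
    (hψ0 : VanishesNearZero ψ) {α : E → ℂ} (hα : AnalyticOnNhd ℂ α U) :
    SymFam U (fun z => r + (α z).re) (fun z => ψ * cpowFun (α z)) := by
  obtain ⟨δ, hδ, h0⟩ := hψ0
  have hnear : ∀ (z : E) (x : ℝ≥0), x < δ → (ψ * cpowFun (α z)) =ᶠ[𝓝 x] 0 := fun z x hx => by
    filter_upwards [gt_mem_nhds hx] with y hy
    simp [h0 y hy]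
  have hdx : ∀ (z : E) (d : ℕ) (x : ℝ≥0), 0 < x → dx d (ψ * cpowFun (α z)) x =
      ∑ i ∈ Finset.range (d + 1), (d.choose i : ℂ) * dx i ψ x *
        ((∏ l ∈ Finset.range (d - i), (α z - l)) * ((x : ℝ) : ℂ) ^ (α z - (d - i : ℕ))) :=
    fun z d x hx => by
      rw [dx_mul (SmoothHalf.contDiffWithinAt hψ.1 d x)
        (contDiffAt_ext_cpowFun (α z) (by exact_mod_cast hx) d).contDiffWithinAt]
      exact Finset.sum_congr rfl fun i _ => by rw [dx_cpowFun _ _ hx]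
  refine ⟨fun z _ => ?_, fun d x => ?_, fun d z₀ hz₀ => ?_⟩
  · intro x hx
    rcases (show (0 : ℝ) ≤ x from hx).eq_or_lt with rfl | hx'
    · refine (contDiffWithinAt_const (c := (0 : ℂ))).congr_of_eventuallyEq ?_ ?_
      · exact (ext_eventuallyEq (hnear z 0 hδ)).filter_mono nhdsWithin_le_nhds
      · exact (ext_eventuallyEq (hnear z 0 hδ)).eq_of_nhds
    · exact (hψ.1 x hx).mul (contDiffAt_ext_cpowFun (α z) hx' _).contDiffWithinAt
  · rcases lt_or_ge x δ with hx | hx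
    · have : (fun z => dx d (ψ * cpowFun (α z)) x) = fun _ => 0 := by
        funext z
        exact dx_eq_zero (hnear z x hx) d
      rw [this]
      exact analyticOnNhd_const
    · have hx' : 0 < x := hδ.trans_le hx
      have hx0 : ((x : ℝ) : ℂ) ≠ 0 := by
        have : (x : ℝ) ≠ 0 := by exact_mod_cast hx'.ne'
        exact_mod_cast this
      simp only [hdx _ d x hx']
      refine Finset.analyticOnNhd_fun_sum _ fun i _ =>
        analyticOnNhd_const.mul (AnalyticOnNhd.mul ?_ ?_)
      · exact Finset.analyticOnNhd_fun_prod _ fun l _ => hα.sub analyticOnNhd_const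
      · simp only [Complex.cpow_def_of_ne_zero hx0]
        exact (analyticOnNhd_const.mul (hα.sub analyticOnNhd_const)).cexp
  · choose D hD0 hD using hψ.2
    -- on `[δ, ∞)` the functions `x` and `⟨x⟩` are comparable
    set c : ℝ := 1 + (δ : ℝ)⁻¹ with hc
    have hδ' : (0 : ℝ) < δ := by exact_mod_cast hδ
    have hc1 : 1 ≤ c := by rw [hc]; have := inv_pos.2 hδ'; linarith
    set p : ℝ := |(α z₀).re| + 1 + d with hp
    have hα0 := (hα z₀ hz₀).continuousAt
    have hre : ∀ᶠ z in 𝓝 z₀, |(α z).re| < |(α z₀).re| + 1 :=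
      ((Complex.continuous_re.continuousAt.comp hα0).abs).eventually_lt_const (lt_add_one _)
    have hprod : ∀ i ∈ Finset.range (d + 1), ∀ᶠ z in 𝓝 z₀,
        ‖∏ l ∈ Finset.range (d - i), (α z - l)‖ <
          ‖∏ l ∈ Finset.range (d - i), (α z₀ - l)‖ + 1 := fun i _ =>
      (ContinuousAt.norm (by fun_prop)).eventually_lt_const (lt_add_one _)
    refine ⟨∑ i ∈ Finset.range (d + 1), d.choose i * D i *
      ((‖∏ l ∈ Finset.range (d - i), (α z₀ - l)‖ + 1) * c ^ p),
      Finset.sum_nonneg fun i _ => mul_nonneg (mul_nonneg (by positivity) (hD0 i).le)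
        (by positivity), ?_⟩
    filter_upwards [hre, (eventually_all_finset _).2 hprod] with z h1 h2 x
    have hb := bracket_pos x
    rcases lt_or_ge x δ with hx | hx
    · rw [dx_eq_zero (hnear z x hx), norm_zero]
      exact mul_nonneg (Finset.sum_nonneg fun i _ => mul_nonneg
        (mul_nonneg (by positivity) (hD0 i).le) (by positivity)) (by positivity)
    have hx' : 0 < x := hδ.trans_le hx
    have hx0 : (0 : ℝ) < x := by exact_mod_cast hx'
    have hcx : bracket x ≤ c * x := by
      refine Real.sqrt_le_iff.2 ⟨by positivity, ?_⟩
      have h3 : (1 : ℝ) ≤ (δ : ℝ)⁻¹ * x := by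
        rw [inv_mul_eq_div, one_le_div hδ']
        exact_mod_cast hx
      have h4 : c * x = x + (δ : ℝ)⁻¹ * x := by rw [hc]; ring
      rw [h4]
      nlinarith
    have hpow : ∀ q : ℝ, |q| ≤ p → (x : ℝ) ^ q ≤ c ^ p * bracket x ^ q := by
      intro q hq
      rcases le_total 0 q with hq0 | hq0
      · calc (x : ℝ) ^ q ≤ bracket x ^ q := Real.rpow_le_rpow hx0.le (le_bracket x) hq0
          _ = 1 * bracket x ^ q := (one_mul _).symm
          _ ≤ _ := by
            have := Real.one_le_rpow hc1 ((abs_nonneg q).trans hq)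
            gcongr
      · have h5 : (c * x : ℝ) ^ q ≤ bracket x ^ q := Real.rpow_le_rpow_of_nonpos hb hcx hq0
        rw [Real.mul_rpow (by positivity) hx0.le] at h5
        calc (x : ℝ) ^ q = c ^ (-q) * (c ^ q * (x : ℝ) ^ q) := by
              rw [← mul_assoc, ← Real.rpow_add (by positivity)]; simp
          _ ≤ c ^ (-q) * bracket x ^ q := by gcongr
          _ ≤ _ := by
            gcongr
            rw [← abs_of_nonpos hq0]
            exact hq
    rw [hdx z d x hx', Finset.sum_mul]
    refine (norm_sum_le _ _).trans (Finset.sum_le_sum fun i hi => ?_)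
    have hid : i ≤ d := Nat.lt_succ_iff.1 (Finset.mem_range.1 hi)
    have hpi : (x : ℝ) ^ (α z - (d - i : ℕ)).re ≤ c ^ p * bracket x ^ (α z - (d - i : ℕ)).re := by
      refine hpow _ ?_
      rw [Complex.sub_re, Complex.natCast_re]
      have h6 : ((d - i : ℕ) : ℝ) ≤ d := by exact_mod_cast Nat.sub_le d i
      calc |(α z).re - ((d - i : ℕ) : ℝ)| ≤ |(α z).re| + |((d - i : ℕ) : ℝ)| := abs_sub _ _
        _ ≤ p := by rw [Nat.abs_cast, hp]; linarith
    rw [norm_mul, norm_mul, norm_mul, Complex.norm_natCast,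
      Complex.norm_cpow_eq_rpow_re_of_pos hx0]
    have h7 := hD i x
    have h8 := (h2 i hi).le
    have h9 : bracket x ^ (r - i) * bracket x ^ (α z - (d - i : ℕ)).re =
        bracket x ^ (r + (α z).re - d) := by
      rw [← Real.rpow_add hb]
      congr 1
      simp only [Complex.sub_re, Complex.natCast_re]
      push_cast [hid]
      ring
    have hD0' := (hD0 i).le
    calc _ ≤ (d.choose i : ℝ) * (D i * bracket x ^ (r - i)) *
          ((‖∏ l ∈ Finset.range (d - i), (α z₀ - l)‖ + 1) *
            (c ^ p * bracket x ^ (α z - (d - i : ℕ)).re)) := by gcongr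
      _ = d.choose i * D i * ((‖∏ l ∈ Finset.range (d - i), (α z₀ - l)‖ + 1) * c ^ p) *
          (bracket x ^ (r - i) * bracket x ^ (α z - (d - i : ℕ)).re) := by ring
      _ = _ := by rw [h9]

end Families

/-! ### Cauchy inequalities for higher derivatives -/

section Cauchy

variable {E : Type} [NormedAddCommGroup E] [NormedSpace ℂ E]

/-- Cauchy inequalities for the `n`-th derivative, by iteration of the one for the first derivative
on balls of half the radius. -/
theorem exists_norm_iteratedFDeriv_le (n : ℕ) : ∀ {F : Type} [NormedAddCommGroup F]
    [NormedSpace ℂ F] [CompleteSpace F] {R : ℝ}, 0 < R → ∃ C : ℝ, 0 ≤ C ∧ ∀ (f : E → F) (z₀ : E)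
      (B : ℝ), AnalyticOnNhd ℂ f (Metric.ball z₀ R) → (∀ z ∈ Metric.ball z₀ R, ‖f z‖ ≤ B) →
        ∀ z ∈ Metric.ball z₀ (R / 2 ^ n), ‖iteratedFDeriv ℂ n f z‖ ≤ C * B := by
  induction n with
  | zero =>
    intro F _ _ _ R hR
    refine ⟨1, zero_le_one, fun f z₀ B hf hB z hz => ?_⟩
    rw [norm_iteratedFDeriv_zero, one_mul]
    exact hB z (by simpa using hz)
  | succ n ih =>
    intro F _ _ _ R hR
    obtain ⟨C, hC0, hC⟩ := ih (F := E →L[ℂ] F) (half_pos hR)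
    refine ⟨C * (4 / R), by positivity, fun f z₀ B hf hB z hz => ?_⟩
    rw [← norm_iteratedFDeriv_fderiv, mul_assoc]
    refine hC (fderiv ℂ f) z₀ (4 / R * B) (hf.fderiv.mono (Metric.ball_subset_ball (by linarith)))
      (fun w hw => ?_) z (by rwa [pow_succ', ← div_div] at hz)
    have hsub : Metric.ball w (R / 2) ⊆ Metric.ball z₀ R := by
      refine Metric.ball_subset_ball' ?_
      have := Metric.mem_ball.1 hw
      linarith
    have hwR : w ∈ Metric.ball z₀ R := hsub (Metric.mem_ball_self (half_pos hR))
    have h1 := Complex.norm_fderiv_le_div_of_mapsTo_ball (f := f) (c := w) (R₁ := R / 2)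
      (R₂ := 2 * B) (hf.differentiableOn.mono hsub) (fun y hy => by
        rw [mem_closedBall_iff_norm]
        calc ‖f y - f w‖ ≤ ‖f y‖ + ‖f w‖ := norm_sub_le _ _
          _ ≤ 2 * B := by linarith [hB y (hsub hy), hB w hwR]) (half_pos hR)
    refine h1.trans (le_of_eq ?_)
    field_simp
    ring

/-- Locally uniform estimates of a holomorphic family of functions of `x` entail estimates for all
derivatives with respect to the parameter, with an arbitrarily small loss in the exponent. -/
theorem exists_norm_iteratedFDeriv_le_of_isCompact {U : Set E} (hU : IsOpen U) {m : E → ℝ}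
    (hm : ContinuousOn m U) {f : ℝ≥0 → E → ℂ} (hf : ∀ x, AnalyticOnNhd ℂ (f x) U)
    (hb : ∀ z₀ ∈ U, ∃ C : ℝ, 0 ≤ C ∧ ∀ᶠ z in 𝓝 z₀, ∀ x : ℝ≥0, ‖f x z‖ ≤ C * bracket x ^ m z)
    {K : Set E} (hKU : K ⊆ U) (hK : IsCompact K) (n : ℕ) {ε : ℝ} (hε : 0 < ε) :
    ∃ C : ℝ, 0 < C ∧ ∀ z ∈ K, ∀ x : ℝ≥0,
      ‖iteratedFDeriv ℂ n (f x) z‖ ≤ C * bracket x ^ (m z + ε) := by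
  refine hK.induction_on (p := fun S => ∃ C : ℝ, 0 < C ∧ ∀ z ∈ S, ∀ x : ℝ≥0,
      ‖iteratedFDeriv ℂ n (f x) z‖ ≤ C * bracket x ^ (m z + ε)) ⟨1, one_pos, by simp⟩ ?_ ?_ ?_
  · rintro S T hST ⟨C, hC0, hC⟩
    exact ⟨C, hC0, fun z hz => hC z (hST hz)⟩
  · rintro S T ⟨C, hC0, hC⟩ ⟨D, hD0, hD⟩
    refine ⟨C + D, by positivity, ?_⟩
    rintro z (hz | hz) x
    · exact (hC z hz x).trans (mul_le_mul_of_nonneg_right (by linarith)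
        (Real.rpow_nonneg (bracket_pos x).le _))
    · exact (hD z hz x).trans (mul_le_mul_of_nonneg_right (by linarith)
        (Real.rpow_nonneg (bracket_pos x).le _))
  · intro z₀ hz₀
    have hz₀U := hKU hz₀
    obtain ⟨C, hC0, hC⟩ := hb z₀ hz₀U
    have hmz : ∀ᶠ z in 𝓝 z₀, |m z - m z₀| < ε / 2 :=
      (hm.continuousAt (hU.mem_nhds hz₀U)).eventually (Metric.ball_mem_nhds _ (half_pos hε))
    obtain ⟨R, hR0, hR⟩ := Metric.eventually_nhds_iff_ball.1
      ((hC.and hmz).and (hU.mem_nhds hz₀U))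
    obtain ⟨D, hD0, hD⟩ := exists_norm_iteratedFDeriv_le (E := E) n (F := ℂ) hR0
    refine ⟨Metric.ball z₀ (R / 2 ^ n),
      mem_nhdsWithin_of_mem_nhds (Metric.ball_mem_nhds _ (by positivity)),
      D * C + 1, by positivity, fun z hz x => ?_⟩
    have hzR : z ∈ Metric.ball z₀ R := by
      refine Metric.ball_subset_ball ?_ hz
      exact div_le_self hR0.le (one_le_pow₀ one_le_two)
    have h1 := hD (f x) z₀ (C * bracket x ^ (m z₀ + ε / 2))
      ((hf x).mono fun w hw => (hR w hw).2) (fun w hw => ((hR w hw).1.1 x).trans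
        (mul_le_mul_of_nonneg_left (bracket_rpow_mono
          (by linarith [(abs_lt.1 (hR w hw).1.2).2]) x) hC0)) z hz
    have h2 : bracket x ^ (m z₀ + ε / 2) ≤ bracket x ^ (m z + ε) :=
      bracket_rpow_mono (by linarith [(abs_lt.1 (hR z hzR).1.2).1]) x
    have h3 : 0 < bracket x ^ (m z + ε) := Real.rpow_pos_of_pos (bracket_pos x) _
    calc _ ≤ D * (C * bracket x ^ (m z₀ + ε / 2)) := h1
      _ ≤ D * (C * bracket x ^ (m z + ε)) := by gcongr
      _ ≤ (D * C + 1) * bracket x ^ (m z + ε) := by nlinarith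

end Cauchy

/-! ### Holomorphic families with polyhomogeneous expansions -/

section HolExp

variable {E E' : Type} [NormedAddCommGroup E] [NormedSpace ℂ E]
  [NormedAddCommGroup E'] [NormedSpace ℂ E']

theorem remainder_eq (χ : ℝ≥0 → ℝ) (α : ℂ) (a : ℕ → ℂ) (N : ℕ) (σ : ℝ≥0 → ℂ) :
    remainder χ α a N σ = σ + ∑ j ∈ Finset.range N, (-a j) • (exc χ * cpowFun (α - j)) := by
  funext x
  simp only [remainder, Pi.add_apply, Finset.sum_apply, Pi.smul_apply, Pi.mul_apply, smul_eq_mul,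
    exc, cpowFun, sub_eq_add_neg, neg_mul, Finset.sum_neg_distrib]
  congr 2
  exact Finset.sum_congr rfl fun j _ => by ring

theorem remainder_zero (χ : ℝ≥0 → ℝ) (α : ℂ) (a : ℕ → ℂ) (σ : ℝ≥0 → ℂ) :
    remainder χ α a 0 σ = σ := by
  simp [remainder_eq]

theorem remainder_eq_succ_add (χ : ℝ≥0 → ℝ) (α : ℂ) (a : ℕ → ℂ) (N : ℕ) (σ : ℝ≥0 → ℂ) :
    remainder χ α a N σ = remainder χ α a (N + 1) σ + a N • (exc χ * cpowFun (α - N)) := by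
  simp only [remainder_eq, Finset.sum_range_succ, neg_smul]
  abel

/-- `τ z` is a holomorphic family of polyhomogeneous symbols of order `α z`, with the expansion
`∑ⱼ aⱼ(z) x ^ (α(z) - j)`: the coefficients are holomorphic and all the remainders are
holomorphic families of symbols in the sense of `SymFam`. -/
def HolExp (U : Set E) (α : E → ℂ) (a : ℕ → E → ℂ) (τ : E → ℝ≥0 → ℂ) : Prop :=
  (∀ j, AnalyticOnNhd ℂ (a j) U) ∧ ∃ χ, IsExcision χ ∧ ∀ N : ℕ,
    SymFam U (fun z => (α z).re - N) (fun z => remainder χ (α z) (fun j => a j z) N (τ z))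

variable {U : Set E} {α β : E → ℂ} {a b : ℕ → E → ℂ} {τ σ : E → ℝ≥0 → ℂ}

theorem VanishesNearZero.add {ψ φ : ℝ≥0 → ℂ} (hψ : VanishesNearZero ψ) (hφ : VanishesNearZero φ) :
    VanishesNearZero (ψ + φ) := by
  obtain ⟨δ, hδ, h⟩ := hψ
  obtain ⟨δ', hδ', h'⟩ := hφ
  exact ⟨min δ δ', lt_min hδ hδ', fun x hx => by
    simp [h x (hx.trans_le (min_le_left _ _)), h' x (hx.trans_le (min_le_right _ _))]⟩

theorem VanishesNearZero.mul {ψ : ℝ≥0 → ℂ} (hψ : VanishesNearZero ψ) (φ : ℝ≥0 → ℂ) :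
    VanishesNearZero (ψ * φ) := by
  obtain ⟨δ, hδ, h⟩ := hψ
  exact ⟨δ, hδ, fun x hx => by simp [h x hx]⟩

theorem VanishesNearZero.smul {ψ : ℝ≥0 → ℂ} (c : ℂ) (hψ : VanishesNearZero ψ) :
    VanishesNearZero (c • ψ) := by
  obtain ⟨δ, hδ, h⟩ := hψ
  exact ⟨δ, hδ, fun x hx => by simp [h x hx]⟩

/-- The condition in `HolExp` for one excision function entails it for all of them. -/
theorem HolExp.remainder_symFam (hU : IsOpen U) (hα : AnalyticOnNhd ℂ α U) (h : HolExp U α a τ)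
    {χ : ℝ≥0 → ℝ} (hχ : IsExcision χ) (N : ℕ) :
    SymFam U (fun z => (α z).re - N) (fun z => remainder χ (α z) (fun j => a j z) N (τ z)) := by
  obtain ⟨ha, χ', hχ', h⟩ := h
  -- two excision functions differ by a function with compact support in `(0, ∞)`
  have hdiff : ∀ r, IsSymbol r (exc χ' + (-1 : ℂ) • exc χ) := fun r => by
    have := (hχ'.isSymbol_sub_one r).add ((hχ.isSymbol_sub_one r).smul (-1))
    convert this using 1
    funext x
    simp only [Pi.add_apply, Pi.smul_apply, smul_eq_mul]
    ring
  have hzero : VanishesNearZero (exc χ' + (-1 : ℂ) • exc χ) :=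
    hχ'.vanishesNearZero.add (hχ.vanishesNearZero.smul _)
  have hsum : SymFam U (fun z => (α z).re - N) (fun z => ∑ j ∈ Finset.range N,
      a j z • ((exc χ' + (-1 : ℂ) • exc χ) * cpowFun (α z - j))) := by
    refine SymFam.sum hU _ fun j hj => ?_
    refine ((symFam_mul_cpowFun (hdiff (-N)) hzero
      (hα.sub (analyticOnNhd_const (v := (j : ℂ))))).mono hU fun z _ => ?_).smul (ha j)
    simp only [Pi.sub_apply, Complex.sub_re, Complex.natCast_re]
    linarith [Nat.cast_nonneg (α := ℝ) j]
  refine (SymFam.add hU (h N) hsum).congr hU fun z _ => ?_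
  simp only [Pi.add_apply, remainder_eq, add_assoc, ← Finset.sum_add_distrib]
  congr 1
  refine Finset.sum_congr rfl fun j _ => ?_
  funext x
  simp only [Pi.add_apply, Pi.smul_apply, Pi.mul_apply, smul_eq_mul]
  ring

theorem HolExp.symFam (h : HolExp U α a τ) : SymFam U (fun z => (α z).re) τ := by
  obtain ⟨-, χ, hχ, h⟩ := h
  simpa [remainder_zero] using h 0

theorem HolExp.hasExpansion (h : HolExp U α a τ) {z : E} (hz : z ∈ U) :
    HasExpansion (τ z) (α z) (fun j => a j z) := by
  obtain ⟨-, χ, hχ, hR⟩ := id h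
  exact ⟨h.symFam.isSymbol hz le_rfl, χ, hχ, fun N _ => (hR N).isSymbol hz le_rfl⟩

theorem HolExp.mono_set {V : Set E} (h : HolExp U α a τ) (hV : V ⊆ U) : HolExp V α a τ := by
  obtain ⟨ha, χ, hχ, hR⟩ := h
  exact ⟨fun j => (ha j).mono hV, χ, hχ, fun N => (hR N).mono_set hV⟩

theorem HolExp.smul (h : HolExp U α a τ) {g : E → ℂ} (hg : AnalyticOnNhd ℂ g U) :
    HolExp U α (fun j z => g z * a j z) (fun z => g z • τ z) := by
  obtain ⟨ha, χ, hχ, hR⟩ := h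
  refine ⟨fun j => hg.mul (ha j), χ, hχ, fun N => ?_⟩
  convert (hR N).smul hg using 2 with z
  simp only [remainder_eq, smul_add, Finset.smul_sum, smul_smul, mul_neg]

theorem HolExp.comp {A : E' → E} {V : Set E'} (h : HolExp U α a τ) (hA : AnalyticOnNhd ℂ A V)
    (hV : Set.MapsTo A V U) :
    HolExp V (fun y => α (A y)) (fun j y => a j (A y)) (fun y => τ (A y)) := by
  obtain ⟨ha, χ, hχ, hR⟩ := h
  exact ⟨fun j => (ha j).comp hA hV, χ, hχ, fun N => (hR N).comp hA hV⟩

theorem sum_range_sum_antidiagonal {M : Type} [AddCommMonoid M] (N : ℕ) (f : ℕ → ℕ → M) :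
    ∑ j ∈ Finset.range N, ∑ p ∈ Finset.HasAntidiagonal.antidiagonal j, f p.1 p.2 =
      ∑ p ∈ Finset.range N ×ˢ Finset.range N, if p.1 + p.2 < N then f p.1 p.2 else 0 := by
  rw [← Finset.sum_filter, ← Finset.sum_fiberwise_of_maps_to (s := (Finset.range N ×ˢ
    Finset.range N).filter fun p => p.1 + p.2 < N) (t := Finset.range N) (g := fun p => p.1 + p.2)]
  · refine Finset.sum_congr rfl fun j hj => Finset.sum_congr ?_ fun _ _ => rfl
    ext p
    simp only [Finset.HasAntidiagonal.mem_antidiagonal, Finset.mem_filter,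
      Finset.mem_product, Finset.mem_range] at hj ⊢
    omega
  · intro p hp
    simp only [Finset.mem_filter] at hp
    exact Finset.mem_range.2 hp.2

/-- The Cauchy product of expansions, at the level of remainders. The last sum accounts for the
terms of order below `N`, in which `χ²` occurs instead of `χ`, and for the superfluous terms. The
condition `χ 0 = 0` is needed because of the junk value of `0 ^ β`. -/
theorem remainder_mul (χ : ℝ≥0 → ℝ) (hχ : χ 0 = 0) (α β : ℂ) (a b : ℕ → ℂ) (N : ℕ)
    (τ σ : ℝ≥0 → ℂ) :
    remainder χ (α + β)
        (fun j => ∑ p ∈ Finset.HasAntidiagonal.antidiagonal j, a p.1 * b p.2) N (τ * σ) =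
      remainder χ α a N τ * σ +
      (∑ i ∈ Finset.range N, a i • (exc χ * cpowFun (α - i))) * remainder χ β b N σ +
      ∑ p ∈ Finset.range N ×ˢ Finset.range N, (a p.1 * b p.2) •
        ((if p.1 + p.2 < N then exc χ * (exc χ + fun _ => -1) else exc χ * exc χ) *
          cpowFun (α + β - (p.1 + p.2 : ℕ))) := by
  set A : ℝ≥0 → ℂ := ∑ i ∈ Finset.range N, a i • (exc χ * cpowFun (α - i)) with hA
  set B : ℝ≥0 → ℂ := ∑ i ∈ Finset.range N, b i • (exc χ * cpowFun (β - i)) with hB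
  have hR1 : remainder χ α a N τ = τ - A := by
    simp [remainder_eq, hA, Finset.sum_neg_distrib, sub_eq_add_neg]
  have hR2 : remainder χ β b N σ = σ - B := by
    simp [remainder_eq, hB, Finset.sum_neg_distrib, sub_eq_add_neg]
  have hAB : A * B = ∑ p ∈ Finset.range N ×ˢ Finset.range N, (a p.1 * b p.2) •
      (exc χ * exc χ * cpowFun (α + β - (p.1 + p.2 : ℕ))) := by
    rw [hA, hB, Finset.sum_mul_sum, ← Finset.sum_product']
    refine Finset.sum_congr rfl fun p _ => ?_
    funext x
    simp only [Pi.mul_apply, Pi.smul_apply, smul_eq_mul]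
    rcases eq_or_ne x 0 with rfl | hx
    · simp [exc, hχ]
    · have hx0 : ((x : ℝ) : ℂ) ≠ 0 := by
        have : (x : ℝ) ≠ 0 := by exact_mod_cast hx
        exact_mod_cast this
      have hpow : cpowFun (α - p.1) x * cpowFun (β - p.2) x =
          cpowFun (α + β - (p.1 + p.2 : ℕ)) x := by
        simp only [cpowFun]
        rw [← Complex.cpow_add _ _ hx0]
        congr 1
        push_cast
        ring
      rw [← hpow]
      ring
  have hC : remainder χ (α + β)
        (fun j => ∑ p ∈ Finset.HasAntidiagonal.antidiagonal j, a p.1 * b p.2) N (τ * σ) =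
      τ * σ - ∑ p ∈ Finset.range N ×ˢ Finset.range N, if p.1 + p.2 < N then
        (a p.1 * b p.2) • (exc χ * cpowFun (α + β - (p.1 + p.2 : ℕ))) else 0 := by
    rw [remainder_eq, sub_eq_add_neg, ← sum_range_sum_antidiagonal N fun i l =>
      (a i * b l) • (exc χ * cpowFun (α + β - (i + l : ℕ))), ← Finset.sum_neg_distrib]
    congr 1
    refine Finset.sum_congr rfl fun j _ => ?_
    rw [neg_smul, Finset.sum_smul]
    congr 1
    refine Finset.sum_congr rfl fun p hp => ?_
    rw [Finset.HasAntidiagonal.mem_antidiagonal.1 hp]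
  rw [hC, hR1, hR2]
  have hsum : ∑ p ∈ Finset.range N ×ˢ Finset.range N, (a p.1 * b p.2) •
        ((if p.1 + p.2 < N then exc χ * (exc χ + fun _ => -1) else exc χ * exc χ) *
          cpowFun (α + β - (p.1 + p.2 : ℕ))) = A * B -
      ∑ p ∈ Finset.range N ×ˢ Finset.range N, if p.1 + p.2 < N then
        (a p.1 * b p.2) • (exc χ * cpowFun (α + β - (p.1 + p.2 : ℕ))) else 0 := by
    rw [hAB, ← Finset.sum_sub_distrib]
    refine Finset.sum_congr rfl fun p _ => ?_
    split_ifs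
    · funext x
      simp only [Pi.mul_apply, Pi.smul_apply, Pi.sub_apply, Pi.add_apply, smul_eq_mul]
      ring
    · rw [sub_zero]
  rw [hsum]
  ring

theorem HolExp.mul (hU : IsOpen U) (hα : AnalyticOnNhd ℂ α U) (hβ : AnalyticOnNhd ℂ β U)
    (h : HolExp U α a τ) (h' : HolExp U β b σ) :
    HolExp U (α + β)
      (fun j z => ∑ p ∈ Finset.HasAntidiagonal.antidiagonal j, a p.1 z * b p.2 z) (τ * σ) := by
  have hχ := isExcision_stepExc one_pos
  have hχ0 : stepExc 1 0 = 0 := stepExc_eq_zero one_pos zero_le_one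
  refine ⟨fun j => Finset.analyticOnNhd_fun_sum _ fun p _ => (h.1 p.1).mul (h'.1 p.2), _, hχ,
    fun N => ?_⟩
  have h1 : SymFam U (fun z => ((α + β) z).re - N) (fun z =>
      remainder (stepExc 1) (α z) (fun j => a j z) N (τ z) * σ z) := by
    refine ((h.remainder_symFam hU hα hχ N).mul hU h'.symFam).mono hU fun z _ => ?_
    simp only [Pi.add_apply, Complex.add_re]
    linarith
  have h2 : SymFam U (fun z => ((α + β) z).re - N) (fun z =>
      (∑ i ∈ Finset.range N, a i z • (exc (stepExc 1) * cpowFun (α z - i))) *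
        remainder (stepExc 1) (β z) (fun j => b j z) N (σ z)) := by
    have hA : SymFam U (fun z => (α z).re) (fun z =>
        ∑ i ∈ Finset.range N, a i z • (exc (stepExc 1) * cpowFun (α z - i))) := by
      refine SymFam.sum hU _ fun i _ => SymFam.smul ?_ (h.1 i)
      refine (symFam_mul_cpowFun hχ.isSymbol hχ.vanishesNearZero
        (hα.sub (analyticOnNhd_const (v := (i : ℂ))))).mono hU fun z _ => ?_
      simp only [Pi.sub_apply, Complex.sub_re, Complex.natCast_re]
      linarith [Nat.cast_nonneg (α := ℝ) i]
    refine (hA.mul hU (h'.remainder_symFam hU hβ hχ N)).mono hU fun z _ => ?_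
    simp only [Pi.add_apply, Complex.add_re]
    linarith
  have h3 : SymFam U (fun z => ((α + β) z).re - N) (fun z =>
      ∑ p ∈ Finset.range N ×ˢ Finset.range N, (a p.1 z * b p.2 z) •
        ((if p.1 + p.2 < N then exc (stepExc 1) * (exc (stepExc 1) + fun _ => -1)
          else exc (stepExc 1) * exc (stepExc 1)) *
          cpowFun (α z + β z - (p.1 + p.2 : ℕ)))) := by
    refine SymFam.sum hU _ fun p _ => SymFam.smul ?_ ((h.1 p.1).mul (h'.1 p.2))
    have hsymb := hχ.isSymbol.symFam (Set.univ : Set ℂ)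
    split_ifs with hp
    · have h4 : IsSymbol (-N) (exc (stepExc 1) * (exc (stepExc 1) + fun _ => -1)) :=
        (hsymb.mul isOpen_univ ((hχ.isSymbol_sub_one (-N)).symFam Set.univ)).isSymbol
          (Set.mem_univ 0) (by simp)
      refine (symFam_mul_cpowFun h4 (hχ.vanishesNearZero.mul _) ((hα.add hβ).sub
        (analyticOnNhd_const (v := ((p.1 + p.2 : ℕ) : ℂ))))).mono hU fun z _ => ?_
      simp only [Pi.sub_apply, Complex.sub_re, Complex.natCast_re, Pi.add_apply]
      linarith [Nat.cast_nonneg (α := ℝ) (p.1 + p.2)]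
    · have h4 : IsSymbol 0 (exc (stepExc 1) * exc (stepExc 1)) :=
        (hsymb.mul isOpen_univ hsymb).isSymbol (Set.mem_univ 0) (by simp)
      refine (symFam_mul_cpowFun h4 (hχ.vanishesNearZero.mul _) ((hα.add hβ).sub
        (analyticOnNhd_const (v := ((p.1 + p.2 : ℕ) : ℂ))))).mono hU fun z _ => ?_
      have hpN : (N : ℝ) ≤ ((p.1 + p.2 : ℕ) : ℝ) := by exact_mod_cast not_lt.1 hp
      simp only [Pi.sub_apply, Complex.sub_re, Complex.natCast_re, Pi.add_apply]
      linarith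
  refine (SymFam.add hU (SymFam.add hU h1 h2) h3).congr hU fun z _ => ?_
  exact (remainder_mul (stepExc 1) hχ0 (α z) (β z) (fun j => a j z) (fun j => b j z) N (τ z)
    (σ z)).symm

end HolExp

/-! ### Simple holomorphic families -/

section SimpleFamilies

variable {k : ℕ} {U : Set (Fin k → ℂ)} {L : Fin k →₀ ℝ} {c : ℝ}

theorem analyticOnNhd_affOrder (L : Fin k →₀ ℝ) (c : ℝ) (U : Set (Fin k → ℂ)) :
    AnalyticOnNhd ℂ (affOrder L c) U :=
  (analyticOnNhd_linForm L U).add analyticOnNhd_const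

theorem continuous_affOrder (L : Fin k →₀ ℝ) (c : ℝ) : Continuous (affOrder L c) :=
  (continuous_linForm L).add continuous_const

/-- An expansion with holomorphic coefficients and remainders makes a simple holomorphic family. -/
theorem HolExp.isSimpleHolFamily (hU : IsOpen U) {a : ℕ → (Fin k → ℂ) → ℂ}
    {τ : (Fin k → ℂ) → ℝ≥0 → ℂ} (h : HolExp U (affOrder L c) a τ) : IsSimpleHolFamily U L c τ := by
  refine ⟨a, fun z hz => h.hasExpansion hz, fun χ hχ N _ d => ?_⟩
  have hR := h.remainder_symFam hU (analyticOnNhd_affOrder L c U) hχ N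
  refine ⟨hR.analytic d, fun K hKU hK n ε hε => ?_⟩
  refine exists_norm_iteratedFDeriv_le_of_isCompact hU (m := fun z => (affOrder L c z).re - N - d)
    (Continuous.continuousOn ?_) (hR.analytic d) (hR.bound d) hKU hK n hε
  exact ((Complex.continuous_re.comp (continuous_affOrder L c)).sub continuous_const).sub
    continuous_const

/-- The coefficients of a simple holomorphic family are holomorphic, and its remainders are
holomorphic families of symbols. This uses that the defining conditions hold for all excision
functions: at a given `x`, some of them vanish and others are equal to one. -/
theorem IsSimpleHolFamily.exists_holExp (hU : IsOpen U) {τ : (Fin k → ℂ) → ℝ≥0 → ℂ}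
    (h : IsSimpleHolFamily U L c τ) : ∃ a, HolExp U (affOrder L c) a τ := by
  obtain ⟨a, hexp, hR⟩ := h
  have hτ : ∀ (d : ℕ) (x : ℝ≥0), AnalyticOnNhd ℂ (fun z => dx d (τ z) x) U := fun d x => by
    -- an excision function vanishing on `[0, x + 1]` gives the remainder `τ z` near `x`
    have hx : 0 < x + 1 := by positivity
    refine ((hR _ (isExcision_stepExc hx) 1 le_rfl d).1 x).congr hU fun z _ => ?_
    refine dx_congr ?_ d
    filter_upwards [gt_mem_nhds (lt_add_one x)] with y hy
    simp [remainder, stepExc_eq_zero hx hy.le]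
  have h2 : (0 : ℝ≥0) < 1 / 2 := by positivity
  have hχ := isExcision_stepExc h2
  have hrem : ∀ (N d : ℕ) (x : ℝ≥0), AnalyticOnNhd ℂ (fun z => dx d
      (remainder (stepExc (1 / 2)) (affOrder L c z) (fun j => a j z) N (τ z)) x) U := by
    rintro (_ | N) d x
    · simpa [remainder_zero] using hτ d x
    · exact (hR _ hχ (N + 1) (by omega) d).1 x
  -- at `x = 1` two successive remainders differ by the coefficient
  have ha : ∀ N, AnalyticOnNhd ℂ (a N) U := fun N => by
    refine ((hrem N 0 1).sub (hrem (N + 1) 0 1)).congr hU fun z _ => ?_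
    have h1 : stepExc (1 / 2) 1 = 1 := stepExc_eq_one h2 (by norm_num)
    simp only [Pi.sub_apply, dx_zero]
    rw [remainder_eq_succ_add]
    rw [one_div] at h1
    simp [exc, cpowFun, h1]
  have hpow : ∀ N : ℕ, SymFam U (fun z => (affOrder L c z).re - N)
      (fun z => a N z • (exc (stepExc (1 / 2)) * cpowFun (affOrder L c z - N))) := fun N => by
    refine ((symFam_mul_cpowFun hχ.isSymbol hχ.vanishesNearZero
      ((analyticOnNhd_affOrder L c U).sub (analyticOnNhd_const (v := (N : ℂ))))).mono hU
        fun z _ => ?_).smul (ha N)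
    simp
  have hsmooth : ∀ z ∈ U, ∀ N, SmoothHalf
      (remainder (stepExc (1 / 2)) (affOrder L c z) (fun j => a j z) N (τ z)) := by
    intro z hz N
    induction N with
    | zero => simpa [remainder_zero] using (hexp z hz).1.1
    | succ N ih =>
      have := ih.add (SmoothHalf.smul (-1) ((hpow N).smooth z hz))
      rw [remainder_eq_succ_add] at this
      simpa using this
  refine ⟨a, ha, _, hχ, fun N => ?_⟩
  -- the loss `ε = 1` in the estimates of a remainder is compensated for by one more term
  have hnext : SymFam U (fun z => (affOrder L c z).re - N) (fun z =>
      remainder (stepExc (1 / 2)) (affOrder L c z) (fun j => a j z) (N + 1) (τ z)) := by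
    refine ⟨fun z hz => hsmooth z hz _, hrem (N + 1), fun d z₀ hz₀ => ?_⟩
    obtain ⟨r, hr0, hr⟩ := Metric.nhds_basis_closedBall.mem_iff.1 (hU.mem_nhds hz₀)
    obtain ⟨C, hC0, hC⟩ := (hR _ hχ (N + 1) (by omega) d).2 _ hr (isCompact_closedBall _ _) 0 1
      one_pos
    refine ⟨C, hC0.le, ?_⟩
    filter_upwards [Metric.closedBall_mem_nhds z₀ hr0] with z hz x
    have h3 := hC z hz x
    rw [norm_iteratedFDeriv_zero] at h3
    refine h3.trans (le_of_eq ?_)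
    congr 2
    push_cast
    ring
  refine (SymFam.add hU hnext (hpow N)).congr hU fun z _ => ?_
  exact (remainder_eq_succ_add _ _ _ _ _).symm

theorem IsSimpleHolFamily.mono_set {V : Set (Fin k → ℂ)} (hU : IsOpen U) (hV : IsOpen V)
    {τ : (Fin k → ℂ) → ℝ≥0 → ℂ} (h : IsSimpleHolFamily U L c τ) (hVU : V ⊆ U) :
    IsSimpleHolFamily V L c τ := by
  obtain ⟨a, ha⟩ := h.exists_holExp hU
  exact (ha.mono_set hVU).isSimpleHolFamily hV

theorem IsSimpleHolFamily.mul (hU : IsOpen U) {τ σ : (Fin k → ℂ) → ℝ≥0 → ℂ} {L' : Fin k →₀ ℝ}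
    {c' : ℝ} (h : IsSimpleHolFamily U L c τ) (h' : IsSimpleHolFamily U L' c' σ) :
    IsSimpleHolFamily U (L + L') (c + c') (τ * σ) := by
  obtain ⟨a, ha⟩ := h.exists_holExp hU
  obtain ⟨b, hb⟩ := h'.exists_holExp hU
  refine HolExp.isSimpleHolFamily hU (a := fun j z => ∑ p ∈ Finset.HasAntidiagonal.antidiagonal j,
    a p.1 z * b p.2 z) ?_
  convert ha.mul hU (analyticOnNhd_affOrder L c U) (analyticOnNhd_affOrder L' c' U) hb using 1
  funext z
  simp only [affOrder, Pi.add_apply, linForm_add]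
  push_cast
  ring

theorem IsSimpleHolFamily.smul (hU : IsOpen U) {τ : (Fin k → ℂ) → ℝ≥0 → ℂ}
    (h : IsSimpleHolFamily U L c τ) {g : (Fin k → ℂ) → ℂ} (hg : AnalyticOnNhd ℂ g U) :
    IsSimpleHolFamily U L c (fun z => g z • τ z) := by
  obtain ⟨a, ha⟩ := h.exists_holExp hU
  exact (ha.smul hg).isSimpleHolFamily hU

theorem analyticOnNhd_pullMap {m : ℕ} (A : (Fin k →₀ ℝ) →ₗ[ℝ] (Fin m →₀ ℝ))
    (V : Set (Fin m → ℂ)) : AnalyticOnNhd ℂ (pullMap A) V := by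
  intro y _
  exact AnalyticAt.pi fun i => analyticOnNhd_linForm _ Set.univ y trivial

theorem analyticOnNhd_slice {m : ℕ} (A : (Fin k →₀ ℝ) →ₗ[ℝ] (Fin m →₀ ℝ)) (w : Fin k → ℂ)
    (V : Set (Fin m → ℂ)) : AnalyticOnNhd ℂ (fun y => pullMap A y + w) V :=
  (analyticOnNhd_pullMap A V).add analyticOnNhd_const

/-- Pull-back of a simple holomorphic family along a real affine map. -/
theorem IsSimpleHolFamily.comp_slice {m : ℕ} (hU : IsOpen U) {τ : (Fin k → ℂ) → ℝ≥0 → ℂ}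
    (h : IsSimpleHolFamily U L c τ) (A : (Fin k →₀ ℝ) →ₗ[ℝ] (Fin m →₀ ℝ))
    (φ : (Fin k →₀ ℝ) →ₗ[ℝ] ℝ) {V : Set (Fin m → ℂ)} (hV : IsOpen V)
    (hVU : Set.MapsTo (fun y => pullMap A y + realPt φ) V U) :
    IsSimpleHolFamily V (A L) (φ L + c) (fun y => τ (pullMap A y + realPt φ)) := by
  obtain ⟨a, ha⟩ := h.exists_holExp hU
  refine HolExp.isSimpleHolFamily hV (a := fun j y => a j (pullMap A y + realPt φ)) ?_
  convert ha.comp (analyticOnNhd_slice A (realPt φ) V) hVU using 1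
  funext y
  simp only [affOrder, linForm_add_right, linForm_pullMap, linForm_realPt]
  push_cast
  ring

end SimpleFamilies

/-! ### Smoothing families, polynomials, and families with locally uniform expansions -/

section Uniform

variable {k : ℕ} {U : Set (Fin k → ℂ)}

/-- Holomorphic families of symbols of order `-∞`. -/
def SmoothingFam (U : Set (Fin k → ℂ)) (τ : (Fin k → ℂ) → ℝ≥0 → ℂ) : Prop :=
  ∀ M : ℝ, SymFam U (fun _ => -M) τ

theorem SmoothingFam.symFam {τ : (Fin k → ℂ) → ℝ≥0 → ℂ} (h : SmoothingFam U τ)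
    {m : (Fin k → ℂ) → ℝ} (hm : ∀ z₀ ∈ U, ContinuousAt m z₀) : SymFam U m τ where
  smooth := (h 0).smooth
  analytic := (h 0).analytic
  bound d z₀ hz₀ := by
    obtain ⟨C, hC0, hC⟩ := (h (-(m z₀ - 1))).bound d z₀ hz₀
    refine ⟨C, hC0, ?_⟩
    filter_upwards [hC, (hm z₀ hz₀).eventually_const_lt (sub_one_lt (m z₀))] with z hz hmz x
    exact (hz x).trans (mul_le_mul_of_nonneg_left (bracket_rpow_mono (by linarith) x) hC0)

theorem SmoothingFam.holExp {τ : (Fin k → ℂ) → ℝ≥0 → ℂ} (h : SmoothingFam U τ)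
    {α : (Fin k → ℂ) → ℂ} (hα : AnalyticOnNhd ℂ α U) : HolExp U α 0 τ := by
  refine ⟨fun j => analyticOnNhd_const, _, isExcision_stepExc one_pos, fun N => ?_⟩
  have : (fun z => remainder (stepExc 1) (α z) (fun j => (0 : ℕ → (Fin k → ℂ) → ℂ) j z) N (τ z)) =
      τ := by
    funext z
    simp [remainder_eq]
  rw [this]
  exact h.symFam fun z hz => ((Complex.continuous_re.continuousAt.comp
    (hα z hz).continuousAt).sub continuousAt_const)

/-- Smoothing families have any affine order, with zero coefficients. -/
theorem SmoothingFam.isSimpleHolFamily {τ : (Fin k → ℂ) → ℝ≥0 → ℂ} (h : SmoothingFam U τ)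
    (hU : IsOpen U) (L : Fin k →₀ ℝ) (c : ℝ) : IsSimpleHolFamily U L c τ :=
  (h.holExp (analyticOnNhd_affOrder L c U)).isSimpleHolFamily hU

theorem SmoothingFam.mul {τ σ : (Fin k → ℂ) → ℝ≥0 → ℂ} (hU : IsOpen U) (h : SmoothingFam U τ)
    {L : Fin k →₀ ℝ} {c : ℝ} (h' : IsSimpleHolFamily U L c σ) : SmoothingFam U (τ * σ) := by
  obtain ⟨b, hb⟩ := h'.exists_holExp hU
  have hc : Continuous fun z => (affOrder L c z).re :=
    Complex.continuous_re.comp (continuous_affOrder L c)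
  intro M
  refine ((h.symFam (m := fun z => -M - (affOrder L c z).re)
    fun z _ => (continuous_const.sub hc).continuousAt).mul hU hb.symFam).mono hU fun z _ => ?_
  linarith

theorem SmoothingFam.hasExpansion_zero {τ : (Fin k → ℂ) → ℝ≥0 → ℂ} (h : SmoothingFam U τ)
    {z : Fin k → ℂ} (hz : z ∈ U) : HasExpansion (τ z) 0 0 :=
  (h.holExp (α := fun _ => 0) analyticOnNhd_const).hasExpansion hz

/-- The power `x ^ n` with a natural exponent. -/
def npowFun (n : ℕ) : ℝ≥0 → ℂ := fun x => ((x : ℝ) : ℂ) ^ n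

theorem smoothHalf_npowFun (n : ℕ) : SmoothHalf (npowFun n) := by
  have h : ContDiff ℝ ∞ fun x : ℝ => ((x : ℂ)) ^ n := Complex.ofRealCLM.contDiff.pow n
  refine h.contDiffOn.congr fun x hx => ?_
  simp [ext, npowFun, Real.coe_toNNReal x hx]

theorem cpowFun_natCast (n : ℕ) : cpowFun (n : ℂ) = npowFun n := by
  funext x
  simp [cpowFun, npowFun]

theorem IsExcision.isSymbol_sub_mul_npowFun {χ : ℝ≥0 → ℝ} (hχ : IsExcision χ) (n : ℕ) (r : ℝ) :
    IsSymbol r ((exc χ + fun _ => -1) * npowFun n) := by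
  obtain ⟨R, hR⟩ := hχ.one_far
  exact isSymbol_of_eq_zero_far ((hχ.smoothHalf.add (smoothHalf_const _)).mul
    (smoothHalf_npowFun n)) (R := R) (fun x hx => by simp [exc, hR x hx]) r

theorem isSymbol_npowFun (n : ℕ) : IsSymbol n (npowFun n) := by
  have hχ := isExcision_stepExc one_pos
  have h1 := ((symFam_mul_cpowFun (U := (Set.univ : Set ℂ)) (α := fun _ => (n : ℂ)) hχ.isSymbol
    hχ.vanishesNearZero analyticOnNhd_const).isSymbol (Set.mem_univ 0) (r := n) (by simp)).add
    ((hχ.isSymbol_sub_mul_npowFun n n).smul (-1))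
  convert h1 using 1
  rw [cpowFun_natCast]
  funext x
  simp only [Pi.add_apply, Pi.smul_apply, Pi.mul_apply, smul_eq_mul]
  ring

theorem holExp_npowFun {h : (Fin k → ℂ) → ℂ} (hh : AnalyticOnNhd ℂ h U) (n : ℕ) :
    HolExp U (fun _ => n) (fun j z => if j = 0 then h z else 0) (fun z => h z • npowFun n) := by
  have hχ := isExcision_stepExc one_pos
  refine ⟨fun j => ?_, _, hχ, fun N => ?_⟩
  · rcases eq_or_ne j 0 with rfl | hj
    · simpa using hh
    · simpa [hj] using analyticOnNhd_const
  · rcases Nat.eq_zero_or_pos N with rfl | hN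
    · simpa [remainder_zero] using ((isSymbol_npowFun n).symFam U).smul hh
    · have h1 := (((hχ.isSymbol_sub_mul_npowFun n (n - N)).smul (-1)).symFam U).smul hh
      convert h1 using 2 with z z
      · simp
      rw [remainder_eq, Finset.sum_eq_single_of_mem 0 (Finset.mem_range.2 hN)]
      · simp only [Nat.cast_zero, sub_zero, if_true, cpowFun_natCast]
        funext x
        simp only [Pi.add_apply, Pi.smul_apply, Pi.mul_apply, smul_eq_mul]
        ring
      · intro j _ hj
        simp [hj]

theorem isSimpleHolFamily_npowFun (hU : IsOpen U) {h : (Fin k → ℂ) → ℂ}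
    (hh : AnalyticOnNhd ℂ h U) (n : ℕ) :
    IsSimpleHolFamily U 0 n (fun z => h z • npowFun n) := by
  refine HolExp.isSimpleHolFamily hU (a := fun j z => if j = 0 then h z else 0) ?_
  convert holExp_npowFun hh n using 1
  funext z
  simp [affOrder]

theorem hasExpansion_npowFun (c : ℂ) (n : ℕ) :
    HasExpansion (c • npowFun n) n (fun j => if j = 0 then c else 0) :=
  (holExp_npowFun (U := (Set.univ : Set (Fin 0 → ℂ))) (h := fun _ => c) analyticOnNhd_const
    n).hasExpansion (z := 0) trivial

/-- `B β z` is the coefficient of `x ^ β` in the expansion of `h z` at infinity, the coefficients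
and the remainders being holomorphic in `z`, and the exponents not depending on `z`. -/
def UnifExp (U : Set (Fin k → ℂ)) (h : (Fin k → ℂ) → ℝ≥0 → ℂ) (B : ℂ → (Fin k → ℂ) → ℂ) : Prop :=
  (∀ β, AnalyticOnNhd ℂ (B β) U) ∧ ∀ M : ℝ, ∃ F : Finset ℂ,
    (∀ β ∉ F, -M ≤ β.re → ∀ z ∈ U, B β z = 0) ∧
    SymFam U (fun _ => -M) (fun z => h z + ∑ β ∈ F, (-B β z) • (exc (stepExc 1) * cpowFun β))

variable {h h' : (Fin k → ℂ) → ℝ≥0 → ℂ} {B B' : ℂ → (Fin k → ℂ) → ℂ}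

theorem symFam_exc_mul_cpowFun (U : Set (Fin k → ℂ)) (β : ℂ) :
    SymFam U (fun _ => β.re) (fun _ => exc (stepExc 1) * cpowFun β) := by
  have hχ := isExcision_stepExc one_pos
  simpa using symFam_mul_cpowFun (U := U) (α := fun _ => β) hχ.isSymbol hχ.vanishesNearZero
    analyticOnNhd_const

theorem symFam_add_sum_of_subset (hU : IsOpen U) (hB : ∀ β, AnalyticOnNhd ℂ (B β) U) {M : ℝ}
    {F G : Finset ℂ} (hFG : F ⊆ G) (hF : ∀ β ∉ F, -M ≤ β.re → ∀ z ∈ U, B β z = 0)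
    (hS : SymFam U (fun _ => -M)
      (fun z => h z + ∑ β ∈ F, (-B β z) • (exc (stepExc 1) * cpowFun β))) :
    SymFam U (fun _ => -M)
      (fun z => h z + ∑ β ∈ G, (-B β z) • (exc (stepExc 1) * cpowFun β)) := by
  classical
  have h1 : SymFam U (fun _ => -M)
      (fun z => ∑ β ∈ G \ F, (-B β z) • (exc (stepExc 1) * cpowFun β)) := by
    refine SymFam.sum hU _ fun β hβ => ?_
    by_cases hM : -M ≤ β.re
    · refine (symFam_zero U _).congr hU fun z hz => ?_
      simp [hF β (Finset.mem_sdiff.1 hβ).2 hM z hz]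
    · exact ((symFam_exc_mul_cpowFun U β).mono hU fun _ _ => (not_le.1 hM).le).smul (hB β).neg
  refine (SymFam.add hU hS h1).congr hU fun z _ => ?_
  simp only [Pi.add_apply]
  rw [← Finset.sum_sdiff hFG, add_assoc, add_comm (∑ β ∈ F, _)]

theorem UnifExp.add (hU : IsOpen U) (hB : UnifExp U h B) (hB' : UnifExp U h' B') :
    UnifExp U (h + h') (B + B') := by
  classical
  refine ⟨fun β => (hB.1 β).add (hB'.1 β), fun M => ?_⟩
  obtain ⟨F, hF, hS⟩ := hB.2 M
  obtain ⟨F', hF', hS'⟩ := hB'.2 M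
  refine ⟨F ∪ F', fun β hβ hM z hz => ?_, ?_⟩
  · rw [Finset.mem_union, not_or] at hβ
    simp [hF β hβ.1 hM z hz, hF' β hβ.2 hM z hz]
  · have h1 := symFam_add_sum_of_subset hU hB.1 (Finset.subset_union_left (s₂ := F')) hF hS
    have h2 := symFam_add_sum_of_subset hU hB'.1 (Finset.subset_union_right (s₁ := F)) hF' hS'
    refine (SymFam.add hU h1 h2).congr hU fun z _ => ?_
    simp only [Pi.add_apply, neg_add, add_smul, Finset.sum_add_distrib]
    abel

theorem UnifExp.smul (hB : UnifExp U h B) {g : (Fin k → ℂ) → ℂ} (hg : AnalyticOnNhd ℂ g U) :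
    UnifExp U (fun z => g z • h z) (fun β z => g z * B β z) := by
  refine ⟨fun β => hg.mul (hB.1 β), fun M => ?_⟩
  obtain ⟨F, hF, hS⟩ := hB.2 M
  refine ⟨F, fun β hβ hM z hz => by simp [hF β hβ hM z hz], ?_⟩
  convert hS.smul hg using 2 with z
  simp only [smul_add, Finset.smul_sum, smul_smul, mul_neg]

theorem unifExp_zero (U : Set (Fin k → ℂ)) : UnifExp U 0 0 :=
  ⟨fun _ => analyticOnNhd_const, fun M => ⟨∅, by simp, by simpa using! symFam_zero U _⟩⟩

theorem UnifExp.mono_set {V : Set (Fin k → ℂ)} (hB : UnifExp U h B) (hV : V ⊆ U) :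
    UnifExp V h B := by
  refine ⟨fun β => (hB.1 β).mono hV, fun M => ?_⟩
  obtain ⟨F, hF, hS⟩ := hB.2 M
  exact ⟨F, fun β hβ hM z hz => hF β hβ hM z (hV hz), hS.mono_set hV⟩

theorem UnifExp.hasCoefs (hB : UnifExp U h B) {z : Fin k → ℂ} (hz : z ∈ U) :
    HasCoefs (h z) (fun β => B β z) := by
  intro M
  obtain ⟨F, hF, hS⟩ := hB.2 M
  refine ⟨F, fun β hβ hM => hF β hβ hM z hz, ?_⟩
  refine (hS.isSymbol hz le_rfl).isBigO.congr' ?_ EventuallyEq.rfl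
  filter_upwards [eventually_ge_atTop 2] with x hx
  have h1 : stepExc 1 x = 1 := stepExc_eq_one one_pos (by simpa using hx)
  simp [exc, cpowFun, h1, Finset.sum_apply, sub_eq_add_neg]

theorem HolExp.unifExp {c : ℝ} {a : ℕ → (Fin k → ℂ) → ℂ} {τ : (Fin k → ℂ) → ℝ≥0 → ℂ}
    (hU : IsOpen U) (hτ : HolExp U (fun _ => (c : ℂ)) a τ) :
    UnifExp U τ (fun β z => coefAt c (fun j => a j z) β) := by
  classical
  refine ⟨fun β => ?_, fun M => ?_⟩
  · by_cases hβ : ∃ j : ℕ, (c : ℂ) - j = β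
    · obtain ⟨j, rfl⟩ := hβ
      simpa [coefAt_sub_natCast] using hτ.1 j
    · push Not at hβ
      simpa [coefAt_eq_zero hβ] using analyticOnNhd_const
  · obtain ⟨N, hN⟩ := exists_nat_gt (c + M)
    refine ⟨(Finset.range N).image fun j : ℕ => (c : ℂ) - j, fun β hβ hM z _ => ?_, ?_⟩
    · refine coefAt_eq_zero ?_
      rintro j rfl
      refine hβ (Finset.mem_image_of_mem _ (Finset.mem_range.2 ?_))
      have : (j : ℝ) < N := by
        simp only [Complex.sub_re, Complex.natCast_re, Complex.ofReal_re] at hM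
        linarith
      exact_mod_cast this
    · refine ((hτ.remainder_symFam hU analyticOnNhd_const (isExcision_stepExc one_pos) N).mono hU
        (m' := fun _ => -M) fun z _ => ?_).congr hU fun z _ => ?_
      · simp only [Complex.ofReal_re]
        linarith
      · rw [Finset.sum_image (fun i _ j _ hij => by simpa using hij), remainder_eq]
        simp only [coefAt_sub_natCast]

/-- A family whose expansion only contains natural powers of `x` is, up to a smoothing family, a
polynomial in `x` with holomorphic coefficients. -/
theorem UnifExp.exists_smoothing (hU : IsOpen U) (hB : UnifExp U h B)
    (hnat : ∀ β : ℂ, (∀ n : ℕ, β ≠ n) → ∀ z ∈ U, B β z = 0) :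
    ∃ s : Finset ℕ, SmoothingFam U (fun z => h z + ∑ n ∈ s, (-B n z) • npowFun n) := by
  classical
  obtain ⟨F₀, hF₀, -⟩ := hB.2 0
  set s : Finset ℕ := F₀.preimage (Nat.cast : ℕ → ℂ) Nat.cast_injective.injOn with hs
  refine ⟨s, fun M => ?_⟩
  obtain ⟨F, hF, hS⟩ := hB.2 (max M 0)
  have hχ := isExcision_stepExc one_pos
  have hbase : SymFam U (fun _ => -M) (fun z => h z + ∑ β ∈ F ∪ s.image (Nat.cast : ℕ → ℂ),
      (-B β z) • (exc (stepExc 1) * cpowFun β)) :=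
    (symFam_add_sum_of_subset hU hB.1 Finset.subset_union_left hF hS).mono hU fun _ _ =>
      neg_le_neg (le_max_left _ _)
  have hcorr : SymFam U (fun _ => -M) (fun z => ∑ n ∈ s,
      B n z • ((exc (stepExc 1) + fun _ => -1) * npowFun n)) :=
    SymFam.sum hU _ fun n _ => ((hχ.isSymbol_sub_mul_npowFun n (-M)).symFam U).smul (hB.1 n)
  refine (SymFam.add hU hbase hcorr).congr hU fun z hz => ?_
  have hsum : ∑ β ∈ F ∪ s.image (Nat.cast : ℕ → ℂ), (-B β z) • (exc (stepExc 1) * cpowFun β) =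
      ∑ n ∈ s, (-B n z) • (exc (stepExc 1) * npowFun n) := by
    rw [← Finset.sum_subset Finset.subset_union_right,
      Finset.sum_image (fun i _ j _ hij => by simpa using hij)]
    · simp only [cpowFun_natCast]
    · intro β _ hβ
      suffices B β z = 0 by simp [this]
      by_cases hn : ∃ n : ℕ, β = n
      · obtain ⟨n, rfl⟩ := hn
        refine hF₀ _ (fun hmem => hβ (Finset.mem_image_of_mem _ ?_)) (by simp) z hz
        simpa [hs] using hmem
      · push Not at hn
        exact hnat β hn z hz
  simp only [Pi.add_apply, hsum, add_assoc, ← Finset.sum_add_distrib]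
  congr 1
  refine Finset.sum_congr rfl fun n _ => ?_
  funext x
  simp only [Pi.add_apply, Pi.smul_apply, Pi.mul_apply, smul_eq_mul]
  ring

end Uniform

/-! ### Pull-back of germs -/

section PullBack

variable {ι κ μ : Type} {β : Type} [AddCommGroup β] [Module ℂ β]

instance polarNhds_neBot : NeBot (polarNhds ι) := by
  refine neBot_iff.2 fun h => ?_
  have hmem : (∅ : Set (ι → ℂ)) ∈ polarNhds ι := by rw [h]; trivial
  obtain ⟨V, hV, F, hF, hS⟩ := mem_polarNhds_iff.1 hmem
  obtain ⟨z, hz, hzF⟩ := (dense_generic F hF).inter_nhds_nonempty hV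
  exact hS z hzF hz

/-- Functions which vanish at generic points near zero and are continuous there vanish near zero. -/
theorem exists_open_forall_eq_zero {T : Type} {U : Set (ι → ℂ)} (hU : IsOpen U) (h0 : 0 ∈ U)
    {f : T → (ι → ℂ) → ℂ} (hf : ∀ t, ContinuousOn (f t) U)
    (h : ∀ᶠ z in polarNhds ι, ∀ t, f t z = 0) :
    ∃ V ⊆ U, IsOpen V ∧ 0 ∈ V ∧ ∀ t, ∀ z ∈ V, f t z = 0 := by
  obtain ⟨V, hV, F, hF, hS⟩ := mem_polarNhds_iff.1 h
  refine ⟨U ∩ interior V, Set.inter_subset_left, hU.inter isOpen_interior,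
    ⟨h0, mem_interior_iff_mem_nhds.2 hV⟩, fun t z hz => ?_⟩
  by_contra hne
  have hcont : ContinuousAt (f t) z := (hf t).continuousAt (hU.mem_nhds hz.1)
  have hnhds : ∀ᶠ y in 𝓝 z, f t y ≠ 0 ∧ y ∈ V :=
    (hcont.eventually_ne hne).and (mem_interior_iff_mem_nhds.1 hz.2)
  obtain ⟨y, hyF, hy⟩ := (dense_generic F hF).inter_nhds_nonempty hnhds
  exact hy.1 (hS y hy.2 hyF t)

/-- Composition of germs with the map dual to an injective map of spaces of linear forms. -/
noncomputable def pullGerm (A : (ι →₀ ℝ) →ₗ[ℝ] (κ →₀ ℝ)) (hA : Function.Injective A) :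
    Germ (polarNhds ι) β →ₗ[ℂ] Germ (polarNhds κ) β where
  toFun g := g.compTendsto (pullMap A) (tendsto_pullMap hA)
  map_add' f g := Germ.inductionOn₂ f g fun _ _ => rfl
  map_smul' _ g := Germ.inductionOn g fun _ => rfl

theorem pullGerm_coe (A : (ι →₀ ℝ) →ₗ[ℝ] (κ →₀ ℝ)) (hA : Function.Injective A)
    (f : (ι → ℂ) → β) :
    pullGerm A hA (f : Germ (polarNhds ι) β) =
      ((fun z => f (pullMap A z) : (κ → ℂ) → β) : Germ (polarNhds κ) β) := rfl

theorem pullGerm_pullGerm (A : (ι →₀ ℝ) →ₗ[ℝ] (κ →₀ ℝ)) (hA : Function.Injective A)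
    (B : (κ →₀ ℝ) →ₗ[ℝ] (μ →₀ ℝ)) (hB : Function.Injective B) (g : Germ (polarNhds ι) β) :
    pullGerm B hB (pullGerm A hA g) = pullGerm (B ∘ₗ A) (hB.comp hA) g := by
  induction g using Germ.inductionOn with
  | h f => simp only [pullGerm_coe, pullMap_pullMap]

theorem pullGerm_mul {R : Type} [Ring R] [Module ℂ R] (A : (ι →₀ ℝ) →ₗ[ℝ] (κ →₀ ℝ))
    (hA : Function.Injective A) (f g : Germ (polarNhds ι) R) :
    pullGerm A hA (f * g) = pullGerm A hA f * pullGerm A hA g :=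
  Germ.inductionOn₂ f g fun _ _ => rfl

theorem germ_eq_of_eventually {γ : Type} {f g : (ι → ℂ) → γ}
    (h : ∀ᶠ z in polarNhds ι, f z = g z) : (f : Germ (polarNhds ι) γ) = g := Germ.coe_eq.2 h

theorem mem_limitGerms_iff {S : ∀ k : ℕ, Set (Germ (polarNhds (Fin k)) β)}
    {g : Germ (polarNhds ℕ) β} :
    g ∈ limitGerms S ↔ ∃ k, ∃ τ ∈ S k, g = pullGerm (inclForms k) (inclForms_injective k) τ := by
  constructor
  · rintro ⟨k, τ, hτ, rfl⟩
    exact ⟨k, τ, hτ, by rw [pullGerm_coe, restr_eq_pullMap]⟩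
  · rintro ⟨k, τ, hτ, rfl⟩
    induction τ using Germ.inductionOn with
    | h τ => exact ⟨k, τ, hτ, by rw [pullGerm_coe, restr_eq_pullMap]⟩

theorem dependsOn_iff {S : ∀ k : ℕ, Submodule ℂ (Germ (polarNhds (Fin k)) β)}
    {g : Germ (polarNhds ℕ) β} {W : Submodule ℝ (ℕ →₀ ℝ)} :
    DependsOn S g W ↔ ∃ (m : ℕ) (A : (Fin m →₀ ℝ) →ₗ[ℝ] (ℕ →₀ ℝ)) (hA : Function.Injective A),
      LinearMap.range A = W ∧ ∃ τ ∈ S m, g = pullGerm A hA τ := by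
  constructor
  · rintro ⟨m, L, τ, hL, hW, hτ, rfl⟩
    have hinj : Function.Injective (Finsupp.linearCombination ℝ L) := hL
    refine ⟨m, Finsupp.linearCombination ℝ L, hinj, ?_, τ, hτ, ?_⟩
    · rw [Finsupp.range_linearCombination, hW]
    · rw [pullGerm_coe, formMap_eq_pullMap]
  · rintro ⟨m, A, hA, hW, τ, hτ, rfl⟩
    induction τ using Germ.inductionOn with
    | h τ =>
      have hlc : Finsupp.linearCombination ℝ (fun j => A (Finsupp.single j 1)) = A := by
        ext j : 2
        simp
      refine ⟨m, fun j => A (Finsupp.single j 1), τ, ?_, ?_, hτ, ?_⟩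
      · rw [LinearIndependent, hlc]
        exact hA
      · rw [← Finsupp.range_linearCombination, hlc, hW]
      · rw [pullGerm_coe, formMap_eq_pullMap, hlc]

end PullBack

/-! ### Slices of simple meromorphic germs -/

section Slices

theorem realPt_zero {ι : Type} : realPt (0 : (ι →₀ ℝ) →ₗ[ℝ] ℝ) = 0 := by
  funext i
  simp [realPt]

theorem IsSimpleMeroGerm.pullGerm {k m : ℕ} {L : Fin k →₀ ℝ} {c : ℝ} {g : SymbGerm (Fin k)}
    (h : IsSimpleMeroGerm L c g) (A : (Fin k →₀ ℝ) →ₗ[ℝ] (Fin m →₀ ℝ))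
    (hA : Function.Injective A) : IsSimpleMeroGerm (A L) c (pullGerm A hA g) := by
  obtain ⟨U, τ, P, hU, h0, hτ, hP, rfl⟩ := h
  refine ⟨pullMap A ⁻¹' U, fun y => τ (pullMap A y), P.map A,
    hU.preimage (continuous_pullMap A), by simpa using h0, ?_, ?_, ?_⟩
  · have := hτ.comp_slice hU A 0 (hU.preimage (continuous_pullMap A))
      (fun y hy => by simpa [realPt_zero] using hy)
    simpa [realPt_zero] using this
  · simp only [List.mem_map, forall_exists_index, and_imp, forall_apply_eq_imp_iff₂]
    exact fun p hp h0 => hP p hp (hA (by simpa using h0))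
  · simp only [pullGerm_coe, polarProd_pullMap]

theorem pullGerm_mem_meroSymb {k m : ℕ} (A : (Fin k →₀ ℝ) →ₗ[ℝ] (Fin m →₀ ℝ))
    (hA : Function.Injective A) {g : SymbGerm (Fin k)} (hg : g ∈ meroSymb k) :
    pullGerm A hA g ∈ meroSymb m := by
  have : meroSymb k ≤ (meroSymb m).comap (pullGerm A hA) :=
    Submodule.span_le.2 fun g ⟨L, c, h⟩ => Submodule.subset_span ⟨A L, c, h.pullGerm A hA⟩
  exact this hg

theorem pullGerm_mem_meroFun {k m : ℕ} (A : (Fin k →₀ ℝ) →ₗ[ℝ] (Fin m →₀ ℝ))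
    (hA : Function.Injective A) {g : FunGerm (Fin k)} (hg : g ∈ meroFun k) :
    pullGerm A hA g ∈ meroFun m := by
  have : meroFun k ≤ (meroFun m).comap (pullGerm A hA) := by
    refine Submodule.span_le.2 ?_
    rintro _ ⟨h, P, hh, hP, rfl⟩
    refine Submodule.subset_span ⟨fun y => h (pullMap A y), P.map A, ?_, ?_, ?_⟩
    · refine AnalyticAt.fun_comp (by simpa using hh) (analyticOnNhd_pullMap A Set.univ 0 trivial)
    · simp only [List.mem_map, forall_exists_index, and_imp, forall_apply_eq_imp_iff₂]
      exact fun p hp h0 => hP p hp (hA (by simpa using h0))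
    · simp only [pullGerm_coe, polarProd_pullMap]
  exact this hg

/-- On a generic real slice, some of the polar forms remain linear forms, and the others are
holomorphic and do not vanish near zero. -/
theorem exists_polarProd_slice {k m : ℕ} (A : (Fin k →₀ ℝ) →ₗ[ℝ] (Fin m →₀ ℝ))
    (φ : (Fin k →₀ ℝ) →ₗ[ℝ] ℝ) (P : List (Fin k →₀ ℝ)) (hP : ∀ p ∈ P, A p ≠ 0 ∨ φ p ≠ 0) :
    ∃ (P' : List (Fin m →₀ ℝ)) (g : (Fin m → ℂ) → ℂ), (∀ p ∈ P', p ≠ 0) ∧ AnalyticAt ℂ g 0 ∧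
      ∀ y, (polarProd P (pullMap A y + realPt φ))⁻¹ = (polarProd P' y)⁻¹ * g y := by
  induction P with
  | nil => exact ⟨[], fun _ => 1, by simp, analyticAt_const, by simp [polarProd]⟩
  | cons p P ih =>
    rw [List.forall_mem_cons] at hP
    obtain ⟨P', g, hP', hg, h⟩ := ih hP.2
    have hcons : ∀ y, (polarProd (p :: P) (pullMap A y + realPt φ))⁻¹ =
        (linForm (A p) y + (φ p : ℂ))⁻¹ * ((polarProd P' y)⁻¹ * g y) := fun y => by
      rw [← h y]
      simp only [polarProd, List.map_cons, List.prod_cons, mul_inv]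
      rw [linForm_add_right, linForm_pullMap, linForm_realPt]
    by_cases h0 : φ p = 0
    · refine ⟨A p :: P', g, ?_, hg, fun y => ?_⟩
      · rw [List.forall_mem_cons]
        exact ⟨hP.1.resolve_right (not_not.2 h0), hP'⟩
      · rw [hcons, h0]
        simp only [polarProd, List.map_cons, List.prod_cons, mul_inv, Complex.ofReal_zero, add_zero]
        ring
    · refine ⟨P', fun y => (linForm (A p) y + (φ p : ℂ))⁻¹ * g y, hP', ?_, fun y => ?_⟩
      · refine AnalyticAt.mul (AnalyticAt.inv ?_ ?_) hg
        · exact (analyticOnNhd_linForm _ Set.univ 0 trivial).add analyticAt_const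
        · simpa using h0
      · rw [hcons]
        ring

/-- A germ in `𝓜𝓢(ℂᵏ)` has a representative all of whose real affine slices near zero which are
not contained in one of finitely many hyperplanes again define germs in `𝓜𝓢`. -/
theorem exists_sliceable {k : ℕ} {g : SymbGerm (Fin k)} (hg : g ∈ meroSymb k) :
    ∃ T : (Fin k → ℂ) → ℝ≥0 → ℂ, g = (T : SymbGerm (Fin k)) ∧ ∃ V ∈ 𝓝 (0 : Fin k → ℂ),
      ∃ P : List (Fin k →₀ ℝ), (∀ p ∈ P, p ≠ 0) ∧
        ∀ (m : ℕ) (A : (Fin k →₀ ℝ) →ₗ[ℝ] (Fin m →₀ ℝ)) (φ : (Fin k →₀ ℝ) →ₗ[ℝ] ℝ),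
          realPt φ ∈ V → (∀ p ∈ P, A p ≠ 0 ∨ φ p ≠ 0) →
          ((fun y => T (pullMap A y + realPt φ) : (Fin m → ℂ) → ℝ≥0 → ℂ) : SymbGerm (Fin m)) ∈
            meroSymb m := by
  induction hg using Submodule.span_induction with
  | mem g hg =>
    obtain ⟨L, c, U, τ, P, hU, h0, hτ, hP, rfl⟩ := hg
    refine ⟨_, rfl, U, hU.mem_nhds h0, P, hP, fun m A φ hφ hAφ => ?_⟩
    obtain ⟨P', h, hP', hh, hprod⟩ := exists_polarProd_slice A φ P hAφ
    obtain ⟨V, hV, hV0, hVh⟩ : ∃ V : Set (Fin m → ℂ), IsOpen V ∧ 0 ∈ V ∧ AnalyticOnNhd ℂ h V := by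
      obtain ⟨V, hVh, hV, hV0⟩ := eventually_nhds_iff.1 hh.eventually_analyticAt
      exact ⟨V, hV, hV0, hVh⟩
    have hcont : Continuous fun y => pullMap A y + realPt φ := by fun_prop
    set V' := V ∩ (fun y => pullMap A y + realPt φ) ⁻¹' U with hV'
    have hV'o : IsOpen V' := hV.inter (hU.preimage hcont)
    refine Submodule.subset_span ⟨A L, φ L + c, V',
      fun y => h y • τ (pullMap A y + realPt φ), P', hV'o, ⟨hV0, by simpa using hφ⟩, ?_, hP', ?_⟩
    · exact (hτ.comp_slice hU A φ hV'o fun y hy => hy.2).smul hV'o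
        (hVh.mono Set.inter_subset_left)
    · simp only [hprod, smul_smul]
  | zero => exact ⟨0, rfl, Set.univ, univ_mem, [], by simp, fun m A φ _ _ => zero_mem (meroSymb m)⟩
  | add f g _ _ hf hg =>
    obtain ⟨T, rfl, V, hV, P, hP, h⟩ := hf
    obtain ⟨T', rfl, V', hV', P', hP', h'⟩ := hg
    refine ⟨T + T', rfl, V ∩ V', inter_mem hV hV', P ++ P', ?_, fun m A φ hφ hAφ => ?_⟩
    · simpa [or_imp, forall_and] using ⟨hP, hP'⟩
    · exact add_mem (h m A φ hφ.1 fun p hp => hAφ p (List.mem_append_left _ hp))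
        (h' m A φ hφ.2 fun p hp => hAφ p (List.mem_append_right _ hp))
  | smul c g _ hg =>
    obtain ⟨T, rfl, V, hV, P, hP, h⟩ := hg
    exact ⟨c • T, rfl, V, hV, P, hP, fun m A φ hφ hAφ =>
      Submodule.smul_mem _ c (h m A φ hφ hAφ)⟩

end Slices

/-! ### The dependence space -/

section DependenceSpace

theorem exists_leftInverse_of_disjoint {V W : Type} [AddCommGroup V] [Module ℝ V] [AddCommGroup W]
    [Module ℝ W] (A : V →ₗ[ℝ] W) (hA : Function.Injective A) (C : Submodule ℝ W)
    (hC : Disjoint (LinearMap.range A) C) :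
    ∃ B : W →ₗ[ℝ] V, B ∘ₗ A = LinearMap.id ∧ ∀ w ∈ C, B w = 0 := by
  have hinj : LinearMap.ker (C.mkQ ∘ₗ A) = ⊥ := by
    refine LinearMap.ker_eq_bot'.2 fun v hv => ?_
    have h1 : A v ∈ C := by simpa using hv
    have h2 : A v = 0 := Submodule.disjoint_def.1 hC _ ⟨v, rfl⟩ h1
    exact hA (by simpa using h2)
  obtain ⟨B, hB⟩ := (C.mkQ ∘ₗ A).exists_leftInverse_of_injective hinj
  refine ⟨B ∘ₗ C.mkQ, by rw [LinearMap.comp_assoc, hB], fun w hw => ?_⟩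
  simp [(Submodule.Quotient.mk_eq_zero C).2 hw]

theorem exists_injective_range_eq {V : Type} [AddCommGroup V] [Module ℝ V] (W : Submodule ℝ V)
    [FiniteDimensional ℝ W] : ∃ (a : ℕ) (A : (Fin a →₀ ℝ) →ₗ[ℝ] V),
      Function.Injective A ∧ LinearMap.range A = W := by
  let b := Module.finBasis ℝ W
  refine ⟨_, W.subtype ∘ₗ b.repr.symm.toLinearMap, ?_, ?_⟩
  · exact Subtype.val_injective.comp b.repr.symm.injective
  · rw [LinearMap.range_comp, LinearEquiv.range, Submodule.map_subtype_top]

/-- If a germ depends on two spaces of linear forms, then it depends on their intersection: fix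
small generic real values of the forms in a complement of the intersection in the second space. -/
theorem DependsOn.inf {g : SymbGerm ℕ} {W₁ W₂ : Submodule ℝ (ℕ →₀ ℝ)}
    (h₁ : DependsOn meroSymb g W₁) (h₂ : DependsOn meroSymb g W₂) :
    DependsOn meroSymb g (W₁ ⊓ W₂) := by
  obtain ⟨m₁, A₁, hA₁, hW₁, τ₁, hτ₁, hg₁⟩ := dependsOn_iff.1 h₁
  obtain ⟨m₂, A₂, hA₂, hW₂, τ₂, hτ₂, hg₂⟩ := dependsOn_iff.1 h₂
  obtain ⟨T₂, rfl, V, hV, P, hP, hslice⟩ := exists_sliceable hτ₂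
  induction τ₁ using Germ.inductionOn with
  | h T₁ =>
  have hfin : FiniteDimensional ℝ (W₁ ⊓ W₂ : Submodule ℝ (ℕ →₀ ℝ)) := by
    have : FiniteDimensional ℝ W₁ := hW₁ ▸ inferInstance
    exact Submodule.finiteDimensional_inf_left _ _
  obtain ⟨a, A₀, hA₀, hW₀⟩ : ∃ (a : ℕ) (A₀ : (Fin a →₀ ℝ) →ₗ[ℝ] (ℕ →₀ ℝ)),
      Function.Injective A₀ ∧ LinearMap.range A₀ = W₁ ⊓ W₂ := exists_injective_range_eq _
  -- a complement `C` of `W₁ ⊓ W₂` in `W₂`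
  obtain ⟨C', hC'⟩ := (W₁ ⊓ W₂).exists_isCompl
  set C := C' ⊓ W₂ with hC
  have hdisj₀ : Disjoint (W₁ ⊓ W₂) C := hC'.disjoint.mono_right inf_le_left
  have hdisj₁ : Disjoint W₁ C := by
    rw [disjoint_iff_inf_le]
    calc W₁ ⊓ (C' ⊓ W₂) ≤ (W₁ ⊓ W₂) ⊓ C' :=
          le_inf (le_inf inf_le_left (inf_le_right.trans inf_le_right))
            (inf_le_right.trans inf_le_left)
      _ ≤ ⊥ := hC'.disjoint.le_bot
  have hsup : W₂ ≤ (W₁ ⊓ W₂) ⊔ C := by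
    rw [hC, ← sup_inf_assoc_of_le C' (inf_le_right : W₁ ⊓ W₂ ≤ W₂), hC'.sup_eq_top, top_inf_eq]
  -- `B` and `B₀` are left inverses of `A₁` and `A₀` that kill `C`, so that `B` maps `W₂` into the
  -- image of `W₁ ⊓ W₂`: on the slice given by `B`, the forms in `W₂` are functions of those in
  -- `W₁ ⊓ W₂`, whereas those in `W₁` remain independent coordinates
  obtain ⟨B, hB, hBC⟩ := exists_leftInverse_of_disjoint A₁ hA₁ C (hW₁.symm ▸ hdisj₁)
  obtain ⟨B₀, hB₀, hB₀C⟩ := exists_leftInverse_of_disjoint A₀ hA₀ C (hW₀.symm ▸ hdisj₀)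
  set E := B ∘ₗ A₀ with hE
  set N := B₀ ∘ₗ A₂ with hN
  have hAE : A₁ ∘ₗ E = A₀ := by
    refine LinearMap.ext fun u => ?_
    obtain ⟨v, hv⟩ : A₀ u ∈ LinearMap.range A₁ := by
      rw [hW₁]
      exact (hW₀ ▸ LinearMap.mem_range_self A₀ u : A₀ u ∈ W₁ ⊓ W₂).1
    have : B (A₁ v) = v := LinearMap.congr_fun hB v
    simp [hE, ← hv, this]
  have hEinj : Function.Injective E := by
    have : Function.Injective (A₁ ∘ₗ E) := hAE ▸ hA₀
    exact Function.Injective.of_comp this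
  have hBA₂ : B ∘ₗ A₂ = E ∘ₗ N := by
    refine LinearMap.ext fun v => ?_
    obtain ⟨w, hw, x, hx, hwx⟩ := Submodule.mem_sup.1
      (hsup (hW₂ ▸ LinearMap.mem_range_self A₂ v : A₂ v ∈ W₂))
    obtain ⟨u, rfl⟩ : w ∈ LinearMap.range A₀ := hW₀ ▸ hw
    have : B₀ (A₀ u) = u := LinearMap.congr_fun hB₀ u
    simp [hE, hN, ← hwx, hBC x hx, hB₀C x hx, this]
  have hS : ∀ᶠ z in polarNhds ℕ, T₁ (pullMap A₁ z) = T₂ (pullMap A₂ z) ∧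
      ∀ p ∈ P, linForm p (pullMap A₂ z) ≠ 0 :=
    (Germ.coe_eq.1 (hg₁.symm.trans hg₂)).and
      ((tendsto_pullMap hA₂).eventually (eventually_polar_linForm_ne_zero hP))
  have hV' : pullMap A₂ ⁻¹' V ∈ 𝓝 (0 : ℕ → ℂ) :=
    (continuous_pullMap A₂).continuousAt.preimage_mem_nhds (by simpa using hV)
  -- the slice has to be translated generically, so as to avoid the polar hyperplanes
  obtain ⟨φ, hφ, hφV, hφS⟩ := exists_generic_slice B W₁ (fun v hv h0 => by
    obtain ⟨u, rfl⟩ : v ∈ LinearMap.range A₁ := hW₁.symm ▸ hv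
    have : B (A₁ u) = u := LinearMap.congr_fun hB u
    rw [← this, h0, map_zero]) hS hV'
  have hz₁ : ∀ y, pullMap A₁ (pullMap B y + realPt φ) = y := fun y => by
    have h0 : φ ∘ₗ A₁ = 0 := LinearMap.ext fun v =>
      hφ _ (hW₁ ▸ LinearMap.mem_range_self A₁ v)
    rw [pullMap_add, pullMap_pullMap, hB, pullMap_id, pullMap_realPt, h0, realPt_zero, add_zero]
  have hz₂ : ∀ y, pullMap A₂ (pullMap B y + realPt φ) =
      pullMap N (pullMap E y) + realPt (φ ∘ₗ A₂) := fun y => by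
    rw [pullMap_add, pullMap_pullMap, hBA₂, pullMap_realPt, pullMap_pullMap]
  have hmem := hslice a N (φ ∘ₗ A₂) (by rw [← pullMap_realPt]; exact hφV) fun p hp => by
    by_contra! hcon
    obtain ⟨y, -, hy⟩ := hφS.exists
    have h1 := hy p hp
    rw [hz₂, linForm_add_right, linForm_pullMap, linForm_realPt, hcon.1, hcon.2] at h1
    simp at h1
  refine dependsOn_iff.2 ⟨a, A₀, hA₀, hW₀, _, hmem, ?_⟩
  have hT₁ : (T₁ : SymbGerm (Fin m₁)) = pullGerm E hEinj
      ((fun y => T₂ (pullMap N y + realPt (φ ∘ₗ A₂)) : (Fin a → ℂ) → ℝ≥0 → ℂ) :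
        SymbGerm (Fin a)) := by
    refine germ_eq_of_eventually ?_
    filter_upwards [hφS] with y hy
    have := hy.1
    rwa [hz₁, hz₂] at this
  rw [hg₁, hT₁, pullGerm_pullGerm]
  simp only [hAE]

/-- A germ which depends on some space of linear forms depends on its dependence space: this is a
space of minimal dimension among those on which the germ depends. -/
theorem dependsOn_depSpace {g : SymbGerm ℕ} (h : ∃ W, DependsOn meroSymb g W) :
    DependsOn meroSymb g (depSpace meroSymb g) := by
  classical
  have hfin : ∀ {W}, DependsOn meroSymb g W → FiniteDimensional ℝ W := fun hW => by
    obtain ⟨m, A, -, rfl, -⟩ := dependsOn_iff.1 hW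
    infer_instance
  have hex : ∃ n : ℕ, ∃ W, DependsOn meroSymb g W ∧ Module.finrank ℝ W = n := by
    obtain ⟨W, hW⟩ := h
    exact ⟨_, W, hW, rfl⟩
  obtain ⟨W, hW, hn⟩ := Nat.find_spec hex
  have heq : depSpace meroSymb g = W := by
    refine le_antisymm (sInf_le hW) (le_sInf fun W' hW' => ?_)
    have := hfin hW
    have h1 : W ⊓ W' = W := by
      refine Submodule.eq_of_le_of_finrank_le inf_le_left ?_
      rw [hn]
      exact Nat.find_min' hex ⟨_, hW.inf hW', rfl⟩
    exact inf_eq_left.1 h1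
  rwa [heq]

end DependenceSpace

/-! ### The finite part on meromorphic germs of symbols -/

section FinitePart

variable {ι : Type}

/-- At generic points, `f` is the finite part of `g`; in particular, `g` takes values in sums of
polyhomogeneous symbols there. -/
abbrev HasFp (g : SymbGerm ι) (f : FunGerm ι) : Prop := Germ.LiftRel IsFinitePart g f

theorem hasFp_coe {τ : (ι → ℂ) → ℝ≥0 → ℂ} {f : (ι → ℂ) → ℂ} :
    HasFp (τ : SymbGerm ι) (f : FunGerm ι) ↔ ∀ᶠ z in polarNhds ι, IsFinitePart (τ z) (f z) :=
  Iff.rfl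

theorem HasFp.map_eq {g : SymbGerm ι} {f : FunGerm ι} (h : HasFp g f) :
    g.map finitePart = f := by
  induction g, f using Germ.inductionOn₂ with
  | h τ f => exact germ_eq_of_eventually ((hasFp_coe.1 h).mono fun z hz => hz.finitePart_eq)

theorem hasFp_zero : HasFp (0 : SymbGerm ι) 0 :=
  hasFp_coe.2 (Eventually.of_forall fun _ => isFinitePart_zero)

theorem HasFp.add {g g' : SymbGerm ι} {f f' : FunGerm ι} (h : HasFp g f) (h' : HasFp g' f') :
    HasFp (g + g') (f + f') := by
  induction g, f using Germ.inductionOn₂ with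
  | h τ f =>
  induction g', f' using Germ.inductionOn₂ with
  | h τ' f' =>
  exact hasFp_coe.2 (((hasFp_coe.1 h).and (hasFp_coe.1 h')).mono fun z hz => hz.1.add hz.2)

theorem HasFp.smul (c : ℂ) {g : SymbGerm ι} {f : FunGerm ι} (h : HasFp g f) :
    HasFp (c • g) (c • f) := by
  induction g, f using Germ.inductionOn₂ with
  | h τ f => exact hasFp_coe.2 ((hasFp_coe.1 h).mono fun z hz => hz.smul c)

/-- Finite parts that belong to a linear space on generators do so on their span. -/
theorem exists_hasFp_of_span {G : Set (SymbGerm ι)} {M : Submodule ℂ (FunGerm ι)}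
    (h : ∀ g ∈ G, ∃ f ∈ M, HasFp g f) {g : SymbGerm ι} (hg : g ∈ Submodule.span ℂ G) :
    ∃ f ∈ M, HasFp g f := by
  induction hg using Submodule.span_induction with
  | mem g hg => exact h g hg
  | zero => exact ⟨0, zero_mem _, hasFp_zero⟩
  | add g g' _ _ hg hg' =>
    obtain ⟨f, hf, h1⟩ := hg
    obtain ⟨f', hf', h2⟩ := hg'
    exact ⟨f + f', add_mem hf hf', h1.add h2⟩
  | smul c g _ hg =>
    obtain ⟨f, hf, h1⟩ := hg
    exact ⟨c • f, Submodule.smul_mem _ c hf, h1.smul c⟩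

theorem exists_pos_forall_int_eq_zero (r : ℝ) :
    ∃ δ : ℝ, 0 < δ ∧ ∀ n : ℤ, |r + n| < δ → r + n = 0 := by
  by_cases h : ∃ n : ℤ, r + n = 0
  · obtain ⟨n₀, hn₀⟩ := h
    refine ⟨1, one_pos, fun n hn => ?_⟩
    have h1 : |((n - n₀ : ℤ) : ℝ)| < 1 := by
      push_cast
      rwa [show (n : ℝ) - n₀ = r + n by linarith]
    have h2 : n - n₀ = 0 := Int.abs_lt_one_iff.1 (by exact_mod_cast h1)
    rw [sub_eq_zero.1 h2, hn₀]
  · push Not at h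
    -- the distance of `r` to the integers is attained at `round r`
    refine ⟨|r - round r|, abs_pos.2 fun h0 => h (-round r) (by push_cast; linarith),
      fun n hn => ?_⟩
    have := round_le r (-n)
    push_cast at this
    rw [sub_neg_eq_add] at this
    exact absurd hn (not_lt.2 this)

/-- The exponents of a simple family of nonconstant affine order generically avoid the translates
of the integers. -/
theorem eventually_affOrder_sub_ne {k : ℕ} {L : Fin k →₀ ℝ} (hL : L ≠ 0) (c r : ℝ) :
    ∀ᶠ z in polarNhds (Fin k), ∀ (j : ℕ) (n : ℤ), affOrder L c z - j ≠ ((r + n : ℝ) : ℂ) := by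
  obtain ⟨δ, hδ, h⟩ := exists_pos_forall_int_eq_zero (r - c)
  have hcont : ContinuousAt (fun z : Fin k → ℂ => ‖linForm L z‖) 0 := by fun_prop
  have hsmall : ∀ᶠ z in polarNhds (Fin k), ‖linForm L z‖ < δ :=
    polarNhds_le_nhds (hcont.eventually_lt_const (by simpa using hδ))
  filter_upwards [hsmall, eventually_linForm_ne_zero hL] with z h1 h2 j n hz
  have h3 : linForm L z = ((r - c + ((n + j : ℤ) : ℝ) : ℝ) : ℂ) := by
    rw [affOrder] at hz
    push_cast at hz ⊢
    linear_combination hz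
  have h4 := h (n + j) (by rwa [h3, Complex.norm_real, Real.norm_eq_abs] at h1)
  rw [h4, Complex.ofReal_zero] at h3
  exact h2 h3

theorem hasFp_of_ne_zero {k : ℕ} {L : Fin k →₀ ℝ} (hL : L ≠ 0) {c : ℝ} {g : SymbGerm (Fin k)}
    (hg : IsSimpleMeroGerm L c g) : HasFp g 0 := by
  obtain ⟨U, τ, P, hU, h0, ⟨a, ha, -⟩, hP, rfl⟩ := hg
  refine hasFp_coe.2 ?_
  filter_upwards [polarNhds_le_nhds (hU.mem_nhds h0), eventually_affOrder_sub_ne hL c 0] with z hz h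
  have h1 := ((ha z hz).isFinitePart).smul (polarProd P z)⁻¹
  rwa [coefAt_eq_zero fun j => by simpa using h j 0, mul_zero] at h1

theorem inv_polarProd_mul_mem_meroFun {k : ℕ} {U : Set (Fin k → ℂ)} (h0 : 0 ∈ U)
    {h : (Fin k → ℂ) → ℂ} (hh : AnalyticOnNhd ℂ h U) {P : List (Fin k →₀ ℝ)}
    (hP : ∀ p ∈ P, p ≠ 0) :
    ((fun z => (polarProd P z)⁻¹ * h z : (Fin k → ℂ) → ℂ) : FunGerm (Fin k)) ∈ meroFun k :=
  Submodule.subset_span ⟨h, P, hh 0 h0, hP, rfl⟩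

/-- The finite part of a germ in `𝓜𝓢(ℂᵏ)` is a meromorphic germ of functions. -/
theorem exists_hasFp_of_mem_meroSymb {k : ℕ} {g : SymbGerm (Fin k)} (hg : g ∈ meroSymb k) :
    ∃ f ∈ meroFun k, HasFp g f := by
  refine exists_hasFp_of_span ?_ hg
  rintro g ⟨L, c, hg⟩
  rcases eq_or_ne L 0 with rfl | hL
  swap
  · exact ⟨0, zero_mem _, hasFp_of_ne_zero hL hg⟩
  obtain ⟨U, τ, P, hU, h0, hτ, hP, rfl⟩ := hg
  obtain ⟨a, ha⟩ := hτ.exists_holExp hU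
  have hc : affOrder (0 : Fin k →₀ ℝ) c = fun _ => (c : ℂ) := by funext z; simp [affOrder]
  rw [hc] at ha
  refine ⟨_, inv_polarProd_mul_mem_meroFun h0 ((ha.unifExp hU).1 0) hP, hasFp_coe.2 ?_⟩
  filter_upwards [polarNhds_le_nhds (hU.mem_nhds h0)] with z hz
  exact ((ha.hasExpansion hz).isFinitePart).smul _

theorem HasFp.pullGerm {κ : Type} (A : (ι →₀ ℝ) →ₗ[ℝ] (κ →₀ ℝ)) (hA : Function.Injective A)
    {g : SymbGerm ι} {f : FunGerm ι} (h : HasFp g f) :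
    HasFp (pullGerm A hA g) (pullGerm A hA f) := by
  induction g, f using Germ.inductionOn₂ with
  | h τ f => exact hasFp_coe.2 ((tendsto_pullMap hA).eventually (hasFp_coe.1 h))

/-- The finite part of a germ which depends on `W` depends on `W`. -/
theorem DependsOn.map_finitePart {g : SymbGerm ℕ} {W : Submodule ℝ (ℕ →₀ ℝ)}
    (h : DependsOn meroSymb g W) : DependsOn meroFun (fpInf g) W := by
  obtain ⟨m, A, hA, hW, τ, hτ, rfl⟩ := dependsOn_iff.1 h
  obtain ⟨f, hf, hfp⟩ := exists_hasFp_of_mem_meroSymb hτ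
  exact dependsOn_iff.2 ⟨m, A, hA, hW, f, hf, (hfp.pullGerm A hA).map_eq⟩

end FinitePart

/-! ### The space `Ω` -/

section OmegaSpace

variable {ι : Type}

/-- The germ `f · x ^ n`. -/
noncomputable def mulPow (n : ℕ) : FunGerm ι →ₗ[ℂ] SymbGerm ι where
  toFun f := f.map fun c => c • npowFun n
  map_add' f g := Germ.inductionOn₂ f g fun f g =>
    congrArg _ (funext fun z => add_smul (f z) (g z) (npowFun n))
  map_smul' c f := Germ.inductionOn f fun f =>
    congrArg _ (funext fun z => smul_assoc c (f z) (npowFun n))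

theorem mulPow_coe (n : ℕ) (f : (ι → ℂ) → ℂ) :
    mulPow n (f : FunGerm ι) = ((fun z => f z • npowFun n : (ι → ℂ) → ℝ≥0 → ℂ) : SymbGerm ι) := rfl

theorem pullGerm_mulPow {κ : Type} (A : (ι →₀ ℝ) →ₗ[ℝ] (κ →₀ ℝ)) (hA : Function.Injective A)
    (n : ℕ) (f : FunGerm ι) : pullGerm A hA (mulPow n f) = mulPow n (pullGerm A hA f) :=
  Germ.inductionOn f fun _ => rfl

theorem mulPow_mem_meroSymb {k : ℕ} (n : ℕ) {f : FunGerm (Fin k)} (hf : f ∈ meroFun k) :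
    mulPow n f ∈ meroSymb k := by
  have : meroFun k ≤ (meroSymb k).comap (mulPow n) := by
    refine Submodule.span_le.2 ?_
    rintro _ ⟨h, P, hh, hP, rfl⟩
    obtain ⟨U, hUh, hU, h0⟩ := eventually_nhds_iff.1 hh.eventually_analyticAt
    refine Submodule.subset_span ⟨0, n, U, fun z => h z • npowFun n, P, hU, h0,
      isSimpleHolFamily_npowFun hU hUh n, hP, ?_⟩
    simp only [mulPow_coe, smul_smul]
  exact this hf

theorem isFinitePart_smul_npowFun (c : ℂ) (n : ℕ) :
    IsFinitePart (c • npowFun n) (if n = 0 then c else 0) := by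
  have h := (hasExpansion_npowFun c n).isFinitePart
  convert h using 1
  rw [← sub_self (n : ℂ), coefAt_sub_natCast]

theorem hasFp_mulPow (n : ℕ) (f : FunGerm ι) : HasFp (mulPow n f) (if n = 0 then f else 0) := by
  induction f using Germ.inductionOn with
  | h f =>
    have : (if n = 0 then (f : FunGerm ι) else 0) =
        ((fun z => if n = 0 then f z else 0 : (ι → ℂ) → ℂ) : FunGerm ι) := by
      split_ifs <;> rfl
    rw [this]
    exact hasFp_coe.2 (Eventually.of_forall fun z => isFinitePart_smul_npowFun (f z) n)

/-- The germs in infinitely many variables that come from the spaces `S k` of germs in finitely many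
variables, as a linear space. The sum of two such germs is again one, because `S` is stable under
the addition of variables. -/
noncomputable def liftedGerms (β : Type) [AddCommGroup β] [Module ℂ β]
    (S : ∀ k : ℕ, Submodule ℂ (Germ (polarNhds (Fin k)) β))
    (hS : ∀ (k m : ℕ) (A : (Fin k →₀ ℝ) →ₗ[ℝ] (Fin m →₀ ℝ)) (hA : Function.Injective A),
      ∀ g ∈ S k, pullGerm A hA g ∈ S m) : Submodule ℂ (Germ (polarNhds ℕ) β) where
  carrier := limitGerms fun k => (S k : Set (Germ (polarNhds (Fin k)) β))
  zero_mem' := mem_limitGerms_iff.2 ⟨0, 0, zero_mem _, (map_zero _).symm⟩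
  smul_mem' c g hg := by
    obtain ⟨k, τ, hτ, rfl⟩ := mem_limitGerms_iff.1 hg
    exact mem_limitGerms_iff.2 ⟨k, c • τ, Submodule.smul_mem _ c hτ, (map_smul _ _ _).symm⟩
  add_mem' := by
    intro f g hf hg
    obtain ⟨k, τ, hτ, rfl⟩ := mem_limitGerms_iff.1 hf
    obtain ⟨m, σ, hσ, rfl⟩ := mem_limitGerms_iff.1 hg
    have hfac : ∀ {i n : ℕ}, i ≤ n → ∃ A : (Fin i →₀ ℝ) →ₗ[ℝ] (Fin n →₀ ℝ),
        inclForms n ∘ₗ A = inclForms i := fun {i n} hin =>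
      ⟨Finsupp.linearCombination ℝ fun l => Finsupp.single (Fin.castLE hin l) 1, by
        ext l : 2
        simp [inclForms]⟩
    obtain ⟨A, hA⟩ := hfac (le_max_left k m)
    obtain ⟨B, hB⟩ := hfac (le_max_right k m)
    have hAi : Function.Injective A := by
      refine Function.Injective.of_comp (f := inclForms (max k m)) ?_
      exact (hA ▸ inclForms_injective k : Function.Injective (inclForms (max k m) ∘ₗ A))
    have hBi : Function.Injective B := by
      refine Function.Injective.of_comp (f := inclForms (max k m)) ?_
      exact (hB ▸ inclForms_injective m : Function.Injective (inclForms (max k m) ∘ₗ B))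
    refine mem_limitGerms_iff.2 ⟨max k m, pullGerm A hAi τ + pullGerm B hBi σ,
      add_mem (hS _ _ A hAi τ hτ) (hS _ _ B hBi σ hσ), ?_⟩
    rw [map_add, pullGerm_pullGerm, pullGerm_pullGerm]
    simp only [hA, hB]

theorem mem_limitGerms_of_mem_meroFunInf {f : FunGerm ℕ} (hf : f ∈ meroFunInf) :
    f ∈ limitGerms fun k => (meroFun k : Set (FunGerm (Fin k))) := by
  have : meroFunInf ≤ liftedGerms ℂ meroFun fun _ _ A hA _ => pullGerm_mem_meroFun A hA :=
    Submodule.span_le.2 fun f hf => hf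
  exact this hf

theorem exists_eq_sum_mulPow {g : SymbGerm ℕ} (hg : g ∈ polySymb) :
    ∃ f ∈ meroFunInf, ∃ p : Polynomial ℝ,
      g = ∑ n ∈ p.support, ((p.coeff n : ℝ) : ℂ) • mulPow n f := by
  obtain ⟨f, p, hf, rfl⟩ := hg
  refine ⟨f, hf, p, ?_⟩
  have h1 : ∀ s : Finset ℕ, ∑ n ∈ s, ((p.coeff n : ℝ) : ℂ) • mulPow n (f : FunGerm ℕ) =
      ((fun z => ∑ n ∈ s, ((p.coeff n : ℝ) : ℂ) • f z • npowFun n : (ℕ → ℂ) → ℝ≥0 → ℂ) :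
        SymbGerm ℕ) := by
    classical
    intro s
    induction s using Finset.induction_on with
    | empty => simp; rfl
    | insert n s hn ih =>
      rw [Finset.sum_insert hn, ih]
      simp only [Finset.sum_insert hn]
      rfl
  rw [h1]
  refine congrArg _ (funext fun z => funext fun x => ?_)
  rw [Polynomial.eval_eq_sum, Polynomial.sum, Finset.sum_apply]
  push_cast
  rw [Finset.mul_sum]
  refine Finset.sum_congr rfl fun n _ => ?_
  simp only [Pi.smul_apply, smul_eq_mul, npowFun]
  ring

theorem mulPow_mem_Omega (n : ℕ) {f : FunGerm ℕ} (hf : f ∈ meroFunInf) : mulPow n f ∈ Omega := by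
  induction f using Germ.inductionOn with
  | h f =>
    refine Submodule.subset_span (Or.inr ⟨f, Polynomial.X ^ n, hf, ?_⟩)
    rw [mulPow_coe]
    refine congrArg _ (funext fun z => funext fun x => ?_)
    simp [npowFun]

theorem pullGerm_mem_Omega_of_ne_zero {k : ℕ} {L : Fin k →₀ ℝ} (hL : L ≠ 0) {c : ℝ}
    {g : SymbGerm (Fin k)} (hg : IsSimpleMeroGerm L c g) :
    pullGerm (inclForms k) (inclForms_injective k) g ∈ Omega :=
  Submodule.subset_span (Or.inl (mem_limitGerms_iff.2
    ⟨k, g, ⟨L, c, hL, Submodule.subset_span hg⟩, rfl⟩))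

/-- A space which contains the generators of nonconstant order and the germs `f · x ^ n` contains
`Ω`. -/
theorem Omega_le {M : Submodule ℂ (SymbGerm ℕ)}
    (h₁ : ∀ (k : ℕ) (L : Fin k →₀ ℝ) (c : ℝ) (g : SymbGerm (Fin k)), L ≠ 0 →
      IsSimpleMeroGerm L c g → pullGerm (inclForms k) (inclForms_injective k) g ∈ M)
    (h₂ : ∀ (n : ℕ) (f : FunGerm ℕ), f ∈ meroFunInf → mulPow n f ∈ M) : Omega ≤ M := by
  refine Submodule.span_le.2 (Set.union_subset ?_ ?_)
  · intro g hg
    obtain ⟨k, τ, ⟨L, c, hL, hτ⟩, rfl⟩ := mem_limitGerms_iff.1 hg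
    have : meroSymbOrder k L c ≤ M.comap (pullGerm (inclForms k) (inclForms_injective k)) :=
      Submodule.span_le.2 fun g hg => h₁ k L c g hL hg
    exact this hτ
  · intro g hg
    obtain ⟨f, hf, p, rfl⟩ := exists_eq_sum_mulPow hg
    exact Submodule.sum_mem _ fun n _ => Submodule.smul_mem _ _ (h₂ n f hf)

theorem exists_dependsOn_of_mem_Omega {g : SymbGerm ℕ} (hg : g ∈ Omega) :
    ∃ W, DependsOn meroSymb g W := by
  have hle : Omega ≤
      liftedGerms (ℝ≥0 → ℂ) meroSymb fun _ _ A hA _ => pullGerm_mem_meroSymb A hA := by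
    refine Omega_le (fun k L c g _ hg => ?_) (fun n f hf => ?_)
    · exact mem_limitGerms_iff.2 ⟨k, g, Submodule.subset_span ⟨L, c, hg⟩, rfl⟩
    · obtain ⟨k, φ, hφ, rfl⟩ := mem_limitGerms_iff.1 (mem_limitGerms_of_mem_meroFunInf hf)
      exact mem_limitGerms_iff.2 ⟨k, mulPow n φ, mulPow_mem_meroSymb n hφ,
        (pullGerm_mulPow _ _ n φ).symm⟩
  obtain ⟨k, τ, hτ, rfl⟩ := mem_limitGerms_iff.1 (hle hg)
  exact ⟨_, dependsOn_iff.2 ⟨k, inclForms k, inclForms_injective k, rfl, τ, hτ, rfl⟩⟩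

theorem exists_hasFp_of_mem_Omega {g : SymbGerm ℕ} (hg : g ∈ Omega) :
    ∃ f ∈ meroFunInf, HasFp g f := by
  let M : Submodule ℂ (SymbGerm ℕ) :=
    { carrier := {g | ∃ f ∈ meroFunInf, HasFp g f}
      zero_mem' := ⟨0, zero_mem _, hasFp_zero⟩
      add_mem' := by
        rintro g g' ⟨f, hf, h⟩ ⟨f', hf', h'⟩
        exact ⟨f + f', add_mem hf hf', h.add h'⟩
      smul_mem' := by
        rintro c g ⟨f, hf, h⟩
        exact ⟨c • f, Submodule.smul_mem _ c hf, h.smul c⟩ }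
  have hle : Omega ≤ M := by
    refine Omega_le (fun k L c g hL hg => ?_) (fun n f hf => ⟨_, ?_, hasFp_mulPow n f⟩)
    · refine ⟨0, zero_mem _, ?_⟩
      simpa using (hasFp_of_ne_zero hL hg).pullGerm (inclForms k) (inclForms_injective k)
    · split_ifs
      exacts [hf, zero_mem _]
  exact hle hg

theorem one_mem_meroFunInf : (1 : FunGerm ℕ) ∈ meroFunInf := by
  refine Submodule.subset_span (mem_limitGerms_iff.2 ⟨0, ((fun _ => 1 : (Fin 0 → ℂ) → ℂ) :
    FunGerm (Fin 0)), Submodule.subset_span ⟨fun _ => 1, [], analyticAt_const, by simp, ?_⟩, rfl⟩)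
  simp [polarProd]

theorem mulPow_zero_one : mulPow 0 (1 : FunGerm ℕ) = 1 := by
  refine congrArg _ (funext fun z => funext fun x => ?_)
  simp [npowFun]

end OmegaSpace

/-! ### Separation of the constant orders -/

section ConstantOrders

variable {ι : Type}

/-- `κ` vanishes at the exponents in `r + ℤ` which are not natural numbers. -/
def NatOn (r : ℝ) (κ : ℂ → ℂ) : Prop :=
  ∀ n : ℤ, (∀ m : ℕ, ((r + n : ℝ) : ℂ) ≠ m) → κ ((r + n : ℝ) : ℂ) = 0

/-- The germs of families of functions whose asymptotic expansions at generic points contain no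
powers `x ^ s` with `s ∈ r + ℤ`, except natural ones. -/
noncomputable def natGerms (ι : Type) (r : ℝ) : Submodule ℂ (SymbGerm ι) where
  carrier := {g | g.LiftPred fun σ => ∃ κ, HasCoefs σ κ ∧ NatOn r κ}
  zero_mem' := by
    have h : ∀ᶠ _ in polarNhds ι, ∃ κ, HasCoefs (0 : ℝ≥0 → ℂ) κ ∧ NatOn r κ :=
      Eventually.of_forall fun _ => ⟨0, hasCoefs_zero, fun _ _ => rfl⟩
    exact h
  add_mem' := by
    intro f g
    induction f, g using Germ.inductionOn₂ with
    | h f g =>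
      intro (hf : ∀ᶠ z in polarNhds ι, ∃ κ, HasCoefs (f z) κ ∧ NatOn r κ)
        (hg : ∀ᶠ z in polarNhds ι, ∃ κ, HasCoefs (g z) κ ∧ NatOn r κ)
      change ∀ᶠ z in polarNhds ι, ∃ κ, HasCoefs (f z + g z) κ ∧ NatOn r κ
      filter_upwards [hf, hg]
      rintro z ⟨κ, hκ, h⟩ ⟨κ', hκ', h'⟩
      exact ⟨κ + κ', hκ.add hκ', fun n hn => by
        rw [Pi.add_apply, h n hn, h' n hn, add_zero]⟩
  smul_mem' := by
    intro c g
    induction g using Germ.inductionOn with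
    | h g =>
      intro (hg : ∀ᶠ z in polarNhds ι, ∃ κ, HasCoefs (g z) κ ∧ NatOn r κ)
      change ∀ᶠ z in polarNhds ι, ∃ κ, HasCoefs (c • g z) κ ∧ NatOn r κ
      filter_upwards [hg]
      rintro z ⟨κ, hκ, h⟩
      exact ⟨c • κ, hκ.smul c, fun n hn => by
        rw [Pi.smul_apply, h n hn, smul_zero]⟩

theorem mem_natGerms_coe {r : ℝ} {τ : (ι → ℂ) → ℝ≥0 → ℂ} :
    (τ : SymbGerm ι) ∈ natGerms ι r ↔
      ∀ᶠ z in polarNhds ι, ∃ κ, HasCoefs (τ z) κ ∧ NatOn r κ := Iff.rfl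

theorem pullGerm_mem_natGerms_iff {κ : Type} (A : (ι →₀ ℝ) →ₗ[ℝ] (κ →₀ ℝ))
    (hA : Function.Injective A) {r : ℝ} {g : SymbGerm ι} :
    pullGerm A hA g ∈ natGerms κ r ↔ g ∈ natGerms ι r := by
  induction g using Germ.inductionOn with
  | h g =>
    rw [pullGerm_coe, mem_natGerms_coe, mem_natGerms_coe]
    exact ⟨fun h => eventually_of_eventually_pullMap hA h,
      fun h => (tendsto_pullMap hA).eventually h⟩

theorem mem_natGerms_of_ne_zero {k : ℕ} {L : Fin k →₀ ℝ} (hL : L ≠ 0) {c : ℝ}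
    {g : SymbGerm (Fin k)} (hg : IsSimpleMeroGerm L c g) (r : ℝ) : g ∈ natGerms (Fin k) r := by
  obtain ⟨U, τ, P, hU, h0, ⟨a, ha, -⟩, hP, rfl⟩ := hg
  refine mem_natGerms_coe.2 ?_
  filter_upwards [polarNhds_le_nhds (hU.mem_nhds h0), eventually_affOrder_sub_ne hL c r] with z hz h
  refine ⟨_, ((ha z hz).hasCoefs).smul (polarProd P z)⁻¹, fun n _ => ?_⟩
  rw [Pi.smul_apply, coefAt_eq_zero fun j => h j n, smul_zero]

theorem mulPow_mem_natGerms (n : ℕ) (f : FunGerm ι) (r : ℝ) : mulPow n f ∈ natGerms ι r := by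
  induction f using Germ.inductionOn with
  | h f =>
    refine mem_natGerms_coe.2 (Eventually.of_forall fun z =>
      ⟨_, (hasExpansion_npowFun (f z) n).hasCoefs, fun i hi => ?_⟩)
    refine (finsum_congr fun j => ?_).trans finsum_zero
    rcases eq_or_ne j 0 with rfl | hj
    · rw [if_neg]
      simpa using (hi n).symm
    · simp [hj]

theorem Omega_le_natGerms (r : ℝ) : Omega ≤ natGerms ℕ r :=
  Omega_le (fun k _ _ _ hL hg => (pullGerm_mem_natGerms_iff (inclForms k)
    (inclForms_injective k)).2 (mem_natGerms_of_ne_zero hL hg r))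
    (fun n f _ => mulPow_mem_natGerms n f r)

/-- The germs `h / (ℓ₁ ⋯ ℓₙ)` where `h` has a locally uniform expansion with constant exponents, in
finitely many classes modulo `ℤ`. -/
noncomputable def constGerms (k : ℕ) : Submodule ℂ (SymbGerm (Fin k)) where
  carrier := {g | ∃ (U : Set (Fin k → ℂ)) (h : (Fin k → ℂ) → ℝ≥0 → ℂ) (B : ℂ → (Fin k → ℂ) → ℂ)
    (P : List (Fin k →₀ ℝ)) (C : Finset ℝ), IsOpen U ∧ 0 ∈ U ∧ UnifExp U h B ∧
      (∀ p ∈ P, p ≠ 0) ∧ (∀ β : ℂ, (∀ c ∈ C, ∀ n : ℤ, β ≠ ((c + n : ℝ) : ℂ)) → B β = 0) ∧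
      g = ((fun z => (polarProd P z)⁻¹ • h z : (Fin k → ℂ) → ℝ≥0 → ℂ) : SymbGerm (Fin k))}
  zero_mem' := ⟨Set.univ, 0, 0, [], ∅, isOpen_univ, trivial, unifExp_zero _, by simp, by simp,
    germ_eq_of_eventually (Eventually.of_forall fun z => by simp)⟩
  add_mem' := by
    classical
    rintro _ _ ⟨U, h, B, P, C, hU, h0, hB, hP, hC, rfl⟩ ⟨U', h', B', P', C', hU', h0', hB', hP',
      hC', rfl⟩
    have hUU := hU.inter hU'
    refine ⟨U ∩ U', (fun z => polarProd P' z • h z) + fun z => polarProd P z • h' z,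
      (fun β z => polarProd P' z * B β z) + fun β z => polarProd P z * B' β z, P ++ P', C ∪ C',
      hUU, ⟨h0, h0'⟩, ?_, ?_, fun β hβ => ?_, germ_eq_of_eventually ?_⟩
    · exact ((hB.mono_set Set.inter_subset_left).smul (analyticOnNhd_polarProd P' _)).add hUU
        ((hB'.mono_set Set.inter_subset_right).smul (analyticOnNhd_polarProd P _))
    · simpa [or_imp, forall_and] using ⟨hP, hP'⟩
    · funext z
      simp [hC β fun c hc => hβ c (Finset.mem_union_left _ hc),
        hC' β fun c hc => hβ c (Finset.mem_union_right _ hc)]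
    · filter_upwards [eventually_polar_linForm_ne_zero hP, eventually_polar_linForm_ne_zero hP']
        with z hz hz'
      have h1 := polarProd_ne_zero hz
      have h2 := polarProd_ne_zero hz'
      simp only [polarProd_append, Pi.add_apply, smul_add, smul_smul]
      congr 2 <;> field_simp
  smul_mem' := by
    rintro c _ ⟨U, h, B, P, C, hU, h0, hB, hP, hC, rfl⟩
    refine ⟨U, fun z => c • h z, fun β z => c * B β z, P, C, hU, h0,
      hB.smul analyticOnNhd_const, hP, fun β hβ => ?_, ?_⟩
    · funext z
      simp [hC β hβ]
    · refine germ_eq_of_eventually (Eventually.of_forall fun z => ?_)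
      exact smul_comm c _ (h z)

theorem mem_constGerms {k : ℕ} {c : ℝ} {g : SymbGerm (Fin k)} (hg : IsSimpleMeroGerm 0 c g) :
    g ∈ constGerms k := by
  obtain ⟨U, τ, P, hU, h0, hτ, hP, rfl⟩ := hg
  obtain ⟨a, ha⟩ := hτ.exists_holExp hU
  have hc : affOrder (0 : Fin k →₀ ℝ) c = fun _ => (c : ℂ) := by funext z; simp [affOrder]
  rw [hc] at ha
  refine ⟨U, τ, _, P, {c}, hU, h0, ha.unifExp hU, hP, fun β hβ => ?_, rfl⟩
  funext z
  refine coefAt_eq_zero fun j hj => hβ c (Finset.mem_singleton_self c) (-j) ?_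
  rw [← hj]
  push_cast
  ring

end ConstantOrders

/-! ### Generators of `Ω` on a space of linear forms -/

section Generators

variable {k : ℕ}

/-- The three kinds of holomorphic families from which the germs in `Ω` are built: smoothing
families, simple families whose order has a nonzero linear part in `W`, and monomials. -/
def IsBasicFam (W : Submodule ℝ (Fin k →₀ ℝ)) (U : Set (Fin k → ℂ))
    (τ : (Fin k → ℂ) → ℝ≥0 → ℂ) : Prop :=
  SmoothingFam U τ ∨ (∃ L ∈ W, L ≠ 0 ∧ ∃ c, IsSimpleHolFamily U L c τ) ∨
    ∃ (n : ℕ) (h : (Fin k → ℂ) → ℂ), AnalyticOnNhd ℂ h U ∧ τ = fun z => h z • npowFun n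

/-- The germs `τ / (ℓ₁ ⋯ ℓₙ)` with `τ` as in `IsBasicFam`. -/
def basicGerms (k : ℕ) (W : Submodule ℝ (Fin k →₀ ℝ)) : Set (SymbGerm (Fin k)) :=
  {g | ∃ (U : Set (Fin k → ℂ)) (τ : (Fin k → ℂ) → ℝ≥0 → ℂ) (P : List (Fin k →₀ ℝ)),
    IsOpen U ∧ 0 ∈ U ∧ IsBasicFam W U τ ∧ (∀ p ∈ P, p ≠ 0) ∧
      g = ((fun z => (polarProd P z)⁻¹ • τ z : (Fin k → ℂ) → ℝ≥0 → ℂ) : SymbGerm (Fin k))}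

/-- A germ with constant exponents that contains no real powers except natural ones is a polynomial
in `x` up to a smoothing family. -/
theorem mem_span_basicGerms_of_mem_constGerms {g : SymbGerm (Fin k)} (hg : g ∈ constGerms k)
    (hnat : ∀ r, g ∈ natGerms (Fin k) r) : g ∈ Submodule.span ℂ (basicGerms k ⊤) := by
  obtain ⟨U, h, B, P, C, hU, h0, hB, hP, hC, rfl⟩ := hg
  -- by uniqueness of expansions, the coefficients of nonnatural powers vanish generically
  have hgen : ∀ᶠ z in polarNhds (Fin k), ∀ β : {β : ℂ // ∀ n : ℕ, β ≠ n}, B β.1 z = 0 := by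
    have hall : ∀ᶠ z in polarNhds (Fin k), ∀ c ∈ C,
        ∃ κ, HasCoefs ((polarProd P z)⁻¹ • h z) κ ∧ NatOn c κ :=
      (eventually_all_finset C).2 fun c _ => mem_natGerms_coe.1 (hnat c)
    filter_upwards [hall, polarNhds_le_nhds (hU.mem_nhds h0),
      eventually_polar_linForm_ne_zero hP] with z hz hzU hzP β
    by_cases hβ : ∃ c ∈ C, ∃ n : ℤ, β.1 = ((c + n : ℝ) : ℂ)
    · obtain ⟨c, hc, n, hn⟩ := hβ
      obtain ⟨κ, hκ, hκn⟩ := hz c hc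
      have h1 := (hB.hasCoefs hzU).smul (polarProd P z)⁻¹
      have h2 := congrFun (h1.unique hκ) β.1
      rw [hn, hκn n (fun m => hn ▸ β.2 m), ← hn] at h2
      simpa [polarProd_ne_zero hzP] using h2
    · push Not at hβ
      exact congrFun (hC β.1 hβ) z
  obtain ⟨V, hVU, hV, hV0, hBV⟩ := exists_open_forall_eq_zero hU h0
    (f := fun β : {β : ℂ // ∀ n : ℕ, β ≠ n} => B β.1) (fun β => (hB.1 β.1).continuousOn) hgen
  obtain ⟨s, hs⟩ := (hB.mono_set hVU).exists_smoothing hV fun β hβ z hz => hBV ⟨β, hβ⟩ z hz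
  have hbasic : ∀ τ : (Fin k → ℂ) → ℝ≥0 → ℂ, IsBasicFam ⊤ V τ →
      ((fun z => (polarProd P z)⁻¹ • τ z : (Fin k → ℂ) → ℝ≥0 → ℂ) : SymbGerm (Fin k)) ∈
        Submodule.span ℂ (basicGerms k ⊤) := fun τ hτ =>
    Submodule.subset_span ⟨V, τ, P, hV, hV0, hτ, hP, rfl⟩
  have hsum : ∀ s : Finset ℕ, ((fun z => (polarProd P z)⁻¹ • ∑ n ∈ s, B n z • npowFun n :
      (Fin k → ℂ) → ℝ≥0 → ℂ) : SymbGerm (Fin k)) ∈ Submodule.span ℂ (basicGerms k ⊤) := by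
    classical
    intro s
    induction s using Finset.induction_on with
    | empty =>
      simp only [Finset.sum_empty, smul_zero]
      exact zero_mem (Submodule.span ℂ (basicGerms k ⊤))
    | insert n s hn ih =>
      simp only [Finset.sum_insert hn, smul_add]
      exact add_mem (hbasic _ (Or.inr (Or.inr ⟨n, B n, (hB.1 n).mono hVU, rfl⟩))) ih
  convert add_mem (hbasic _ (Or.inl hs)) (hsum s) using 1
  refine germ_eq_of_eventually (Eventually.of_forall fun z => ?_)
  simp only [← smul_add, add_assoc, ← Finset.sum_add_distrib, ← add_smul, neg_add_cancel, zero_smul,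
    Finset.sum_const_zero, add_zero]

/-- If a germ in `Ω` depends on the forms in the range of `A`, then it is the pull-back by `A` of a
combination of basic germs: the parts of constant order of its representation in
`𝓜𝓢(ℂᵐ)` add up to a polynomial with meromorphic coefficients and a smoothing family. -/
theorem mem_span_basicGerms {m : ℕ} (A : (Fin m →₀ ℝ) →ₗ[ℝ] (ℕ →₀ ℝ)) (hA : Function.Injective A)
    {τ : SymbGerm (Fin m)} (hτ : τ ∈ meroSymb m) (hΩ : pullGerm A hA τ ∈ Omega) :
    τ ∈ Submodule.span ℂ (basicGerms m ⊤) := by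
  set N : Submodule ℂ (SymbGerm (Fin m)) :=
    Submodule.span ℂ {g | ∃ L c, L ≠ 0 ∧ IsSimpleMeroGerm L c g} with hN
  have hsplit : meroSymb m ≤ N ⊔ constGerms m := by
    refine Submodule.span_le.2 ?_
    rintro g ⟨L, c, hg⟩
    rcases eq_or_ne L 0 with rfl | hL
    · exact Submodule.mem_sup_right (mem_constGerms hg)
    · exact Submodule.mem_sup_left (Submodule.subset_span ⟨L, c, hL, hg⟩)
  have hNb : N ≤ Submodule.span ℂ (basicGerms m ⊤) := by
    refine Submodule.span_mono ?_
    rintro g ⟨L, c, hL, U, τ, P, hU, h0, hτ, hP, rfl⟩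
    exact ⟨U, τ, P, hU, h0, Or.inr (Or.inl ⟨L, trivial, hL, c, hτ⟩), hP, rfl⟩
  have hNn : ∀ r, N ≤ natGerms (Fin m) r := fun r => Submodule.span_le.2 fun g ⟨L, c, hL, hg⟩ =>
    mem_natGerms_of_ne_zero hL hg r
  obtain ⟨ν, hν, κ, hκ, rfl⟩ := Submodule.mem_sup.1 (hsplit hτ)
  refine add_mem (hNb hν) (mem_span_basicGerms_of_mem_constGerms hκ fun r => ?_)
  have h1 := (pullGerm_mem_natGerms_iff A hA).1 (Omega_le_natGerms r hΩ)
  simpa using sub_mem h1 (hNn r hν)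

theorem pullGerm_mem_span_basicGerms {m : ℕ} (A : (Fin m →₀ ℝ) →ₗ[ℝ] (Fin k →₀ ℝ))
    (hA : Function.Injective A) {τ : SymbGerm (Fin m)}
    (hτ : τ ∈ Submodule.span ℂ (basicGerms m ⊤)) :
    pullGerm A hA τ ∈ Submodule.span ℂ (basicGerms k (LinearMap.range A)) := by
  have : Submodule.span ℂ (basicGerms m ⊤) ≤
      (Submodule.span ℂ (basicGerms k (LinearMap.range A))).comap (pullGerm A hA) := by
    refine Submodule.span_le.2 ?_
    rintro _ ⟨U, τ, P, hU, h0, hτ, hP, rfl⟩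
    have hV := hU.preimage (continuous_pullMap A)
    refine Submodule.subset_span ⟨pullMap A ⁻¹' U, fun y => τ (pullMap A y), P.map A, hV,
      by simpa using h0, ?_, ?_, ?_⟩
    · rcases hτ with hτ | ⟨L, -, hL, c, hτ⟩ | ⟨n, h, hh, rfl⟩
      · exact Or.inl fun M => (hτ M).comp (analyticOnNhd_pullMap A _) fun _ h => h
      · refine Or.inr (Or.inl ⟨A L, ⟨L, rfl⟩, fun h => hL (hA (by simpa using h)), c, ?_⟩)
        simpa [realPt_zero] using hτ.comp_slice hU A 0 hV
          (fun y hy => by simpa [realPt_zero] using hy)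
      · exact Or.inr (Or.inr ⟨n, fun y => h (pullMap A y),
          hh.comp (analyticOnNhd_pullMap A _) fun _ h => h, rfl⟩)
    · simp only [List.mem_map, forall_exists_index, and_imp, forall_apply_eq_imp_iff₂]
      exact fun p hp h0 => hP p hp (hA (by simpa using h0))
    · simp only [pullGerm_coe, polarProd_pullMap]
  exact this hτ

/-- Basic germs in at least one variable belong to `Ω`; a smoothing family may be regarded as a
family of nonconstant affine order. -/
theorem pullGerm_mem_Omega (hk : 1 ≤ k) {g : SymbGerm (Fin k)}
    (hg : g ∈ Submodule.span ℂ (basicGerms k ⊤)) :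
    pullGerm (inclForms k) (inclForms_injective k) g ∈ Omega := by
  have : Submodule.span ℂ (basicGerms k ⊤) ≤
      Omega.comap (pullGerm (inclForms k) (inclForms_injective k)) := by
    refine Submodule.span_le.2 ?_
    rintro _ ⟨U, τ, P, hU, h0, hτ | ⟨L, -, hL, c, hτ⟩ | ⟨n, h, hh, rfl⟩, hP, rfl⟩
    · have hL : (Finsupp.single (⟨0, hk⟩ : Fin k) 1 : Fin k →₀ ℝ) ≠ 0 := by simp
      exact pullGerm_mem_Omega_of_ne_zero hL (c := 0)
        ⟨U, τ, P, hU, h0, hτ.isSimpleHolFamily hU _ _, hP, rfl⟩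
    · exact pullGerm_mem_Omega_of_ne_zero hL ⟨U, τ, P, hU, h0, hτ, hP, rfl⟩
    · have h1 : ((fun z => (polarProd P z)⁻¹ • h z • npowFun n : (Fin k → ℂ) → ℝ≥0 → ℂ) :
          SymbGerm (Fin k)) = mulPow n ((fun z => (polarProd P z)⁻¹ * h z : (Fin k → ℂ) → ℂ) :
            FunGerm (Fin k)) := by
        simp only [mulPow_coe, smul_smul]
      change pullGerm _ _ _ ∈ Omega
      rw [h1, pullGerm_mulPow]
      exact mulPow_mem_Omega n (Submodule.subset_span (mem_limitGerms_iff.2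
        ⟨k, _, inv_polarProd_mul_mem_meroFun h0 hh hP, rfl⟩))
  exact this hg

/-! ### Products of basic germs in independent variables -/

/-- `τ` is a basic family as in `IsBasicFam`, and `f` its finite part at generic points: only the
monomials of degree `0` contribute. -/
def IsBasicFp (W : Submodule ℝ (Fin k →₀ ℝ)) (U : Set (Fin k → ℂ))
    (τ : (Fin k → ℂ) → ℝ≥0 → ℂ) (f : (Fin k → ℂ) → ℂ) : Prop :=
  (SmoothingFam U τ ∧ f = 0) ∨ ((∃ L ∈ W, L ≠ 0 ∧ ∃ c, IsSimpleHolFamily U L c τ) ∧ f = 0) ∨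
    ∃ (n : ℕ) (h : (Fin k → ℂ) → ℂ), AnalyticOnNhd ℂ h U ∧ (τ = fun z => h z • npowFun n) ∧
      f = if n = 0 then h else 0

theorem IsBasicFam.exists_isBasicFp {W : Submodule ℝ (Fin k →₀ ℝ)} {U : Set (Fin k → ℂ)}
    {τ : (Fin k → ℂ) → ℝ≥0 → ℂ} (h : IsBasicFam W U τ) : ∃ f, IsBasicFp W U τ f := by
  rcases h with h | h | ⟨n, h, hh, rfl⟩
  · exact ⟨0, Or.inl ⟨h, rfl⟩⟩
  · exact ⟨0, Or.inr (Or.inl ⟨h, rfl⟩)⟩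
  · exact ⟨_, Or.inr (Or.inr ⟨n, h, hh, rfl, rfl⟩)⟩

theorem IsBasicFp.isBasicFam {W : Submodule ℝ (Fin k →₀ ℝ)} {U : Set (Fin k → ℂ)}
    {τ : (Fin k → ℂ) → ℝ≥0 → ℂ} {f : (Fin k → ℂ) → ℂ} (h : IsBasicFp W U τ f) :
    IsBasicFam W U τ := by
  rcases h with ⟨h, -⟩ | ⟨h, -⟩ | ⟨n, h, hh, rfl, -⟩
  · exact Or.inl h
  · exact Or.inr (Or.inl h)
  · exact Or.inr (Or.inr ⟨n, h, hh, rfl⟩)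

theorem IsBasicFp.hasFp {W : Submodule ℝ (Fin k →₀ ℝ)} {U : Set (Fin k → ℂ)} (hU : IsOpen U)
    (h0 : 0 ∈ U) {τ : (Fin k → ℂ) → ℝ≥0 → ℂ} {f : (Fin k → ℂ) → ℂ} (h : IsBasicFp W U τ f)
    {P : List (Fin k →₀ ℝ)} (hP : ∀ p ∈ P, p ≠ 0) :
    HasFp ((fun z => (polarProd P z)⁻¹ • τ z : (Fin k → ℂ) → ℝ≥0 → ℂ) : SymbGerm (Fin k))
      ((fun z => (polarProd P z)⁻¹ * f z : (Fin k → ℂ) → ℂ) : FunGerm (Fin k)) := by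
  rcases h with ⟨h, rfl⟩ | ⟨⟨L, -, hL, c, h⟩, rfl⟩ | ⟨n, h, hh, rfl, rfl⟩
  · refine hasFp_coe.2 ?_
    filter_upwards [polarNhds_le_nhds (hU.mem_nhds h0)] with z hz
    refine IsFinitePart.smul _ ?_
    convert (h.hasExpansion_zero hz).isFinitePart using 1
    have := coefAt_sub_natCast 0 0 0
    simp only [Nat.cast_zero, sub_zero] at this
    simp [this]
  · simp only [Pi.zero_apply, mul_zero]
    exact hasFp_of_ne_zero hL ⟨U, τ, P, hU, h0, h, hP, rfl⟩
  · refine hasFp_coe.2 (Eventually.of_forall fun z => ?_)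
    have h1 := (isFinitePart_smul_npowFun (h z) n).smul (polarProd P z)⁻¹
    convert h1 using 2
    split_ifs <;> rfl

theorem npowFun_add (n m : ℕ) : npowFun (n + m) = npowFun n * npowFun m := by
  funext x
  simp [npowFun, pow_add]

theorem IsBasicFp.exists_isSimpleHolFamily {W : Submodule ℝ (Fin k →₀ ℝ)} {U : Set (Fin k → ℂ)}
    (hU : IsOpen U) {τ : (Fin k → ℂ) → ℝ≥0 → ℂ} {f : (Fin k → ℂ) → ℂ} (h : IsBasicFp W U τ f) :
    ∃ L c, IsSimpleHolFamily U L c τ := by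
  rcases h with ⟨h, -⟩ | ⟨⟨L, -, -, c, h⟩, -⟩ | ⟨n, h, hh, rfl, -⟩
  · exact ⟨0, 0, h.isSimpleHolFamily hU 0 0⟩
  · exact ⟨L, c, h⟩
  · exact ⟨0, n, isSimpleHolFamily_npowFun hU hh n⟩

/-- The product of basic families whose orders involve independent linear forms is basic, and its
finite part is the product of the finite parts: sums of nonzero forms in independent spaces do not
vanish, so that all products involving a nonconstant order have nonconstant order again. -/
theorem IsBasicFp.mul {W₁ W₂ : Submodule ℝ (Fin k →₀ ℝ)} (hW : Disjoint W₁ W₂)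
    {U : Set (Fin k → ℂ)} (hU : IsOpen U) {τ₁ τ₂ : (Fin k → ℂ) → ℝ≥0 → ℂ}
    {f₁ f₂ : (Fin k → ℂ) → ℂ} (h₁ : IsBasicFp W₁ U τ₁ f₁) (h₂ : IsBasicFp W₂ U τ₂ f₂) :
    IsBasicFp ⊤ U (τ₁ * τ₂) (f₁ * f₂) := by
  obtain ⟨L₁, c₁, hs₁⟩ := h₁.exists_isSimpleHolFamily hU
  obtain ⟨L₂, c₂, hs₂⟩ := h₂.exists_isSimpleHolFamily hU
  rcases h₁ with ⟨h₁, rfl⟩ | h₁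
  · exact Or.inl ⟨h₁.mul hU hs₂, zero_mul _⟩
  rcases h₂ with ⟨h₂, rfl⟩ | h₂
  · exact Or.inl ⟨mul_comm τ₂ τ₁ ▸ h₂.mul hU hs₁, mul_zero _⟩
  rcases h₁ with ⟨⟨L, hL, hL0, c, h₁⟩, rfl⟩ | ⟨n, a, ha, rfl, rfl⟩ <;>
  rcases h₂ with ⟨⟨L', hL', hL0', c', h₂⟩, rfl⟩ | ⟨n', a', ha', rfl, rfl⟩
  · refine Or.inr (Or.inl ⟨⟨L + L', trivial, fun h => hL0 ?_, _, h₁.mul hU h₂⟩, zero_mul _⟩)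
    have : L = -L' := eq_neg_of_add_eq_zero_left h
    exact Submodule.disjoint_def.1 hW L hL (this ▸ neg_mem hL')
  · refine Or.inr (Or.inl ⟨⟨L + 0, trivial, by simpa using hL0, _,
      h₁.mul hU (isSimpleHolFamily_npowFun hU ha' n')⟩, zero_mul _⟩)
  · refine Or.inr (Or.inl ⟨⟨0 + L', trivial, by simpa using hL0', _,
      (isSimpleHolFamily_npowFun hU ha n).mul hU h₂⟩, mul_zero _⟩)
  · refine Or.inr (Or.inr ⟨n + n', a * a', ha.mul ha', ?_, ?_⟩)
    · funext z
      simp only [Pi.mul_apply, npowFun_add, smul_mul_smul_comm]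
    · by_cases hn : n = 0 <;> by_cases hn' : n' = 0 <;> simp [hn, hn']

theorem IsBasicFam.mono_set {W : Submodule ℝ (Fin k →₀ ℝ)} {U V : Set (Fin k → ℂ)} (hU : IsOpen U)
    (hV : IsOpen V) (hVU : V ⊆ U) {τ : (Fin k → ℂ) → ℝ≥0 → ℂ} (h : IsBasicFam W U τ) :
    IsBasicFam W V τ := by
  rcases h with h | ⟨L, hL, hL0, c, h⟩ | ⟨n, h, hh, rfl⟩
  · exact Or.inl fun M => (h M).mono_set hVU
  · exact Or.inr (Or.inl ⟨L, hL, hL0, c, h.mono_set hU hV hVU⟩)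
  · exact Or.inr (Or.inr ⟨n, h, hh.mono hVU, rfl⟩)

theorem germ_mul_smul {X R : Type*} [Ring R] [Algebra ℂ R] {l : Filter X} (c : ℂ)
    (f g : Germ l R) : f * c • g = c • (f * g) := by
  induction f, g using Germ.inductionOn₂ with
  | h f g => exact congrArg Germ.ofFun (mul_smul_comm c f g)

theorem germ_smul_mul {X R : Type*} [Ring R] [Algebra ℂ R] {l : Filter X} (c : ℂ)
    (f g : Germ l R) : c • f * g = c • (f * g) := by
  induction f, g using Germ.inductionOn₂ with
  | h f g => exact congrArg Germ.ofFun (smul_mul_assoc c f g)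

/-- Products of basic germs in independent variables, with their finite parts. -/
theorem mul_mem_span_basicGerms {W₁ W₂ : Submodule ℝ (Fin k →₀ ℝ)} (hW : Disjoint W₁ W₂)
    {g₁ g₂ : SymbGerm (Fin k)} (h₁ : g₁ ∈ Submodule.span ℂ (basicGerms k W₁))
    (h₂ : g₂ ∈ Submodule.span ℂ (basicGerms k W₂)) :
    g₁ * g₂ ∈ Submodule.span ℂ (basicGerms k ⊤) ∧
      ∃ f₁ f₂, HasFp g₁ f₁ ∧ HasFp g₂ f₂ ∧ HasFp (g₁ * g₂) (f₁ * f₂) := by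
  induction h₁ using Submodule.span_induction with
  | mem g₁ h₁ =>
    induction h₂ using Submodule.span_induction with
    | mem g₂ h₂ =>
      obtain ⟨U, τ, P, hU, h0, hτ, hP, rfl⟩ := h₁
      obtain ⟨U', τ', P', hU', h0', hτ', hP', rfl⟩ := h₂
      have hUU := hU.inter hU'
      obtain ⟨f, hf⟩ := (hτ.mono_set hU hUU Set.inter_subset_left).exists_isBasicFp
      obtain ⟨f', hf'⟩ := (hτ'.mono_set hU' hUU Set.inter_subset_right).exists_isBasicFp
      have hPP : ∀ p ∈ P ++ P', p ≠ 0 := by simpa [or_imp, forall_and] using ⟨hP, hP'⟩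
      have hmul := hf.mul hW hUU hf'
      have heq : ((fun z => (polarProd P z)⁻¹ • τ z : (Fin k → ℂ) → ℝ≥0 → ℂ) : SymbGerm (Fin k)) *
          ((fun z => (polarProd P' z)⁻¹ • τ' z : (Fin k → ℂ) → ℝ≥0 → ℂ) : SymbGerm (Fin k)) =
          ((fun z => (polarProd (P ++ P') z)⁻¹ • (τ * τ') z : (Fin k → ℂ) → ℝ≥0 → ℂ) :
            SymbGerm (Fin k)) := by
        refine germ_eq_of_eventually (Eventually.of_forall fun z => ?_)
        simp only [Pi.mul_apply, polarProd_append, mul_inv, smul_mul_smul_comm]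
      have heqf : ((fun z => (polarProd P z)⁻¹ * f z : (Fin k → ℂ) → ℂ) : FunGerm (Fin k)) *
          ((fun z => (polarProd P' z)⁻¹ * f' z : (Fin k → ℂ) → ℂ) : FunGerm (Fin k)) =
          ((fun z => (polarProd (P ++ P') z)⁻¹ * (f * f') z : (Fin k → ℂ) → ℂ) :
            FunGerm (Fin k)) := by
        refine germ_eq_of_eventually (Eventually.of_forall fun z => ?_)
        simp only [Pi.mul_apply, polarProd_append, mul_inv]
        ring
      rw [heq]
      refine ⟨Submodule.subset_span ⟨U ∩ U', τ * τ', P ++ P', hUU, ⟨h0, h0'⟩, hmul.isBasicFam, hPP,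
        rfl⟩, _, _, hf.hasFp hUU ⟨h0, h0'⟩ hP, hf'.hasFp hUU ⟨h0, h0'⟩ hP', ?_⟩
      rw [heqf]
      exact hmul.hasFp hUU ⟨h0, h0'⟩ hPP
    | zero =>
      obtain ⟨U, τ, P, hU, h0, hτ, hP, rfl⟩ := h₁
      obtain ⟨f, hf⟩ := hτ.exists_isBasicFp
      rw [mul_zero]
      exact ⟨zero_mem _, _, 0, hf.hasFp hU h0 hP, hasFp_zero, by rw [mul_zero]; exact hasFp_zero⟩
    | add g g' _ _ h h' =>
      obtain ⟨hm, f₁, f, hf₁, hf, hp⟩ := h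
      obtain ⟨hm', f₁', f', hf₁', hf', hp'⟩ := h'
      obtain rfl : f₁ = f₁' := hf₁.map_eq.symm.trans hf₁'.map_eq
      rw [mul_add]
      exact ⟨add_mem hm hm', f₁, f + f', hf₁, hf.add hf', by rw [mul_add]; exact hp.add hp'⟩
    | smul c g _ h =>
      obtain ⟨hm, f₁, f, hf₁, hf, hp⟩ := h
      rw [germ_mul_smul]
      exact ⟨Submodule.smul_mem _ c hm, f₁, c • f, hf₁, hf.smul c, by
        rw [germ_mul_smul]; exact hp.smul c⟩
  | zero =>
    obtain ⟨f₂, -, hf₂⟩ := exists_hasFp_of_span (M := ⊤) (fun g hg => by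
      obtain ⟨U, τ, P, hU, h0, hτ, hP, rfl⟩ := hg
      obtain ⟨f, hf⟩ := hτ.exists_isBasicFp
      exact ⟨_, trivial, hf.hasFp hU h0 hP⟩) h₂
    rw [zero_mul]
    exact ⟨zero_mem _, 0, f₂, hasFp_zero, hf₂, by rw [zero_mul]; exact hasFp_zero⟩
  | add g g' _ _ h h' =>
    obtain ⟨hm, f, f₂, hf, hf₂, hp⟩ := h
    obtain ⟨hm', f', f₂', hf', hf₂', hp'⟩ := h'
    obtain rfl : f₂ = f₂' := hf₂.map_eq.symm.trans hf₂'.map_eq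
    rw [add_mul]
    exact ⟨add_mem hm hm', f + f', f₂, hf.add hf', hf₂, by rw [add_mul]; exact hp.add hp'⟩
  | smul c g _ h =>
    obtain ⟨hm, f, f₂, hf, hf₂, hp⟩ := h
    rw [germ_smul_mul]
    exact ⟨Submodule.smul_mem _ c hm, c • f, f₂, hf.smul c, hf₂, by
      rw [germ_smul_mul]; exact hp.smul c⟩

/-- `Ω` contains the product of two of its germs which depend on independent spaces of linear forms,
and the finite part is multiplicative on them. -/
theorem mul_mem_Omega {σ₁ σ₂ : SymbGerm ℕ} (h₁ : σ₁ ∈ Omega) (h₂ : σ₂ ∈ Omega)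
    {W₁ W₂ : Submodule ℝ (ℕ →₀ ℝ)} (hW : Disjoint W₁ W₂) (hd₁ : DependsOn meroSymb σ₁ W₁)
    (hd₂ : DependsOn meroSymb σ₂ W₂) :
    σ₁ * σ₂ ∈ Omega ∧ fpInf (σ₁ * σ₂) = fpInf σ₁ * fpInf σ₂ := by
  classical
  obtain ⟨m₁, A₁, hA₁, rfl, τ₁, hτ₁, rfl⟩ := dependsOn_iff.1 hd₁
  obtain ⟨m₂, A₂, hA₂, rfl, τ₂, hτ₂, rfl⟩ := dependsOn_iff.1 hd₂
  have hb₁ := mem_span_basicGerms A₁ hA₁ hτ₁ h₁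
  have hb₂ := mem_span_basicGerms A₂ hA₂ hτ₂ h₂
  -- both germs involve only the first `k` variables
  obtain ⟨k, hk, hrange⟩ := exists_range_inclForms
    ((Finset.univ.image fun i => A₁ (Finsupp.single i 1)) ∪
      Finset.univ.image fun i => A₂ (Finsupp.single i 1))
  obtain ⟨R, hR⟩ := (inclForms k).exists_leftInverse_of_injective
    (LinearMap.ker_eq_bot.2 (inclForms_injective k))
  have hfac : ∀ {m : ℕ} (A : (Fin m →₀ ℝ) →ₗ[ℝ] (ℕ →₀ ℝ)),
      (∀ i, A (Finsupp.single i 1) ∈ LinearMap.range (inclForms k)) →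
        inclForms k ∘ₗ (R ∘ₗ A) = A := fun A hA => by
    ext i : 2
    obtain ⟨u, hu⟩ := hA i
    have : R (inclForms k u) = u := LinearMap.congr_fun hR u
    simp [← hu, this]
  have hf₁ := hfac A₁ fun i => hrange _ (by simp)
  have hf₂ := hfac A₂ fun i => hrange _ (by simp)
  have hi₁ : Function.Injective (R ∘ₗ A₁) := Function.Injective.of_comp (f := inclForms k)
    (hf₁.symm ▸ hA₁ : Function.Injective (inclForms k ∘ₗ (R ∘ₗ A₁)))
  have hi₂ : Function.Injective (R ∘ₗ A₂) := Function.Injective.of_comp (f := inclForms k)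
    (hf₂.symm ▸ hA₂ : Function.Injective (inclForms k ∘ₗ (R ∘ₗ A₂)))
  have hdisj : Disjoint (LinearMap.range (R ∘ₗ A₁)) (LinearMap.range (R ∘ₗ A₂)) := by
    refine Submodule.disjoint_def.2 ?_
    rintro _ ⟨u, rfl⟩ ⟨v, hv⟩
    have h1 : A₁ u = inclForms k ((R ∘ₗ A₁) u) := (LinearMap.congr_fun hf₁ u).symm
    have h2 : A₂ v = inclForms k ((R ∘ₗ A₂) v) := (LinearMap.congr_fun hf₂ v).symm
    have h3 : A₁ u = 0 := Submodule.disjoint_def.1 hW _ ⟨u, rfl⟩ ⟨v, by rw [h1, h2, hv]⟩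
    simp [h3]
  obtain ⟨hm, f₁, f₂, hp₁, hp₂, hp⟩ := mul_mem_span_basicGerms hdisj
    (pullGerm_mem_span_basicGerms _ hi₁ hb₁) (pullGerm_mem_span_basicGerms _ hi₂ hb₂)
  have he₁ : pullGerm A₁ hA₁ τ₁ = pullGerm (inclForms k) (inclForms_injective k)
      (pullGerm (R ∘ₗ A₁) hi₁ τ₁) := by
    rw [pullGerm_pullGerm]
    simp only [hf₁]
  have he₂ : pullGerm A₂ hA₂ τ₂ = pullGerm (inclForms k) (inclForms_injective k)
      (pullGerm (R ∘ₗ A₂) hi₂ τ₂) := by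
    rw [pullGerm_pullGerm]
    simp only [hf₂]
  rw [he₁, he₂, ← pullGerm_mul]
  refine ⟨pullGerm_mem_Omega hk hm, ?_⟩
  rw [fpInf, fpInf, fpInf, (hp.pullGerm _ _).map_eq, (hp₁.pullGerm _ _).map_eq,
    (hp₂.pullGerm _ _).map_eq, pullGerm_mul]

end Generators

end LocSymb

/-! ### The finite part as a morphism of locality algebras -/

open LocSymb

theorem proposition4p17 (Q : LinearMap.BilinForm ℝ (ℕ →₀ ℝ))
    (hQsymm : ∀ u v, Q u v = Q v u) (hQpos : ∀ v, v ≠ 0 → 0 < Q v v) :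
    ∃ fp : Omega →ₗ[ℂ] meroFunInf,
      (∀ σ : Omega, (fp σ : FunGerm ℕ) = fpInf (σ : SymbGerm ℕ)) ∧
      (∃ h : (1 : SymbGerm ℕ) ∈ Omega, (fp ⟨1, h⟩ : FunGerm ℕ) = 1) ∧
      ∀ σ₁ σ₂ : Omega, Indep meroSymb Q (σ₁ : SymbGerm ℕ) (σ₂ : SymbGerm ℕ) →
        Indep meroFun Q (fp σ₁ : FunGerm ℕ) (fp σ₂ : FunGerm ℕ) ∧
        ∃ h : (σ₁ : SymbGerm ℕ) * (σ₂ : SymbGerm ℕ) ∈ Omega,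
          (fp ⟨(σ₁ : SymbGerm ℕ) * (σ₂ : SymbGerm ℕ), h⟩ : FunGerm ℕ)
            = (fp σ₁ : FunGerm ℕ) * (fp σ₂ : FunGerm ℕ) := by
  have hfp : ∀ g ∈ Omega, HasFp g (fpInf g) ∧ fpInf g ∈ meroFunInf := fun g hg => by
    obtain ⟨f, hf, h⟩ := exists_hasFp_of_mem_Omega hg
    have : fpInf g = f := h.map_eq
    exact this ▸ ⟨h, hf⟩
  have hone : (1 : SymbGerm ℕ) ∈ Omega := mulPow_zero_one ▸ mulPow_mem_Omega 0 one_mem_meroFunInf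
  refine ⟨{ toFun := fun σ => ⟨fpInf σ, (hfp σ σ.2).2⟩
            map_add' := fun σ τ => Subtype.ext
              (((hfp σ σ.2).1.add (hfp τ τ.2).1).map_eq)
            map_smul' := fun c σ => Subtype.ext (((hfp σ σ.2).1.smul c).map_eq) },
    fun σ => rfl, ⟨hone, ?_⟩, fun σ₁ σ₂ hind => ?_⟩
  · have h1 : HasFp (1 : SymbGerm ℕ) 1 := by
      simpa [mulPow_zero_one] using hasFp_mulPow 0 (1 : FunGerm ℕ)
    exact h1.map_eq
  · have hdep : ∀ σ : SymbGerm ℕ, depSpace meroFun (fpInf σ) ≤ depSpace meroSymb σ := fun σ =>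
      sInf_le_sInf fun W hW => DependsOn.map_finitePart hW
    have hdisj : Disjoint (depSpace meroSymb (σ₁ : SymbGerm ℕ))
        (depSpace meroSymb (σ₂ : SymbGerm ℕ)) := by
      refine Submodule.disjoint_def.2 fun v hv₁ hv₂ => ?_
      by_contra hv
      exact (hQpos v hv).ne' (hind v hv₁ v hv₂)
    obtain ⟨hmem, hmul⟩ := mul_mem_Omega σ₁.2 σ₂.2 hdisj
      (dependsOn_depSpace (exists_dependsOn_of_mem_Omega σ₁.2))
      (dependsOn_depSpace (exists_dependsOn_of_mem_Omega σ₂.2))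
    exact ⟨fun u hu v hv => hind u (hdep _ hu) v (hdep _ hv), hmem, hmul⟩
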